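/- **Proposition.** Let $k$ be a field and let $(H,\mathcal R,\nu)$ be a ribbon quantum groupoid over $k$: a finite-dimensional $k$-vector space $H$ that is an algebra and a coalgebra $(\Delta,\varepsilon)$ with $\Delta$ multiplicative, $(\Delta\otimes\mathrm{id})\Delta(1)=(\Delta(1)\otimes1)(1\otimes\Delta(1))=(1\otimes\Delta(1))(\Delta(1)\otimes1)$, $\varepsilon(fgh)=\varepsilon(fg_{(1)})\varepsilon(g_{(2)}h)=\varepsilon(fg_{(2)})\varepsilon(g_{(1)}h)$, and an antipode $S$ (an anti-homomorphism of algebras and coalgebras with $h_{(1)}S(h_{(2)})=(\varepsilon\otimes\mathrm{id})(\Delta(1)(h\otimes1))=:\varepsilon_t(h)$ and $S(h_{(1)})h_{(2)}=(\mathrm{id}\otimes\varepsilon)((1\otimes h)\Delta(1))$); an element $\mathcal R\in\Delta^{op}(1)(H\otimes H)\Delta(1)$ with $\Delta^{op}(h)\mathcal R=\mathcal R\Delta(h)$, $(\mathrm{id}\otimes\Delta)\mathcal R=\mathcal R_{13}\mathcal R_{12}$, $(\Delta\otimes\mathrm{id})\mathcal R=\mathcal R_{13}\mathcal R_{23}$,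 for which some $\bar{\mathcal R}\in\Delta(1)(H\otimes H)\Delta^{op}(1)$ satisfies $\mathcal R\bar{\mathcal R}=\Delta^{op}(1)$, $\bar{\mathcal R}\mathcal R=\Delta(1)$; and an invertible central $\nu\in H$ with $\Delta(\nu)=\mathcal R_{21}\mathcal R(\nu\otimes\nu)$, $S(\nu)=\nu$. Let $\mathrm{Rep}(H)$ be the ribbon category of finite-dimensional left $H$-modules: $V\otimes W=\{x\in V\otimes_kW: x=\Delta(1)x\}$ with $H$ acting through $\Delta$; the unit object is $H_t=\varepsilon_t(H)$ with $h\cdot z=\varepsilon_t(hz)$; the associativity isomorphisms are the usual ones, and the unit isomorphisms $H_t\otimes V\to V$ and $V\otimes H_t\to V$ are the inverses of $v\mapsto 1_{(1)}\cdot 1\otimes 1_{(2)}v$ and $v\mapsto 1_{(1)}v\otimes1_{(2)}$, where $1_{(1)}\cdot1=\varepsilon_t(1_{(1)})$; $V^*=\mathrm{Hom}_k(V,k)$ with $(h\varphi)(v)=\varphi(S(h)v)$, evaluation $d_V(\varphi\otimes v)=\varphi(1_{(1)}v)1_{(2)}$ and coevaluation $b_V(z)=z\cdot\sum_if_i\otimes\xi^i$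 for dual bases $(f_i)$, $(\xi^i)$ of $V$, $V^*$; the braiding is $c_{V,W}(x)=\mathcal R^{(2)}x^{(2)}\otimes\mathcal R^{(1)}x^{(1)}$ and the twist is $\theta_V(v)=\nu v$. In a ribbon category whose Hom-sets are $k$-vector spaces, with bilinear composition and tensor product, write $\mathrm{tr}_q(f)=d_X\,c_{X,X^*}\,(\theta_Xf\otimes\mathrm{id})\,b_X\in\mathrm{End}(\mathbf 1)$ for $f\in\mathrm{End}(X)$. An object $X$ is *simple* if $k\to\mathrm{End}(X)$, $c\mapsto c\,\mathrm{id}_X$, is bijective; it is *negligible* if $\mathrm{tr}_q(f)=0$ for all $f\in\mathrm{End}(X)$; a morphism $f:X\to Y$ is *negligible* if $\mathrm{tr}_q(fg)=0$ for all $g:Y\to X$. A family $\{V_i\}_{i\in I}$ of objects *dominates* (*quasidominates*) $X$ if there are finitely many morphisms $f_r:V_{i(r)}\to X$, $g_r:X\to V_{i(r)}$ such that $\mathrm{id}_X-\sum_rf_rg_r$ is zero (negligible). Consider the following conditions on a finite family $\{V_i\}_{i\in I}$ of simple objects: 1. $V_0=\mathbf 1$ for some $0\in I$; 2. for every $i\in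 I$ there is $i^*\in I$ with $V_{i^*}\cong V_i^*$; 3. the square matrix with entries $S_{ij}=\mathrm{tr}_q(c_{V_i,V_j}\circ c_{V_j,V_i})\in\mathrm{End}(\mathbf 1)=k$ $(i,j\in I)$ is invertible over $k$. The category together with $\{V_i\}_{i\in I}$ is *modular* (*quasimodular*) if 1, 2, 3 hold and every object is dominated (quasidominated) by $\{V_i\}_{i\in I}$. The *purification* of the category has the same objects, and its morphisms are the morphisms modulo negligible ones, with the induced structure. Now let $\{V_i\}_{i\in I}$ be a finite family of finite-dimensional $H$-modules. Call $(H,\mathcal R,\nu,\{V_i\})$ a *modular quantum groupoid* if the $V_i$ are simple objects of $\mathrm{Rep}(H)$, 1, 2, 3 hold in $\mathrm{Rep}(H)$, and for all $a,b\in I$ the module $V_a\otimes V_b$ is isomorphic to the direct sum of a finite direct sum of modules $V_i$ (possibly with multiplicities) and a negligible module. Let $\mathcal C$ be the full subcategory of $\mathrm{Rep}(H)$ of the modules quasidominated by $\{V_i\}$, with the operations of $\mathrm{Rep}(H)$. Then: (a) If $(H,\mathcal R,\nu,\{V_i\})$ is a modular quantum groupoid, then $\mathcal C$ contains the unit object,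 is closed under $\otimes$ and duals (so that it is a ribbon category with the operations of $\mathrm{Rep}(H)$), and $(\mathcal C,\{V_i\})$ is quasimodular. (b) Conversely, if $\mathcal C$ contains the unit object, is closed under $\otimes$ and duals, and $(\mathcal C,\{V_i\})$ is quasimodular, then $(H,\mathcal R,\nu,\{V_i\})$ is a modular quantum groupoid. (c) In that case the purification of $\mathcal C$, together with $\{V_i\}$, is a modular category. -/

import Mathlib

open CategoryTheory MonoidalCategory
open scoped TensorProduct

universe u

/-- A (finite) quantum groupoid (weak Hopf algebra) over a field `k`. -/
class QuantumGroupoid (k H : Type u) [Field k] [Ring H] [Algebra k H] extends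
    Coalgebra k H where
  finite : Module.Finite k H
  comul_mul : ∀ a b : H, comul (a * b) = comul a * comul b
  /-- `(Δ ⊗ id)Δ(1) = (Δ(1) ⊗ 1)(1 ⊗ Δ(1))` -/
  comul_comul_one : comul.rTensor H (comul 1) =
    (comul 1 ⊗ₜ[k] (1 : H)) * (TensorProduct.assoc k H H H).symm ((1 : H) ⊗ₜ[k] comul 1)
  /-- `(Δ ⊗ id)Δ(1) = (1 ⊗ Δ(1))(Δ(1) ⊗ 1)` -/
  comul_comul_one' : comul.rTensor H (comul 1) =
    (TensorProduct.assoc k H H H).symm ((1 : H) ⊗ₜ[k] comul 1) * (comul 1 ⊗ₜ[k] (1 : H))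
  /-- `ε(fgh) = ε(f g₍₁₎) ε(g₍₂₎ h)` -/
  counit_mul_mul : ∀ f g h : H, counit (f * g * h) =
    LinearMap.mul' k k (TensorProduct.map (counit ∘ₗ LinearMap.mulLeft k f)
      (counit ∘ₗ LinearMap.mulRight k h) (comul g))
  /-- `ε(fgh) = ε(f g₍₂₎) ε(g₍₁₎ h)` -/
  counit_mul_mul' : ∀ f g h : H, counit (f * g * h) =
    LinearMap.mul' k k (TensorProduct.map (counit ∘ₗ LinearMap.mulRight k h)
      (counit ∘ₗ LinearMap.mulLeft k f) (comul g))
  /-- the antipode `S`, an anti-homomorphism of algebras and of coalgebras -/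
  antipode : H →ₗ[k] H
  antipode_one : antipode 1 = 1
  antipode_mul : ∀ a b : H, antipode (a * b) = antipode b * antipode a
  counit_antipode : ∀ a : H, counit (antipode a) = counit a
  comul_antipode : ∀ a : H, comul (antipode a) =
    TensorProduct.comm k H H (TensorProduct.map antipode antipode (comul a))
  /-- `m(id ⊗ S)Δ(h) = (ε ⊗ id)(Δ(1)(h ⊗ 1))` -/
  mul_lTensor_antipode : ∀ h : H, LinearMap.mul' k H (antipode.lTensor H (comul h)) =
    TensorProduct.lid k H (counit.rTensor H (comul 1 * (h ⊗ₜ[k] (1 : H))))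
  /-- `m(S ⊗ id)Δ(h) = (id ⊗ ε)((1 ⊗ h)Δ(1))` -/
  mul_rTensor_antipode : ∀ h : H, LinearMap.mul' k H (antipode.rTensor H (comul h)) =
    TensorProduct.rid k H (counit.lTensor H (((1 : H) ⊗ₜ[k] h) * comul 1))

namespace QuantumGroupoid

section Basic

variable (k : Type u) {H : Type u} [Field k] [Ring H] [Algebra k H] [QuantumGroupoid k H]

/-- comultiplication -/
noncomputable abbrev Δ : H →ₗ[k] H ⊗[k] H := CoalgebraStruct.comul

/-- counit -/
noncomputable abbrev ε : H →ₗ[k] k := CoalgebraStruct.counit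

/-- antipode -/
noncomputable abbrev S : H →ₗ[k] H := QuantumGroupoid.antipode

/-- the opposite comultiplication -/
noncomputable def Δop : H →ₗ[k] H ⊗[k] H := (TensorProduct.comm k H H).toLinearMap ∘ₗ Δ k

/-- the target counital map `ε_t(h) = h₍₁₎ S(h₍₂₎)` -/
noncomputable def εt : H →ₗ[k] H :=
  LinearMap.mul' k H ∘ₗ (S k).lTensor H ∘ₗ Δ k

end Basic

end QuantumGroupoid

open QuantumGroupoid in
/-- A quasitriangular quantum groupoid `(H, R)`. -/
class QuasitriangularQuantumGroupoid (k H : Type u) [Field k] [Ring H] [Algebra k H] extends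
    QuantumGroupoid k H where
  R : H ⊗[k] H
  /-- `R ∈ Δᵒᵖ(1)(H ⊗ H)Δ(1)` -/
  R_mem : ∃ x : H ⊗[k] H, R = Δop k 1 * x * Δ k 1
  Δop_mul_R : ∀ h : H, Δop k h * R = R * Δ k h
  /-- `(id ⊗ Δ)R = R₁₃R₁₂` -/
  lTensor_R : (TensorProduct.assoc k H H H).symm ((Δ k).lTensor H R) =
    TensorProduct.rightComm k H H H (R ⊗ₜ[k] (1 : H)) * (R ⊗ₜ[k] (1 : H))
  /-- `(Δ ⊗ id)R = R₁₃R₂₃` -/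
  rTensor_R : (Δ k).rTensor H R =
    TensorProduct.rightComm k H H H (R ⊗ₜ[k] (1 : H)) *
      (TensorProduct.assoc k H H H).symm ((1 : H) ⊗ₜ[k] R)
  /-- there is `R' ∈ Δ(1)(H ⊗ H)Δᵒᵖ(1)` with `RR' = Δᵒᵖ(1)` and `R'R = Δ(1)` -/
  exists_R_inv : ∃ x : H ⊗[k] H, R * (Δ k 1 * x * Δop k 1) = Δop k 1 ∧
    (Δ k 1 * x * Δop k 1) * R = Δ k 1

open QuantumGroupoid in
/-- A ribbon quantum groupoid `(H, R, ν)`. -/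
class RibbonQuantumGroupoid (k H : Type u) [Field k] [Ring H] [Algebra k H] extends
    QuasitriangularQuantumGroupoid k H where
  ν : H
  isUnit_ν : IsUnit ν
  ν_central : ∀ h : H, ν * h = h * ν
  /-- `Δ(ν) = R₂₁R(ν ⊗ ν)` -/
  Δ_ν : Δ k ν = TensorProduct.comm k H H R * R * (ν ⊗ₜ[k] ν)
  S_ν : S k ν = ν

namespace QuantumGroupoid

section Lemmas

variable {k H : Type u} [Field k] [Ring H] [Algebra k H] [QuantumGroupoid k H]

lemma Δ_mul (a b : H) : Δ k (a * b) = Δ k a * Δ k b := comul_mul a b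

lemma Δ_one_mul_Δ (a : H) : Δ k (1 : H) * Δ k a = Δ k a := by rw [← Δ_mul, one_mul]

lemma Δ_mul_Δ_one (a : H) : Δ k a * Δ k (1 : H) = Δ k a := by rw [← Δ_mul, mul_one]

lemma εt_eq (h : H) : εt k h =
    TensorProduct.lid k H ((ε k).rTensor H (Δ k 1 * (h ⊗ₜ[k] (1 : H)))) :=
  mul_lTensor_antipode h

/-- The map `x ⊗ y ↦ ε(x z) y`. -/
noncomputable def ctrL (z : H) : H ⊗[k] H →ₗ[k] H :=
  (TensorProduct.lid k H).toLinearMap ∘ₗ (ε k ∘ₗ LinearMap.mulRight k z).rTensor H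

@[simp] lemma ctrL_tmul (z a b : H) : ctrL z (a ⊗ₜ[k] b) = ε k (a * z) • b := by
  simp [ctrL]

/-- The map `x ⊗ y ↦ ε(a x) y`. -/
noncomputable def ctrL' (c : H) : H ⊗[k] H →ₗ[k] H :=
  (TensorProduct.lid k H).toLinearMap ∘ₗ (ε k ∘ₗ LinearMap.mulLeft k c).rTensor H

@[simp] lemma ctrL'_tmul (z a b : H) : ctrL' z (a ⊗ₜ[k] b) = ε k (z * a) • b := by
  simp [ctrL']

/-- The map `x ⊗ y ↦ ε(y z) x`. -/
noncomputable def ctrR (z : H) : H ⊗[k] H →ₗ[k] H :=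
  (TensorProduct.rid k H).toLinearMap ∘ₗ (ε k ∘ₗ LinearMap.mulRight k z).lTensor H

@[simp] lemma ctrR_tmul (z a b : H) : ctrR z (a ⊗ₜ[k] b) = ε k (b * z) • a := by
  simp [ctrR]

/-- The map `x ⊗ y ↦ ε(a y) x`. -/
noncomputable def ctrR' (c : H) : H ⊗[k] H →ₗ[k] H :=
  (TensorProduct.rid k H).toLinearMap ∘ₗ (ε k ∘ₗ LinearMap.mulLeft k c).lTensor H

@[simp] lemma ctrR'_tmul (z a b : H) : ctrR' z (a ⊗ₜ[k] b) = ε k (z * b) • a := by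
  simp [ctrR']

lemma εt_eq_ctrL (h : H) : εt k h = ctrL h (Δ k 1) := by
  rw [εt_eq]
  induction Δ k (1 : H) using TensorProduct.induction_on with
  | zero => simp
  | tmul a b => simp
  | add x y hx hy => rw [add_mul, map_add, map_add, map_add, hx, hy]

end Lemmas
end QuantumGroupoid

namespace QuantumGroupoid
section Lemmas2

variable {k H : Type u} [Field k] [Ring H] [Algebra k H] [QuantumGroupoid k H]

lemma counit_rid (a : H) : TensorProduct.rid k H ((ε k).lTensor H (Δ k a)) = a := by
  simp [Δ, ε]

lemma counit_lid (a : H) : TensorProduct.lid k H ((ε k).rTensor H (Δ k a)) = a := by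
  simp [Δ, ε]

lemma ctrL_one (h : H) : ctrL 1 (Δ k h) = h := by
  have : (ctrL (1 : H) : H ⊗[k] H →ₗ[k] H) =
      (TensorProduct.lid k H).toLinearMap ∘ₗ (ε k).rTensor H := by ext; simp
  rw [this]; exact counit_lid h

lemma ctrL'_one (h : H) : ctrL' 1 (Δ k h) = h := by
  have : (ctrL' (1 : H) : H ⊗[k] H →ₗ[k] H) =
      (TensorProduct.lid k H).toLinearMap ∘ₗ (ε k).rTensor H := by ext; simp
  rw [this]; exact counit_lid h

lemma ctrR_one (h : H) : ctrR 1 (Δ k h) = h := by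
  have : (ctrR (1 : H) : H ⊗[k] H →ₗ[k] H) =
      (TensorProduct.rid k H).toLinearMap ∘ₗ (ε k).lTensor H := by ext; simp
  rw [this]; exact counit_rid h

lemma ctrR'_one (h : H) : ctrR' 1 (Δ k h) = h := by
  have : (ctrR' (1 : H) : H ⊗[k] H →ₗ[k] H) =
      (TensorProduct.rid k H).toLinearMap ∘ₗ (ε k).lTensor H := by ext; simp
  rw [this]; exact counit_rid h

lemma coassoc_symm (h : H) : (Δ k).rTensor H (Δ k h) =
    (TensorProduct.assoc k H H H).symm ((Δ k).lTensor H (Δ k h)) :=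
  (Coalgebra.coassoc_symm_apply h).symm

/-- `ε(h₍₁₎z) h₍₂₎ = h ε(1₍₁₎z) 1₍₂₎` -/
lemma ctrL_Δ (z h : H) : ctrL z (Δ k h) = h * ctrL z (Δ k 1) := by
  let F (s : H ⊗[k] H) : (H ⊗[k] H) ⊗[k] H →ₗ[k] H :=
    (TensorProduct.lid k H).toLinearMap ∘ₗ TensorProduct.map (ε k ∘ₗ LinearMap.mulRight k z)
      (ctrL 1 ∘ₗ LinearMap.mulLeft k s) ∘ₗ (TensorProduct.assoc k H H H).toLinearMap
  have h1 (s t : H ⊗[k] H) : ctrL z (s * t) = F s ((Δ k).rTensor H t) := by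
    induction t using TensorProduct.induction_on with
    | zero => simp
    | add x y hx hy => rw [mul_add, map_add, map_add, map_add, hx, hy]
    | tmul c d =>
      induction s using TensorProduct.induction_on with
      | zero => simp [F]
      | add x y hx hy =>
        rw [add_mul, map_add, hx, hy]
        have : F (x + y) = F x + F y := by
          ext; simp [F, add_mul]
        rw [this]; rfl
      | tmul a b =>
        simp only [Algebra.TensorProduct.tmul_mul_tmul, ctrL_tmul, LinearMap.rTensor_tmul]
        have := counit_mul_mul' (k := k) a c z
        rw [show ε k (a * c * z) = _ from this]
        change (LinearMap.mul' k k (TensorProduct.map _ _ (Δ k c))) • _ = _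
        induction Δ k c using TensorProduct.induction_on with
        | zero => simp
        | add x y hx hy =>
          rw [map_add, map_add, add_smul, hx, hy, TensorProduct.add_tmul, map_add]
        | tmul x y => simp [F, smul_smul, mul_comm]
  have h2 (t : H ⊗[k] H) : F (Δ k h) ((TensorProduct.assoc k H H H).symm ((Δ k).lTensor H t)) =
      h * ctrL z t := by
    induction t using TensorProduct.induction_on with
    | zero => simp
    | add x y hx hy => rw [map_add, map_add, map_add, map_add, mul_add, hx, hy]
    | tmul c d => simp [F, ← Δ_mul, ctrL_one]
  rw [← Δ_mul_Δ_one h, h1, coassoc_symm, h2]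

/-- `h₍₁₎ ε(h₍₂₎z) = h 1₍₁₎ ε(1₍₂₎z)` -/
lemma ctrR_Δ (z h : H) : ctrR z (Δ k h) = h * ctrR z (Δ k 1) := by
  let F (s : H ⊗[k] H) : (H ⊗[k] H) ⊗[k] H →ₗ[k] H :=
    (TensorProduct.rid k H).toLinearMap ∘ₗ TensorProduct.map 
      (ctrR 1 ∘ₗ LinearMap.mulLeft k s) (ε k ∘ₗ LinearMap.mulRight k z)
  have h1 (s t : H ⊗[k] H) : ctrR z (s * t) =
      F s ((TensorProduct.assoc k H H H).symm ((Δ k).lTensor H t)) := by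
    induction t using TensorProduct.induction_on with
    | zero => simp
    | add x y hx hy => rw [mul_add, map_add, map_add, map_add, map_add, hx, hy]
    | tmul c d =>
      induction s using TensorProduct.induction_on with
      | zero => simp [F]
      | add x y hx hy =>
        rw [add_mul, map_add, hx, hy]
        have : F (x + y) = F x + F y := by
          ext; simp [F, add_mul, TensorProduct.add_tmul]
        rw [this]; rfl
      | tmul a b =>
        simp only [Algebra.TensorProduct.tmul_mul_tmul, ctrR_tmul, LinearMap.lTensor_tmul]
        have := counit_mul_mul (k := k) b d z
        rw [show ε k (b * d * z) = _ from this]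
        change (LinearMap.mul' k k (TensorProduct.map _ _ (Δ k d))) • _ = _
        induction Δ k d using TensorProduct.induction_on with
        | zero => simp
        | add x y hx hy =>
          rw [map_add, map_add, add_smul, hx, hy, TensorProduct.tmul_add, map_add, map_add]
        | tmul x y => simp [F, smul_smul, mul_comm]
  have h2 (t : H ⊗[k] H) : F (Δ k h) ((Δ k).rTensor H t) = h * ctrR z t := by
    induction t using TensorProduct.induction_on with
    | zero => simp
    | add x y hx hy => rw [map_add, map_add, map_add, mul_add, hx, hy]
    | tmul c d => simp [F, ← Δ_mul, ctrR_one]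
  rw [← Δ_mul_Δ_one h, h1, ← coassoc_symm, h2]

/-- `ε(c h₍₁₎) h₍₂₎ = ε(c 1₍₁₎) 1₍₂₎ h` -/
lemma ctrL'_Δ (z h : H) : ctrL' z (Δ k h) = ctrL' z (Δ k 1) * h := by
  let F (s : H ⊗[k] H) : (H ⊗[k] H) ⊗[k] H →ₗ[k] H :=
    (TensorProduct.lid k H).toLinearMap ∘ₗ TensorProduct.map (ε k ∘ₗ LinearMap.mulLeft k z)
      (ctrL 1 ∘ₗ LinearMap.mulRight k s) ∘ₗ (TensorProduct.assoc k H H H).toLinearMap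
  have h1 (s t : H ⊗[k] H) : ctrL' z (t * s) = F s ((Δ k).rTensor H t) := by
    induction t using TensorProduct.induction_on with
    | zero => simp
    | add x y hx hy => rw [add_mul, map_add, map_add, map_add, hx, hy]
    | tmul c d =>
      induction s using TensorProduct.induction_on with
      | zero => simp [F]
      | add x y hx hy =>
        rw [mul_add, map_add, hx, hy]
        have : F (x + y) = F x + F y := by
          ext; simp [F, mul_add]
        rw [this]; rfl
      | tmul a b =>
        simp only [Algebra.TensorProduct.tmul_mul_tmul, ctrL'_tmul, LinearMap.rTensor_tmul]
        have := counit_mul_mul (k := k) z c a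
        rw [← mul_assoc, show ε k (z * c * a) = _ from this]
        change (LinearMap.mul' k k (TensorProduct.map _ _ (Δ k c))) • _ = _
        induction Δ k c using TensorProduct.induction_on with
        | zero => simp
        | add x y hx hy =>
          rw [map_add, map_add, add_smul, hx, hy, TensorProduct.add_tmul, map_add]
        | tmul x y => simp [F, smul_smul, mul_comm]
  have h2 (t : H ⊗[k] H) : F (Δ k h) ((TensorProduct.assoc k H H H).symm ((Δ k).lTensor H t)) =
      ctrL' z t * h := by
    induction t using TensorProduct.induction_on with
    | zero => simp
    | add x y hx hy => rw [map_add, map_add, map_add, map_add, add_mul, hx, hy]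
    | tmul c d => simp [F, ← Δ_mul, ctrL_one]
  rw [← Δ_one_mul_Δ h, h1, coassoc_symm, h2]

/-- `h₍₁₎ ε(c h₍₂₎) = 1₍₁₎ ε(c 1₍₂₎) h` -/
lemma ctrR'_Δ (z h : H) : ctrR' z (Δ k h) = ctrR' z (Δ k 1) * h := by
  let F (s : H ⊗[k] H) : (H ⊗[k] H) ⊗[k] H →ₗ[k] H :=
    (TensorProduct.rid k H).toLinearMap ∘ₗ TensorProduct.map 
      (ctrR 1 ∘ₗ LinearMap.mulRight k s) (ε k ∘ₗ LinearMap.mulLeft k z)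
  have h1 (s t : H ⊗[k] H) : ctrR' z (t * s) =
      F s ((TensorProduct.assoc k H H H).symm ((Δ k).lTensor H t)) := by
    induction t using TensorProduct.induction_on with
    | zero => simp
    | add x y hx hy => rw [add_mul, map_add, map_add, map_add, map_add, hx, hy]
    | tmul c d =>
      induction s using TensorProduct.induction_on with
      | zero => simp [F]
      | add x y hx hy =>
        rw [mul_add, map_add, hx, hy]
        have : F (x + y) = F x + F y := by
          ext; simp [F, mul_add, TensorProduct.add_tmul]
        rw [this]; rfl
      | tmul a b =>
        simp only [Algebra.TensorProduct.tmul_mul_tmul, ctrR'_tmul, LinearMap.lTensor_tmul]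
        have := counit_mul_mul' (k := k) z d b
        rw [← mul_assoc, show ε k (z * d * b) = _ from this]
        change (LinearMap.mul' k k (TensorProduct.map _ _ (Δ k d))) • _ = _
        induction Δ k d using TensorProduct.induction_on with
        | zero => simp
        | add x y hx hy =>
          rw [map_add, map_add, add_smul, hx, hy, TensorProduct.tmul_add, map_add, map_add]
        | tmul x y => simp [F, smul_smul, mul_comm]
  have h2 (t : H ⊗[k] H) : F (Δ k h) ((Δ k).rTensor H t) = ctrR' z t * h := by
    induction t using TensorProduct.induction_on with
    | zero => simp
    | add x y hx hy => rw [map_add, map_add, map_add, add_mul, hx, hy]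
    | tmul c d => simp [F, ← Δ_mul, ctrR_one]
  rw [← Δ_one_mul_Δ h, h1, ← coassoc_symm, h2]

end Lemmas2
end QuantumGroupoid

namespace QuantumGroupoid
section Lemmas3

variable {k H : Type u} [Field k] [Ring H] [Algebra k H] [QuantumGroupoid k H]

/-- `ε(g ε_t(x)) = ε(g x)` -/
lemma ε_mul_εt (g x : H) : ε k (g * εt k x) = ε k (g * x) := by
  have h := counit_mul_mul' (k := k) g 1 x
  rw [mul_one] at h
  rw [h, εt_eq_ctrL]
  induction (CoalgebraStruct.comul (1 : H) : H ⊗[k] H) using TensorProduct.induction_on with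
  | zero => simp
  | add x y hx hy => rw [map_add, map_add, mul_add, map_add, map_add, hx, hy]
  | tmul a b => simp

lemma ε_εt (x : H) : ε k (εt k x) = ε k x := by
  simpa using ε_mul_εt (k := k) 1 x

/-- `ε_t(h ε_t(x)) = ε_t(h x)` -/
lemma εt_mul_εt (h x : H) : εt k (h * εt k x) = εt k (h * x) := by
  rw [εt_eq_ctrL (h * _), εt_eq_ctrL (h * x)]
  induction (Δ k (1 : H) : H ⊗[k] H) using TensorProduct.induction_on with
  | zero => simp
  | add x y hx hy => rw [map_add, map_add, hx, hy]
  | tmul a b => simp only [ctrL_tmul, ← mul_assoc, ε_mul_εt]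

lemma εt_εt (x : H) : εt k (εt k x) = εt k x := by
  simpa using εt_mul_εt (k := k) 1 x

lemma εt_one : εt k (1 : H) = 1 := by
  rw [εt_eq_ctrL, ctrL_one]

/-- The source counital map `ε_s(h) = S(h₍₁₎)h₍₂₎`. -/
noncomputable def εs : H →ₗ[k] H :=
  LinearMap.mul' k H ∘ₗ (S k).rTensor H ∘ₗ Δ k

lemma εs_eq_ctrR' (h : H) : εs (k := k) h = ctrR' h (Δ k 1) := by
  refine (mul_rTensor_antipode h).trans ?_
  change _ = ctrR' h (CoalgebraStruct.comul (1 : H))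
  induction (CoalgebraStruct.comul (1 : H) : H ⊗[k] H) using TensorProduct.induction_on with
  | zero => simp
  | tmul a b => simp
  | add x y hx hy => rw [mul_add, map_add, map_add, map_add, hx, hy]

lemma εs_one : εs (k := k) (1 : H) = 1 := by
  rw [εs_eq_ctrR', ctrR'_one]

/-- `x ↦ ε(x t₁) t₂`, linear in `x` -/
noncomputable def cL' (s : H ⊗[k] H) : H →ₗ[k] H where
  toFun x := ctrL' x s
  map_add' x y := by
    have : (ctrL' (x + y) : H ⊗[k] H →ₗ[k] H) = ctrL' x + ctrL' y := by
      ext; simp [add_mul, add_smul]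
    rw [this]; rfl
  map_smul' c x := by
    have : (ctrL' (c • x) : H ⊗[k] H →ₗ[k] H) = c • ctrL' x := by
      ext; simp [mul_smul]
    rw [this]; rfl

/-- `x ↦ ε(x t₂) t₁`, linear in `x` -/
noncomputable def cR' (s : H ⊗[k] H) : H →ₗ[k] H where
  toFun x := ctrR' x s
  map_add' x y := by
    have : (ctrR' (x + y) : H ⊗[k] H →ₗ[k] H) = ctrR' x + ctrR' y := by
      ext; simp [add_mul, add_smul]
    rw [this]; rfl
  map_smul' c x := by
    have : (ctrR' (c • x) : H ⊗[k] H →ₗ[k] H) = c • ctrR' x := by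
      ext; simp [mul_smul]
    rw [this]; rfl

/-- `x ↦ ε(t₁ x) t₂`, linear in `x` -/
noncomputable def cL (s : H ⊗[k] H) : H →ₗ[k] H where
  toFun x := ctrL x s
  map_add' x y := by
    have : (ctrL (x + y) : H ⊗[k] H →ₗ[k] H) = ctrL x + ctrL y := by
      ext; simp [mul_add, add_smul]
    rw [this]; rfl
  map_smul' c x := by
    have : (ctrL (c • x) : H ⊗[k] H →ₗ[k] H) = c • ctrL x := by
      ext; simp [mul_smul]
    rw [this]; rfl

lemma cL_Δ_one : cL (Δ k (1 : H)) = εt k := LinearMap.ext fun x => (εt_eq_ctrL x).symm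

lemma cR'_Δ_one : cR' (Δ k (1 : H)) = εs := LinearMap.ext fun x => (εs_eq_ctrR' x).symm

lemma rTensor_cL (s t : H ⊗[k] H) : (cL t).rTensor H s =
    TensorProduct.comm k H H ((cL' s).rTensor H t) := by
  induction t using TensorProduct.induction_on with
  | zero =>
    rw [show cL (0 : H ⊗[k] H) = 0 from LinearMap.ext fun x => map_zero (ctrL (k := k) x)]; simp
  | add a b ha hb =>
    rw [show cL (a + b) = cL a + cL b from LinearMap.ext fun x => map_add (ctrL x) a b,
      LinearMap.rTensor_add, LinearMap.add_apply, ha, hb, map_add, map_add]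
  | tmul a b =>
    induction s using TensorProduct.induction_on with
    | zero => 
      rw [show cL' (0 : H ⊗[k] H) = 0 from LinearMap.ext fun x => map_zero (ctrL' (k := k) x)]; simp
    | add x y hx hy =>
      rw [show cL' (x + y) = cL' x + cL' y from LinearMap.ext fun z => map_add (ctrL' z) x y,
        LinearMap.rTensor_add, LinearMap.add_apply, map_add, hx, hy, map_add]
    | tmul x y => simp [cL, cL', TensorProduct.smul_tmul]

lemma lTensor_cL (s t : H ⊗[k] H) : (cL t).lTensor H s = (cR' s).rTensor H t := by
  induction t using TensorProduct.induction_on with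
  | zero =>
    rw [show cL (0 : H ⊗[k] H) = 0 from LinearMap.ext fun x => map_zero (ctrL (k := k) x)]; simp
  | add a b ha hb =>
    rw [show cL (a + b) = cL a + cL b from LinearMap.ext fun x => map_add (ctrL x) a b,
      LinearMap.lTensor_add, LinearMap.add_apply, ha, hb, map_add]
  | tmul a b =>
    induction s using TensorProduct.induction_on with
    | zero => 
      rw [show cR' (0 : H ⊗[k] H) = 0 from LinearMap.ext fun x => map_zero (ctrR' (k := k) x)]; simp
    | add x y hx hy =>
      rw [show cR' (x + y) = cR' x + cR' y from LinearMap.ext fun z => map_add (ctrR' z) x y,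
        LinearMap.rTensor_add, LinearMap.add_apply, map_add, hx, hy]
    | tmul x y => simp [cL, cR', TensorProduct.smul_tmul]

lemma rTensor_εt_congr {s s' : H ⊗[k] H} (h : ∀ e : H, ctrL' e s = ctrL' e s') :
    (εt k).rTensor H s = (εt k).rTensor H s' := by
  rw [← cL_Δ_one, rTensor_cL, rTensor_cL, show cL' s = cL' s' from LinearMap.ext h]

lemma lTensor_εt_congr {s s' : H ⊗[k] H} (h : ∀ e : H, ctrR' e s = ctrR' e s') :
    (εt k).lTensor H s = (εt k).lTensor H s' := by
  rw [← cL_Δ_one, lTensor_cL, lTensor_cL, show cR' s = cR' s' from LinearMap.ext h]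

/-- `ε_t(h₍₁₎) ⊗ h₍₂₎ = ε_t(1₍₁₎) ⊗ 1₍₂₎h` -/
lemma rTensor_εt_Δ (h : H) : (εt k).rTensor H (Δ k h) =
    (εt k).rTensor H (Δ k 1 * ((1 : H) ⊗ₜ[k] h)) := by
  refine rTensor_εt_congr fun e => ?_
  rw [ctrL'_Δ]
  induction (Δ k (1 : H) : H ⊗[k] H) using TensorProduct.induction_on with
  | zero => simp
  | tmul a b => simp
  | add x y hx hy => rw [add_mul, map_add, map_add, add_mul, hx, hy]

/-- `ε(e 1₍₂₎ z) 1₍₁₎ = ε(e 1₍₂₎) 1₍₁₎ 1'₍₁₎ ε(1'₍₂₎ z)` -/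
lemma ctrR'_one_mul (e z : H) : ctrR' e (Δ k 1 * ((1 : H) ⊗ₜ[k] z)) =
    ctrR' e (Δ k 1) * ctrR z (Δ k 1) := by
  let P : (H ⊗[k] H) ⊗[k] H →ₗ[k] H := (TensorProduct.rid k H).toLinearMap ∘ₗ
    TensorProduct.map (ctrR' e) (ε k ∘ₗ LinearMap.mulRight k z)
  have h1 (t : H ⊗[k] H) : ctrR' e (t * ((1 : H) ⊗ₜ[k] z)) =
      P ((TensorProduct.assoc k H H H).symm ((Δ k).lTensor H t)) := by
    induction t using TensorProduct.induction_on with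
    | zero => simp
    | add x y hx hy => rw [add_mul, map_add, map_add, map_add, map_add, hx, hy]
    | tmul a b =>
      simp only [Algebra.TensorProduct.tmul_mul_tmul, mul_one, ctrR'_tmul, LinearMap.lTensor_tmul]
      rw [← mul_assoc, show ε k (e * b * z) = _ from counit_mul_mul (k := k) e b z]
      change (LinearMap.mul' k k (TensorProduct.map _ _ (Δ k b))) • _ = _
      induction Δ k b using TensorProduct.induction_on with
      | zero => simp
      | add x y hx hy =>
        rw [map_add, map_add, add_smul, hx, hy, TensorProduct.tmul_add, map_add, map_add]
      | tmul x y => simp [P, smul_smul, mul_comm]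
  have h2 (t : H ⊗[k] H) : P ((Δ k).rTensor H t) = ctrR' e (Δ k 1) * ctrR z t := by
    induction t using TensorProduct.induction_on with
    | zero => simp
    | add x y hx hy => rw [map_add, map_add, map_add, mul_add, hx, hy]
    | tmul a b =>
      have : P ((Δ k).rTensor H (a ⊗ₜ[k] b)) = ε k (b * z) • ctrR' e (Δ k a) := by simp [P]
      rw [this, ctrR'_Δ]; simp
  rw [h1, ← coassoc_symm, h2]

/-- `1₍₁₎ ⊗ ε_t(1₍₂₎z) = 1₍₁₎1'₍₁₎ε(1'₍₂₎z) ⊗ ε_t(1₍₂₎)` -/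
lemma lTensor_εt_one_mul (z : H) : (εt k).lTensor H (Δ k 1 * ((1 : H) ⊗ₜ[k] z)) =
    (εt k).lTensor H (Δ k 1 * (ctrR z (Δ k 1) ⊗ₜ[k] (1 : H))) := by
  refine lTensor_εt_congr fun e => ?_
  rw [ctrR'_one_mul]
  generalize ctrR z (Δ k (1 : H)) = y
  induction (Δ k (1 : H) : H ⊗[k] H) using TensorProduct.induction_on with
  | zero => simp
  | tmul a b => simp
  | add u v hu hv => rw [add_mul, map_add, map_add, add_mul, hu, hv]

lemma assoc_symm_mul {k H : Type u} [Field k] [Ring H] [Algebra k H] (s t : H ⊗[k] H) (P : (H ⊗[k] H) ⊗[k] H →ₗ[k] H ⊗[k] H)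
    (Q : H ⊗[k] H →ₗ[k] H ⊗[k] H →ₗ[k] H ⊗[k] H)
    (h : ∀ a b c d : H, P ((c ⊗ₜ[k] (a * d)) ⊗ₜ[k] b) = Q (a ⊗ₜ b) (c ⊗ₜ d)) :
    P ((TensorProduct.assoc k H H H).symm ((1 : H) ⊗ₜ[k] s) * (t ⊗ₜ[k] (1 : H))) = Q s t := by
  induction s using TensorProduct.induction_on with
  | zero => simp
  | add a b ha hb =>
    rw [TensorProduct.tmul_add, map_add, add_mul, map_add, ha, hb, map_add]; rfl
  | tmul a b =>
    induction t using TensorProduct.induction_on with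
    | zero => simp
    | add x y hx hy => rw [TensorProduct.add_tmul, mul_add, map_add, hx, hy, map_add]
    | tmul x y => simp [h]

/-- `(Δ ⊗ id)Δ(1) = (1 ⊗ Δ(1))(Δ(1) ⊗ 1)` -/
lemma comul_comul_one'' : (Δ k).rTensor H (Δ k (1 : H)) =
    (TensorProduct.assoc k H H H).symm ((1 : H) ⊗ₜ[k] Δ k 1) * (Δ k 1 ⊗ₜ[k] (1 : H)) :=
  comul_comul_one'

/-- `1₍₁₎ ⊗ ε_t(1₍₂₎) = Δ(1)` -/
lemma lTensor_εt_one : (εt k).lTensor H (Δ k (1 : H)) = Δ k 1 := by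
  let P : (H ⊗[k] H) ⊗[k] H →ₗ[k] H ⊗[k] H :=
    ((TensorProduct.lid k H).toLinearMap ∘ₗ (ε k).rTensor H).lTensor H ∘ₗ
      (TensorProduct.assoc k H H H).toLinearMap
  let Q : H ⊗[k] H →ₗ[k] H ⊗[k] H →ₗ[k] H ⊗[k] H := LinearMap.lTensorHom H ∘ₗ
    { toFun := cL, map_add' := fun s t => LinearMap.ext fun x => map_add (ctrL x) s t,
      map_smul' := fun c s => LinearMap.ext fun x => map_smul (ctrL x) c s }
  have h := assoc_symm_mul (Δ k (1 : H)) (Δ k 1) P Q (by simp [P, Q, cL])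
  rw [← comul_comul_one'', coassoc_symm] at h
  have h2 : ∀ t : H ⊗[k] H, P ((TensorProduct.assoc k H H H).symm ((Δ k).lTensor H t)) = t := by
    intro t
    induction t using TensorProduct.induction_on with
    | zero => simp
    | add x y hx hy => rw [map_add, map_add, map_add, hx, hy]
    | tmul x y => simp [P]
  rw [h2] at h
  rw [← cL_Δ_one]
  exact h.symm

/-- `ε_s(1₍₁₎) ⊗ 1₍₂₎ = Δ(1)` -/
lemma rTensor_εs_one : (εs (k := k)).rTensor H (Δ k (1 : H)) = Δ k 1 := by
  let P : (H ⊗[k] H) ⊗[k] H →ₗ[k] H ⊗[k] H :=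
    ((TensorProduct.rid k H).toLinearMap ∘ₗ (ε k).lTensor H).rTensor H
  let Q : H ⊗[k] H →ₗ[k] H ⊗[k] H →ₗ[k] H ⊗[k] H := LinearMap.flip (LinearMap.rTensorHom H ∘ₗ
    { toFun := cR', map_add' := fun s t => LinearMap.ext fun x => map_add (ctrR' x) s t,
      map_smul' := fun c s => LinearMap.ext fun x => map_smul (ctrR' x) c s })
  have h := assoc_symm_mul (Δ k (1 : H)) (Δ k 1) P Q (by simp [P, Q, cR'])
  rw [← comul_comul_one''] at h
  have h2 : ∀ t : H ⊗[k] H, P ((Δ k).rTensor H t) = t := by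
    intro t
    induction t using TensorProduct.induction_on with
    | zero => simp
    | add x y hx hy => rw [map_add, map_add, hx, hy]
    | tmul x y => simp [P]
  rw [h2] at h
  rw [← cR'_Δ_one]
  exact h.symm

/-- `Δ(z) = Δ(1)(z ⊗ 1)` for `z ∈ H_t` -/
lemma Δ_εt (w : H) : Δ k (εt k w) = Δ k 1 * (εt k w ⊗ₜ[k] (1 : H)) := by
  let P : (H ⊗[k] H) ⊗[k] H →ₗ[k] H ⊗[k] H := (ctrL w).rTensor H
  have h1 (t : H ⊗[k] H) : Δ k (ctrL w t) =
      P ((TensorProduct.assoc k H H H).symm ((Δ k).lTensor H t)) := by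
    induction t using TensorProduct.induction_on with
    | zero => simp
    | add x y hx hy => rw [map_add, map_add, map_add, map_add, map_add, hx, hy]
    | tmul x y =>
      simp only [ctrL_tmul, map_smul, LinearMap.lTensor_tmul]
      induction Δ k y using TensorProduct.induction_on with
      | zero => simp
      | add x y hx hy => rw [TensorProduct.tmul_add, map_add, map_add, smul_add, hx, hy]
      | tmul x y => simp [P, TensorProduct.smul_tmul']
  let Q : H ⊗[k] H →ₗ[k] H ⊗[k] H →ₗ[k] H ⊗[k] H :=
    (LinearMap.compl₂ (LinearMap.mul k (H ⊗[k] H))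
      ((TensorProduct.mk k H H).flip (1 : H) ∘ₗ ctrL w))
  have h := assoc_symm_mul (Δ k (1 : H)) (Δ k 1) P Q (by intros; simp [P, Q, TensorProduct.smul_tmul'])
  rw [εt_eq_ctrL, h1, ← coassoc_symm, comul_comul_one'', h]
  rfl

/-- `a ⊗ b ↦ (S(a) ⊗ 1) t (b ⊗ 1)` -/
noncomputable def sandwich (t : H ⊗[k] H) : H ⊗[k] H →ₗ[k] H ⊗[k] H :=
  TensorProduct.lift (LinearMap.mk₂ k
    (fun a b => (S k a ⊗ₜ[k] (1 : H)) * t * (b ⊗ₜ[k] (1 : H)))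
    (by intros; rw [map_add, TensorProduct.add_tmul, add_mul, add_mul])
    (by intros; rw [map_smul, ← TensorProduct.smul_tmul', smul_mul_assoc, smul_mul_assoc])
    (by intros; rw [TensorProduct.add_tmul, mul_add])
    (by intros; rw [← TensorProduct.smul_tmul', mul_smul_comm]))

lemma sandwich_tmul (t : H ⊗[k] H) (a b : H) : sandwich t (a ⊗ₜ[k] b) =
    (S k a ⊗ₜ[k] (1 : H)) * t * (b ⊗ₜ[k] (1 : H)) := rfl

/-- `1₍₁₎ ⊗ ε_t(h 1₍₂₎) = S(h₍₁₎) 1₍₁₎ h₍₂₎ ⊗ 1₍₂₎` -/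
lemma lTensor_εt_mul_one (h : H) : (εt k).lTensor H (((1 : H) ⊗ₜ[k] h) * Δ k 1) =
    sandwich (Δ k 1) (Δ k h) := by
  have e1 : (εt k).lTensor H (((1 : H) ⊗ₜ[k] h) * Δ k 1) =
      (εs (k := k)).rTensor H (Δ k 1 * (h ⊗ₜ[k] (1 : H))) := by
    rw [← cL_Δ_one, lTensor_cL]
    have : cR' (((1 : H) ⊗ₜ[k] h) * Δ k 1) = εs ∘ₗ LinearMap.mulRight k h := by
      rw [← cR'_Δ_one]
      ext e
      change ctrR' e _ = ctrR' (e * h) _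
      induction (Δ k (1 : H) : H ⊗[k] H) using TensorProduct.induction_on with
      | zero => simp
      | tmul a b => simp [mul_assoc]
      | add u v hu hv => rw [mul_add, map_add, map_add, hu, hv]
    rw [this]
    induction (Δ k (1 : H) : H ⊗[k] H) using TensorProduct.induction_on with
    | zero => simp
    | tmul a b => simp
    | add u v hu hv => rw [add_mul, map_add, map_add, hu, hv]
  have e3 (a b : H) (s : H ⊗[k] H) : 
      LinearMap.mul' k H ((S k).rTensor H (s * (a ⊗ₜ[k] b))) =
        S k a * LinearMap.mul' k H ((S k).rTensor H s) * b := by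
    induction s using TensorProduct.induction_on with
    | zero => simp
    | tmul x y => simp [antipode_mul, mul_assoc]
    | add u v hu hv => rw [add_mul, map_add, map_add, map_add, map_add, hu, hv, mul_add, add_mul]
  have e4 (t : H ⊗[k] H) : (εs (k := k)).rTensor H (t * (h ⊗ₜ[k] (1 : H))) =
      sandwich ((εs (k := k)).rTensor H t) (Δ k h) := by
    induction t using TensorProduct.induction_on with
    | zero =>
      rw [zero_mul, map_zero]
      induction Δ k h using TensorProduct.induction_on with
      | zero => simp
      | tmul a b => simp [sandwich_tmul]
      | add u v hu hv => rw [map_add, ← hu, ← hv, add_zero]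
    | add u v hu hv =>
      rw [add_mul, map_add, hu, hv, map_add]
      induction Δ k h using TensorProduct.induction_on with
      | zero => simp
      | tmul a b => simp only [sandwich_tmul]; rw [mul_add, add_mul]
      | add u v hu hv => rw [map_add, map_add, map_add, ← hu, ← hv]; abel
    | tmul c d =>
      simp only [Algebra.TensorProduct.tmul_mul_tmul, mul_one, LinearMap.rTensor_tmul]
      rw [show εs (k := k) (c * h) = LinearMap.mul' k H ((S k).rTensor H (Δ k (c * h))) from rfl,
        Δ_mul]
      induction Δ k h using TensorProduct.induction_on with
      | zero => simp
      | tmul a b =>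
        rw [e3, sandwich_tmul]
        simp [εs]
      | add u v hu hv =>
        rw [mul_add, map_add, map_add, TensorProduct.add_tmul, hu, hv, map_add]
  rw [e1, e4, rTensor_εs_one]

end Lemmas3
end QuantumGroupoid

/-- A finite dimensional left module over a `k`-algebra `H`. -/
structure QGRep (k H : Type u) [Field k] [Ring H] [Algebra k H] where
  carrier : Type u
  [addCommGroup : AddCommGroup carrier]
  [module : Module k carrier]
  [moduleH : Module H carrier]
  [tower : IsScalarTower k H carrier]
  [finite : Module.Finite k carrier]

namespace QGRep

attribute [instance] QGRep.addCommGroup QGRep.module QGRep.moduleH QGRep.tower QGRep.finite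

section Cat

variable {k H : Type u} [Field k] [Ring H] [Algebra k H]

instance (V : QGRep k H) : SMulCommClass H k V.carrier := IsScalarTower.to_smulCommClass'
instance (V : QGRep k H) : SMulCommClass k H V.carrier := IsScalarTower.to_smulCommClass

/-- A morphism of `Rep(H)` is an `H`-linear map. -/
@[ext] structure Hom (V W : QGRep k H) where
  lin : V.carrier →ₗ[H] W.carrier

instance : Category (QGRep k H) where
  Hom V W := Hom V W
  id V := ⟨LinearMap.id⟩
  comp f g := ⟨g.lin ∘ₗ f.lin⟩

variable {U V W X Y Z : QGRep k H}

lemma hom_ext {f g : V ⟶ W} (h : ∀ x, f.lin x = g.lin x) : f = g :=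
  Hom.ext (LinearMap.ext h)

@[simp] lemma id_lin (x : V.carrier) : (𝟙 V : V ⟶ V).lin x = x := rfl
@[simp] lemma comp_lin (f : U ⟶ V) (g : V ⟶ W) (x : U.carrier) :
    (f ≫ g).lin x = g.lin (f.lin x) := rfl

/-- Morphisms are the same as `H`-linear maps. -/
def homEquiv (V W : QGRep k H) : (V ⟶ W) ≃ (V.carrier →ₗ[H] W.carrier) where
  toFun f := f.lin
  invFun f := ⟨f⟩
  left_inv _ := rfl
  right_inv _ := rfl

noncomputable instance (V W : QGRep k H) : AddCommGroup (V ⟶ W) := (homEquiv V W).addCommGroup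
noncomputable instance (V W : QGRep k H) : Module k (V ⟶ W) := (homEquiv V W).module k

@[simp] lemma add_lin (f g : V ⟶ W) (x : V.carrier) : (f + g).lin x = f.lin x + g.lin x := rfl
@[simp] lemma zero_lin (x : V.carrier) : (0 : V ⟶ W).lin x = 0 := rfl
@[simp] lemma smul_lin (c : k) (f : V ⟶ W) (x : V.carrier) : (c • f).lin x = c • f.lin x := rfl

noncomputable instance : Preadditive (QGRep k H) where
  add_comp _ _ _ _ _ _ := hom_ext fun x => by simp
  comp_add _ _ _ _ _ _ := hom_ext fun x => by simp

noncomputable instance : Linear k (QGRep k H) where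
  smul_comp _ _ _ r f g := hom_ext fun x => by
    simp only [comp_lin, smul_lin]
    exact (g.lin.restrictScalars k).map_smul r _
  comp_smul _ _ _ _ _ _ := hom_ext fun x => by simp

/-- A morphism as a `k`-linear map. -/
def klin (f : V ⟶ W) : V.carrier →ₗ[k] W.carrier := f.lin.restrictScalars k

@[simp] lemma klin_apply (f : V ⟶ W) (x : V.carrier) : klin f x = f.lin x := rfl

/-- A bijective `H`-linear map is an isomorphism. -/
def isoMk (e : V.carrier ≃ₗ[H] W.carrier) : V ≅ W where
  hom := ⟨e.toLinearMap⟩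
  inv := ⟨e.symm.toLinearMap⟩
  hom_inv_id := hom_ext fun x => by simp
  inv_hom_id := hom_ext fun x => by simp

/-- the action of `H` on `V` as an algebra homomorphism -/
noncomputable def act (V : QGRep k H) : H →ₐ[k] Module.End k V.carrier :=
  Algebra.lsmul k k V.carrier

@[simp] lemma act_apply (V : QGRep k H) (h : H) (x : V.carrier) : act V h x = h • x := rfl

/-- the componentwise action of `A ⊗ B` on `M ⊗ N` -/
noncomputable def act₂ {A B M N : Type u} [Ring A] [Algebra k A] [Ring B] [Algebra k B]
    [AddCommGroup M] [Module k M] [AddCommGroup N] [Module k N]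
    (ρ : A →ₐ[k] Module.End k M) (σ : B →ₐ[k] Module.End k N) :
    A ⊗[k] B →ₐ[k] Module.End k (M ⊗[k] N) :=
  (Module.endTensorEndAlgHom (R := k) (S := k) (A := k) (M := M) (N := N)).comp
    (Algebra.TensorProduct.map ρ σ)

@[simp] lemma act₂_tmul {A B M N : Type u} [Ring A] [Algebra k A] [Ring B] [Algebra k B]
    [AddCommGroup M] [Module k M] [AddCommGroup N] [Module k N]
    (ρ : A →ₐ[k] Module.End k M) (σ : B →ₐ[k] Module.End k N) (a : A) (b : B) (x : M) (y : N) :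
    act₂ ρ σ (a ⊗ₜ[k] b) (x ⊗ₜ[k] y) = ρ a x ⊗ₜ[k] σ b y := rfl

lemma act₂_tmul' {A B M N : Type u} [Ring A] [Algebra k A] [Ring B] [Algebra k B]
    [AddCommGroup M] [Module k M] [AddCommGroup N] [Module k N]
    (ρ : A →ₐ[k] Module.End k M) (σ : B →ₐ[k] Module.End k N) (a : A) (b : B) :
    act₂ ρ σ (a ⊗ₜ[k] b) = TensorProduct.map (ρ a) (σ b) := by
  ext; simp

/-- the componentwise action of `H ⊗ H` on `V ⊗ₖ W` -/
noncomputable abbrev actT (V W : QGRep k H) :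
    H ⊗[k] H →ₐ[k] Module.End k (V.carrier ⊗[k] W.carrier) :=
  act₂ (act V) (act W)

end Cat

open QuantumGroupoid

section Tensor

variable {k H : Type u} [Field k] [Ring H] [Algebra k H] [QuantumGroupoid k H]

/-- The subspace `{x ∈ V ⊗ₖ W | x = Δ(1)·x}` of `V ⊗ₖ W`. -/
noncomputable def tensorSub (V W : QGRep k H) : Submodule k (V.carrier ⊗[k] W.carrier) where
  carrier := {x | actT V W (Δ k 1) x = x}
  add_mem' {x y} hx hy := by
    change _ = _ at hx hy ⊢
    rw [map_add, hx, hy]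
  zero_mem' := map_zero _
  smul_mem' c x hx := by
    change _ = _ at hx ⊢
    rw [map_smul, hx]

lemma mem_tensorSub {V W : QGRep k H} {x : V.carrier ⊗[k] W.carrier} :
    x ∈ tensorSub V W ↔ actT V W (Δ k 1) x = x := Iff.rfl

lemma actT_Δ_mem (V W : QGRep k H) (h : H) (x : V.carrier ⊗[k] W.carrier) :
    actT V W (Δ k h) x ∈ tensorSub V W := by
  rw [mem_tensorSub, ← Module.End.mul_apply, ← map_mul, Δ_one_mul_Δ]

/-- `H` acts on `V ⊗ W` through the comultiplication. -/
@[reducible] noncomputable def tensorModule (V W : QGRep k H) : Module H (tensorSub V W) where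
  smul h x := ⟨actT V W (Δ k h) x, actT_Δ_mem V W h x⟩
  one_smul x := Subtype.ext x.2
  mul_smul a b x := Subtype.ext (by
    change actT V W (Δ k (a * b)) x = actT V W (Δ k a) (actT V W (Δ k b) x)
    rw [Δ_mul, map_mul, Module.End.mul_apply])
  smul_zero a := Subtype.ext (map_zero _)
  smul_add a x y := Subtype.ext (map_add _ _ _)
  add_smul a b x := Subtype.ext (by
    change actT V W (Δ k (a + b)) x = actT V W (Δ k a) x + actT V W (Δ k b) x
    rw [map_add, map_add, LinearMap.add_apply])
  zero_smul x := Subtype.ext (by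
    change actT V W (Δ k 0) x = 0
    rw [map_zero, map_zero, LinearMap.zero_apply])

/-- The tensor product `V ⊗ W = {x ∈ V ⊗ₖ W | x = Δ(1)·x}` of `Rep(H)`. -/
noncomputable def tensor (V W : QGRep k H) : QGRep k H :=
  letI := tensorModule V W
  { carrier := tensorSub V W
    tower := ⟨fun c h x => Subtype.ext (by
      change actT V W (Δ k (c • h)) x = c • actT V W (Δ k h) x
      rw [map_smul, map_smul, LinearMap.smul_apply])⟩ }

variable {U V W X Y Z : QGRep k H}

/-- The inclusion `V ⊗ W ⊂ V ⊗ₖ W`. -/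
noncomputable def inc (V W : QGRep k H) : (tensor V W).carrier →ₗ[k] V.carrier ⊗[k] W.carrier :=
  (tensorSub V W).subtype

lemma inc_injective (V W : QGRep k H) : Function.Injective (inc V W) := Subtype.val_injective

@[simp] lemma inc_smul (h : H) (x : (tensor V W).carrier) :
    inc V W (h • x) = actT V W (Δ k h) (inc V W x) := rfl

@[simp] lemma actT_one_inc (x : (tensor V W).carrier) :
    actT V W (Δ k 1) (inc V W x) = inc V W x := x.2

/-- The projection `x ↦ Δ(1)·x` of `V ⊗ₖ W` onto `V ⊗ W`. -/
noncomputable def proj (V W : QGRep k H) : V.carrier ⊗[k] W.carrier →ₗ[k] (tensor V W).carrier :=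
  (actT V W (Δ k 1)).codRestrict (tensorSub V W) (actT_Δ_mem V W 1)

@[simp] lemma inc_proj (x : V.carrier ⊗[k] W.carrier) :
    inc V W (proj V W x) = actT V W (Δ k 1) x := rfl

@[simp] lemma proj_inc (x : (tensor V W).carrier) : proj V W (inc V W x) = x :=
  inc_injective V W (by simp)

/-- `H`-linear maps into `V ⊗ W` from equivariant linear maps into `V ⊗ₖ W` -/
noncomputable def lift (g : X.carrier →ₗ[k] V.carrier ⊗[k] W.carrier)
    (hg : ∀ (h : H) x, actT V W (Δ k h) (g x) = g (h • x)) : X ⟶ tensor V W where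
  lin :=
    { toFun := fun x => proj V W (g x)
      map_add' := fun x y => by rw [map_add, map_add]
      map_smul' := fun h x => inc_injective V W (by
        simp only [inc_proj, hg, one_smul, RingHom.id_apply, inc_smul]) }

@[simp] lemma inc_lift (g : X.carrier →ₗ[k] V.carrier ⊗[k] W.carrier)
    (hg : ∀ (h : H) x, actT V W (Δ k h) (g x) = g (h • x)) (x : X.carrier) :
    inc V W ((lift g hg).lin x) = g x := by
  change inc V W (proj V W (g x)) = g x
  rw [inc_proj, hg, one_smul]

lemma actT_map {k H : Type u} [Field k] [Ring H] [Algebra k H] {V W X Y : QGRep k H}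
    (f : V ⟶ X) (g : W ⟶ Y) (s : H ⊗[k] H) (x : V.carrier ⊗[k] W.carrier) :
    actT X Y s (TensorProduct.map (klin f) (klin g) x) =
      TensorProduct.map (klin f) (klin g) (actT V W s x) := by
  induction s using TensorProduct.induction_on with
  | zero => simp
  | add a b ha hb => rw [map_add, map_add, LinearMap.add_apply, LinearMap.add_apply, ha, hb, map_add]
  | tmul a b =>
    induction x using TensorProduct.induction_on with
    | zero => simp
    | add x y hx hy => rw [map_add, map_add, hx, hy, map_add, map_add]
    | tmul x y => simp

/-- The tensor product of morphisms is the restriction of `f ⊗ₖ g`. -/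
noncomputable def tensorMap (f : V ⟶ X) (g : W ⟶ Y) : tensor V W ⟶ tensor X Y :=
  lift (TensorProduct.map (klin f) (klin g) ∘ₗ inc V W) fun h x => by
    simp [actT_map]

@[simp] lemma inc_tensorMap (f : V ⟶ X) (g : W ⟶ Y) (x : (tensor V W).carrier) :
    inc X Y ((tensorMap f g).lin x) = TensorProduct.map (klin f) (klin g) (inc V W x) :=
  inc_lift _ _ x

/-- The action of `H ⊗ H ⊗ H` on `(U ⊗ₖ V) ⊗ₖ W`. -/
noncomputable abbrev act3 (U V W : QGRep k H) :
    (H ⊗[k] H) ⊗[k] H →ₐ[k] Module.End k ((U.carrier ⊗[k] V.carrier) ⊗[k] W.carrier) :=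
  act₂ (actT U V) (act W)

/-- `(U ⊗ V) ⊗ W ⊂ (U ⊗ₖ V) ⊗ₖ W` -/
noncomputable def incL (U V W : QGRep k H) : (tensor (tensor U V) W).carrier →ₗ[k]
    (U.carrier ⊗[k] V.carrier) ⊗[k] W.carrier :=
  (inc U V).rTensor _ ∘ₗ inc (tensor U V) W

/-- `U ⊗ (V ⊗ W) ⊂ U ⊗ₖ (V ⊗ₖ W)` -/
noncomputable def incR (U V W : QGRep k H) : (tensor U (tensor V W)).carrier →ₗ[k]
    U.carrier ⊗[k] (V.carrier ⊗[k] W.carrier) :=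
  (inc V W).lTensor _ ∘ₗ inc U (tensor V W)

lemma incL_injective (U V W : QGRep k H) : Function.Injective (incL U V W) :=
  (Module.Flat.rTensor_preserves_injective_linearMap _ (inc_injective U V)).comp
    (inc_injective _ _)

lemma incR_injective (U V W : QGRep k H) : Function.Injective (incR U V W) :=
  (Module.Flat.lTensor_preserves_injective_linearMap _ (inc_injective V W)).comp
    (inc_injective _ _)

lemma rTensor_inc_actT (s : H ⊗[k] H) (x : (tensor U V).carrier ⊗[k] W.carrier) :
    (inc U V).rTensor W.carrier (actT (tensor U V) W s x) =
      act3 U V W ((Δ k).rTensor H s) ((inc U V).rTensor W.carrier x) := by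
  induction s using TensorProduct.induction_on with
  | zero => simp
  | add a b ha hb =>
    simp only [map_add, LinearMap.add_apply, ha, hb]
  | tmul a b =>
    induction x using TensorProduct.induction_on with
    | zero => simp
    | add x y hx hy => simp only [map_add, hx, hy]
    | tmul x y => simp

lemma lTensor_inc_actT (s : H ⊗[k] H) (x : U.carrier ⊗[k] (tensor V W).carrier) :
    (inc V W).lTensor U.carrier (actT U (tensor V W) s x) =
      act₂ (act U) (actT V W) ((Δ k).lTensor H s) ((inc V W).lTensor U.carrier x) := by
  induction s using TensorProduct.induction_on with
  | zero => simp
  | add a b ha hb =>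
    simp only [map_add, LinearMap.add_apply, ha, hb]
  | tmul a b =>
    induction x using TensorProduct.induction_on with
    | zero => simp
    | add x y hx hy => simp only [map_add, hx, hy]
    | tmul x y => simp

lemma assoc_act3 {k H : Type u} [Field k] [Ring H] [Algebra k H] {U V W : QGRep k H}
    (s : (H ⊗[k] H) ⊗[k] H) (x : (U.carrier ⊗[k] V.carrier) ⊗[k] W.carrier) :
    TensorProduct.assoc k _ _ _ (act3 U V W s x) =
      act₂ (act U) (actT V W) (TensorProduct.assoc k _ _ _ s) (TensorProduct.assoc k _ _ _ x) := by
  induction s using TensorProduct.induction_on with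
  | zero => simp
  | add a b ha hb => simp only [map_add, LinearMap.add_apply, ha, hb]
  | tmul s c =>
    induction s using TensorProduct.induction_on with
    | zero => simp
    | add a b ha hb => simp only [TensorProduct.add_tmul, map_add, LinearMap.add_apply, ha, hb]
    | tmul a b =>
      induction x using TensorProduct.induction_on with
      | zero => simp
      | add x y hx hy => simp only [map_add, hx, hy]
      | tmul x z =>
        induction x using TensorProduct.induction_on with
        | zero => simp
        | add x y hx hy => simp only [TensorProduct.add_tmul, map_add, hx, hy]
        | tmul x y => simp

lemma incL_smul (h : H) (x : (tensor (tensor U V) W).carrier) :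
    incL U V W (h • x) = act3 U V W ((Δ k).rTensor H (Δ k h)) (incL U V W x) := by
  simp only [incL, LinearMap.comp_apply, inc_smul, rTensor_inc_actT]

lemma incR_smul (h : H) (x : (tensor U (tensor V W)).carrier) :
    incR U V W (h • x) = act₂ (act U) (actT V W) ((Δ k).lTensor H (Δ k h)) (incR U V W x) := by
  simp only [incR, LinearMap.comp_apply, inc_smul, lTensor_inc_actT]

lemma comul_comul_one₁ : (Δ k).rTensor H (Δ k (1 : H)) =
    (Δ k 1 ⊗ₜ[k] (1 : H)) * (TensorProduct.assoc k H H H).symm ((1 : H) ⊗ₜ[k] Δ k 1) :=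
  comul_comul_one

lemma Δ_one_idem : Δ k (1 : H) * Δ k 1 = Δ k 1 := Δ_one_mul_Δ 1

/-- The associator is the restriction of the usual one. -/
noncomputable def assocFun (U V W : QGRep k H) : (tensor (tensor U V) W).carrier →ₗ[k]
    U.carrier ⊗[k] (tensor V W).carrier :=
  (proj V W).lTensor U.carrier ∘ₗ (TensorProduct.assoc k _ _ _).toLinearMap ∘ₗ incL U V W

lemma lTensor_inc_proj (x : U.carrier ⊗[k] (V.carrier ⊗[k] W.carrier)) :
    (inc V W).lTensor U.carrier ((proj V W).lTensor U.carrier x) =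
      act₂ (act U) (actT V W) ((1 : H) ⊗ₜ[k] Δ k 1) x := by
  induction x using TensorProduct.induction_on with
  | zero => simp
  | add x y hx hy => simp only [map_add, hx, hy]
  | tmul x y => simp

lemma rTensor_inc_proj (x : (U.carrier ⊗[k] V.carrier) ⊗[k] W.carrier) :
    (inc U V).rTensor W.carrier ((proj U V).rTensor W.carrier x) =
      act3 U V W (Δ k 1 ⊗ₜ[k] (1 : H)) x := by
  induction x using TensorProduct.induction_on with
  | zero => simp
  | add x y hx hy => simp only [map_add, hx, hy]
  | tmul x y => simp

lemma lTensor_inc_assocFun (x : (tensor (tensor U V) W).carrier) :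
    (inc V W).lTensor U.carrier (assocFun U V W x) =
      TensorProduct.assoc k _ _ _ (incL U V W x) := by
  have h := incL_smul (1 : H) x
  rw [one_smul, comul_comul_one''] at h
  simp only [assocFun, LinearMap.comp_apply, lTensor_inc_proj]
  rw [h]
  simp only [LinearEquiv.coe_coe, assoc_act3]
  rw [← Module.End.mul_apply, ← map_mul]
  congr 2
  have : (1 : H) ⊗ₜ[k] Δ k 1 = TensorProduct.assoc k H H H
    ((TensorProduct.assoc k H H H).symm ((1 : H) ⊗ₜ[k] Δ k 1)) := by simp
  have hm (a b : (H ⊗[k] H) ⊗[k] H) : TensorProduct.assoc k H H H a * TensorProduct.assoc k H H H b =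
    TensorProduct.assoc k H H H (a * b) :=
      (map_mul (Algebra.TensorProduct.assoc k k k H H H) a b).symm
  have hs (a b : H ⊗[k] (H ⊗[k] H)) : (TensorProduct.assoc k H H H).symm a *
      (TensorProduct.assoc k H H H).symm b = (TensorProduct.assoc k H H H).symm (a * b) :=
      (map_mul (Algebra.TensorProduct.assoc k k k H H H).symm a b).symm
  conv_lhs => rw [this]
  rw [hm, ← mul_assoc, hs]
  simp [Δ_one_idem]

lemma lTensor_inc_injective : Function.Injective ((inc V W).lTensor U.carrier) :=
  Module.Flat.lTensor_preserves_injective_linearMap _ (inc_injective V W)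

lemma rTensor_inc_injective : Function.Injective ((inc U V).rTensor W.carrier) :=
  Module.Flat.rTensor_preserves_injective_linearMap _ (inc_injective U V)

/-- The associator, as a morphism. -/
noncomputable def assocHom (U V W : QGRep k H) : tensor (tensor U V) W ⟶ tensor U (tensor V W) :=
  lift (assocFun U V W) fun h x => lTensor_inc_injective (by
    rw [lTensor_inc_actT, lTensor_inc_assocFun, lTensor_inc_assocFun, incL_smul, assoc_act3,
      coassoc_symm, LinearEquiv.apply_symm_apply])

lemma incR_assocHom (x : (tensor (tensor U V) W).carrier) :
    incR U V W ((assocHom U V W).lin x) = TensorProduct.assoc k _ _ _ (incL U V W x) := by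
  simp [incR, assocHom, lTensor_inc_assocFun]

lemma assocHom_bijective (U V W : QGRep k H) : Function.Bijective (assocHom U V W).lin := by
  constructor
  · intro x y hxy
    apply incL_injective
    apply (TensorProduct.assoc k _ _ _).injective
    rw [← incR_assocHom, ← incR_assocHom, hxy]
  · intro y
    set y' := (TensorProduct.assoc k _ _ _).symm (incR U V W y) with hy'
    have hyy : incR U V W y = TensorProduct.assoc k _ _ _ y' := by simp [hy']
    have h := incR_smul (1 : H) y
    rw [one_smul] at h
    have h3 : act3 U V W ((Δ k).rTensor H (Δ k 1)) y' = y' := by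
      apply (TensorProduct.assoc k _ _ _).injective
      rw [assoc_act3, ← hyy, coassoc_symm, LinearEquiv.apply_symm_apply, ← h]
    have h4 : (inc U V).rTensor W.carrier ((proj U V).rTensor W.carrier y') = y' := by
      rw [rTensor_inc_proj, ← h3, ← Module.End.mul_apply, ← map_mul, comul_comul_one₁, ← mul_assoc]
      simp [Δ_one_idem]
    refine ⟨proj (tensor U V) W ((proj U V).rTensor W.carrier y'), ?_⟩
    apply incR_injective
    rw [incR_assocHom, hyy]
    congr 1
    rw [incL, LinearMap.comp_apply, inc_proj, rTensor_inc_actT, h4, h3]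

/-- The associativity isomorphism of `Rep(H)`, the restriction of the usual one. -/
noncomputable def associator (U V W : QGRep k H) :
    tensor (tensor U V) W ≅ tensor U (tensor V W) :=
  isoMk (LinearEquiv.ofBijective (assocHom U V W).lin (assocHom_bijective U V W))

lemma incR_associator (x : (tensor (tensor U V) W).carrier) :
    incR U V W ((associator U V W).hom.lin x) = TensorProduct.assoc k _ _ _ (incL U V W x) :=
  incR_assocHom x

end Tensor
end QGRep

namespace QGRep
open QuantumGroupoid

section Unit

variable (k H : Type u) [Field k] [Ring H] [Algebra k H] [QuantumGroupoid k H]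

/-- The target counital subalgebra `H_t = ε_t(H)`. -/
noncomputable def targetSub : Submodule k H := LinearMap.range (εt k)

variable {k H} in
lemma εt_of_mem {z : H} (hz : z ∈ targetSub k H) : εt k z = z := by
  obtain ⟨w, rfl⟩ := hz
  exact εt_εt w

/-- The action `h · z = ε_t(hz)` of `H` on `H_t`. -/
@[reducible] noncomputable def targetModule : Module H (targetSub k H) where
  smul h z := ⟨εt k (h * z), LinearMap.mem_range_self _ _⟩
  one_smul z := Subtype.ext (by
    change εt k (1 * (z : H)) = z
    rw [one_mul, εt_of_mem z.2])
  mul_smul a b z := Subtype.ext (by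
    change εt k (a * b * (z : H)) = εt k (a * εt k (b * z))
    rw [εt_mul_εt, mul_assoc])
  smul_zero a := Subtype.ext (by
    change εt k (a * 0) = 0
    rw [mul_zero, map_zero])
  smul_add a x y := Subtype.ext (by
    change εt k (a * (x + y)) = εt k (a * x) + εt k (a * y)
    rw [mul_add, map_add])
  add_smul a b x := Subtype.ext (by
    change εt k ((a + b) * x) = εt k (a * x) + εt k (b * x)
    rw [add_mul, map_add])
  zero_smul x := Subtype.ext (by
    change εt k (0 * (x : H)) = 0
    rw [zero_mul, map_zero])

/-- The unit object `H_t` of `Rep(H)`. -/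
noncomputable def unitObj : QGRep k H :=
  letI := targetModule k H
  haveI : Module.Finite k H := QuantumGroupoid.finite
  { carrier := targetSub k H
    tower := ⟨fun c h z => Subtype.ext (by
      change εt k ((c • h) * (z : H)) = c • εt k (h * z)
      rw [smul_mul_assoc, map_smul])⟩ }

variable {k H}

/-- The inclusion `H_t ⊂ H`. -/
noncomputable def uinc : (unitObj k H).carrier →ₗ[k] H := (targetSub k H).subtype

lemma uinc_injective : Function.Injective (uinc (k := k) (H := H)) := Subtype.val_injective

@[simp] lemma uinc_smul (h : H) (z : (unitObj k H).carrier) :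
    uinc (h • z) = εt k (h * uinc z) := rfl

@[simp] lemma εt_uinc (z : (unitObj k H).carrier) : εt k (uinc z) = uinc z := εt_of_mem z.2

/-- `ε_t : H → H_t` -/
noncomputable def uproj : H →ₗ[k] (unitObj k H).carrier := (εt k).rangeRestrict

@[simp] lemma uinc_uproj (h : H) : uinc (uproj (k := k) h) = εt k h := rfl

variable (V : QGRep k H)

/-- `z ⊗ v ↦ z·v` -/
noncomputable def leftFun : (tensor (unitObj k H) V).carrier →ₗ[k] V.carrier :=
  TensorProduct.lift ((act V).toLinearMap ∘ₗ uinc) ∘ₗ inc _ _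

/-- `z ⊗ v ↦ ε(z) v` -/
noncomputable def epsL : (unitObj k H).carrier ⊗[k] V.carrier →ₗ[k] V.carrier :=
  (TensorProduct.lid k _).toLinearMap ∘ₗ (ε k ∘ₗ uinc).rTensor _

/-- `v ⊗ z ↦ ε(z) v` -/
noncomputable def epsR : V.carrier ⊗[k] (unitObj k H).carrier →ₗ[k] V.carrier :=
  (TensorProduct.rid k _).toLinearMap ∘ₗ (ε k ∘ₗ uinc).lTensor _

@[simp] lemma epsL_tmul (z : (unitObj k H).carrier) (v : V.carrier) :
    epsL V (z ⊗ₜ v) = ε k (uinc z) • v := by simp [epsL]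

@[simp] lemma epsR_tmul (z : (unitObj k H).carrier) (v : V.carrier) :
    epsR V (v ⊗ₜ z) = ε k (uinc z) • v := by simp [epsR]

lemma epsL_act (s : H ⊗[k] H) (z : (unitObj k H).carrier) (v : V.carrier) :
    epsL V (actT _ V s (z ⊗ₜ v)) = ctrL (uinc z) s • v := by
  induction s using TensorProduct.induction_on with
  | zero => simp
  | add a b ha hb => simp only [map_add, LinearMap.add_apply, ha, hb, add_smul]
  | tmul a b => simp [ε_εt]

lemma epsR_act (s : H ⊗[k] H) (z : (unitObj k H).carrier) (v : V.carrier) :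
    epsR V (actT V _ s (v ⊗ₜ z)) = ctrR (uinc z) s • v := by
  induction s using TensorProduct.induction_on with
  | zero => simp
  | add a b ha hb => simp only [map_add, LinearMap.add_apply, ha, hb, add_smul]
  | tmul a b => simp [ε_εt]

lemma epsL_Δ (h : H) (x : (unitObj k H).carrier ⊗[k] V.carrier) :
    epsL V (actT _ V (Δ k h) x) =
      h • TensorProduct.lift ((act V).toLinearMap ∘ₗ uinc) x := by
  induction x using TensorProduct.induction_on with
  | zero => simp
  | add x y hx hy => simp only [map_add, hx, hy, smul_add]
  | tmul z v =>
    rw [epsL_act, ctrL_Δ, ← εt_eq_ctrL, εt_uinc, mul_smul]; simp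

lemma epsL_inc (x : (tensor (unitObj k H) V).carrier) : epsL V (inc _ _ x) = leftFun V x := by
  rw [← actT_one_inc, epsL_Δ, one_smul]; rfl

/-- `l_V : H_t ⊗ V → V`, `z ⊗ v ↦ z·v` -/
noncomputable def leftHom : tensor (unitObj k H) V ⟶ V where
  lin :=
    { toFun := leftFun V
      map_add' := map_add _
      map_smul' := fun h x => by
        rw [← epsL_inc, inc_smul, epsL_Δ]; rfl }

@[simp] lemma leftHom_lin (x : (tensor (unitObj k H) V).carrier) :
    (leftHom V).lin x = epsL V (inc _ _ x) := (epsL_inc V x).symm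

lemma uinc_one_eq : uinc (uproj (k := k) (1 : H)) = 1 := by rw [uinc_uproj, εt_one]

lemma leftHom_bijective : Function.Bijective (leftHom V).lin := by
  have h1 (v : V.carrier) : (leftHom V).lin (proj _ _ (uproj (k := k) (1 : H) ⊗ₜ v)) = v := by
    rw [leftHom_lin, inc_proj, epsL_act, uinc_one_eq, ctrL_one, one_smul]
  refine ⟨?_, fun v => ⟨_, h1 v⟩⟩
  have h2 (x : (tensor (unitObj k H) V).carrier) :
      proj _ _ (uproj (k := k) (1 : H) ⊗ₜ (leftHom V).lin x) = x := by
    have key (y : (unitObj k H).carrier ⊗[k] V.carrier) :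
        actT _ V (Δ k 1) (uproj (k := k) (1 : H) ⊗ₜ
          TensorProduct.lift ((act V).toLinearMap ∘ₗ uinc) y) = actT _ V (Δ k 1) y := by
      induction y using TensorProduct.induction_on with
      | zero => simp
      | add x y hx hy => simp only [map_add, TensorProduct.tmul_add, hx, hy]
      | tmul z v =>
        let P : H ⊗[k] H →ₗ[k] (unitObj k H).carrier ⊗[k] V.carrier :=
          TensorProduct.map uproj ((LinearMap.flip (act V).toLinearMap) v)
        have hu (x : H) : uproj (εt k x) = uproj (k := k) x :=
          uinc_injective (by simp [εt_εt])
        have hP (s : H ⊗[k] H) : P ((εt k).rTensor H s) = P s := by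
          induction s using TensorProduct.induction_on with
          | zero => simp
          | add x y hx hy => simp only [map_add, hx, hy]
          | tmul a b => simp [P, hu]
        have e1 (s : H ⊗[k] H) : actT _ V s (uproj (k := k) (1 : H) ⊗ₜ (uinc z • v)) =
            P (s * ((1 : H) ⊗ₜ[k] uinc z)) := by
          induction s using TensorProduct.induction_on with
          | zero => simp
          | add x y hx hy => simp only [map_add, add_mul, hx, hy, LinearMap.add_apply]
          | tmul a b =>
            simp only [act₂_tmul, act_apply, Algebra.TensorProduct.tmul_mul_tmul, mul_one, P,
              TensorProduct.map_tmul, LinearMap.flip_apply, AlgHom.toLinearMap_apply, mul_smul]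
            congr 1
            exact uinc_injective (by simp [εt_one])
        have e2 (s : H ⊗[k] H) : actT _ V s (z ⊗ₜ v) = P (s * (uinc z ⊗ₜ[k] (1 : H))) := by
          induction s using TensorProduct.induction_on with
          | zero => simp
          | add x y hx hy => simp only [map_add, add_mul, hx, hy, LinearMap.add_apply]
          | tmul a b =>
            simp only [act₂_tmul, act_apply, Algebra.TensorProduct.tmul_mul_tmul, mul_one, P,
              TensorProduct.map_tmul, LinearMap.flip_apply, AlgHom.toLinearMap_apply]
            congr 1
        have e3 : Δ k (uinc z) = Δ k 1 * (uinc z ⊗ₜ[k] (1 : H)) := by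
          rw [← εt_uinc z, Δ_εt]
        simp only [TensorProduct.lift.tmul, LinearMap.comp_apply, AlgHom.toLinearMap_apply,
          act_apply]
        rw [e1, e2, ← hP, ← e3, ← rTensor_εt_Δ, hP]
    apply inc_injective
    rw [inc_proj]
    exact (key _).trans (actT_one_inc x)
  exact fun x y h => by rw [← h2 x, ← h2 y, h]

/-- `v ⊗ z ↦ ε(z) v`, the inverse of `v ↦ 1₍₁₎·v ⊗ 1₍₂₎` -/
noncomputable def rightHom : tensor V (unitObj k H) ⟶ V where
  lin :=
    { toFun := fun x => epsR V (inc _ _ x)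
      map_add' := fun x y => by rw [map_add, map_add]
      map_smul' := fun h x => by
        have key (h : H) (x : V.carrier ⊗[k] (unitObj k H).carrier) :
            epsR V (actT V _ (Δ k h) x) = h • epsR V (actT V _ (Δ k 1) x) := by
          induction x using TensorProduct.induction_on with
          | zero => simp
          | add x y hx hy => simp only [map_add, hx, hy, smul_add]
          | tmul v z => rw [epsR_act, epsR_act, ctrR_Δ, mul_smul]
        rw [inc_smul, key, actT_one_inc]; rfl }

@[simp] lemma rightHom_lin (x : (tensor V (unitObj k H)).carrier) :
    (rightHom V).lin x = epsR V (inc _ _ x) := rfl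

lemma rightHom_bijective : Function.Bijective (rightHom V).lin := by
  have h1 (v : V.carrier) : (rightHom V).lin (proj _ _ (v ⊗ₜ uproj (k := k) (1 : H))) = v := by
    rw [rightHom_lin, inc_proj, epsR_act, uinc_one_eq, ctrR_one, one_smul]
  refine ⟨?_, fun v => ⟨_, h1 v⟩⟩
  have h2 (x : (tensor V (unitObj k H)).carrier) :
      proj _ _ ((rightHom V).lin x ⊗ₜ uproj (k := k) (1 : H)) = x := by
    have key (y : V.carrier ⊗[k] (unitObj k H).carrier) :
        actT V _ (Δ k 1) (epsR V (actT V _ (Δ k 1) y) ⊗ₜ uproj (k := k) (1 : H)) =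
          actT V _ (Δ k 1) y := by
      induction y using TensorProduct.induction_on with
      | zero => simp
      | add x y hx hy => simp only [map_add, TensorProduct.add_tmul, hx, hy]
      | tmul v z =>
        let P : H ⊗[k] H →ₗ[k] V.carrier ⊗[k] (unitObj k H).carrier :=
          TensorProduct.map ((LinearMap.flip (act V).toLinearMap) v) uproj
        have hu (x : H) : uproj (εt k x) = uproj (k := k) x :=
          uinc_injective (by simp [εt_εt])
        have hP (s : H ⊗[k] H) : P ((εt k).lTensor H s) = P s := by
          induction s using TensorProduct.induction_on with
          | zero => simp
          | add x y hx hy => simp only [map_add, hx, hy]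
          | tmul a b => simp [P, hu]
        have e1 (y : H) (s : H ⊗[k] H) : actT V _ s ((y • v) ⊗ₜ uproj (k := k) (1 : H)) =
            P (s * (y ⊗ₜ[k] (1 : H))) := by
          induction s using TensorProduct.induction_on with
          | zero => simp
          | add x y hx hy => simp only [map_add, add_mul, hx, hy, LinearMap.add_apply]
          | tmul a b =>
            simp only [act₂_tmul, act_apply, Algebra.TensorProduct.tmul_mul_tmul, mul_one, P,
              TensorProduct.map_tmul, LinearMap.flip_apply, AlgHom.toLinearMap_apply, mul_smul]
            congr 1
            exact uinc_injective (by simp [εt_one])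
        have e2 (s : H ⊗[k] H) : actT V _ s (v ⊗ₜ z) = P (s * ((1 : H) ⊗ₜ[k] uinc z)) := by
          induction s using TensorProduct.induction_on with
          | zero => simp
          | add x y hx hy => simp only [map_add, add_mul, hx, hy, LinearMap.add_apply]
          | tmul a b =>
            simp only [act₂_tmul, act_apply, Algebra.TensorProduct.tmul_mul_tmul, mul_one, P,
              TensorProduct.map_tmul, LinearMap.flip_apply, AlgHom.toLinearMap_apply]
            congr 1
        rw [epsR_act, e1, e2, ← hP, ← lTensor_εt_one_mul, hP]
    apply inc_injective
    rw [inc_proj, rightHom_lin]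
    have := key (inc _ _ x)
    rwa [actT_one_inc] at this
  exact fun x y h => by rw [← h2 x, ← h2 y, h]

/-- The left unit isomorphism `H_t ⊗ V ≅ V`. -/
noncomputable def leftUnitor : tensor (unitObj k H) V ≅ V :=
  isoMk (LinearEquiv.ofBijective (leftHom V).lin (leftHom_bijective V))

/-- The right unit isomorphism `V ⊗ H_t ≅ V`. -/
noncomputable def rightUnitor : tensor V (unitObj k H) ≅ V :=
  isoMk (LinearEquiv.ofBijective (rightHom V).lin (rightHom_bijective V))

lemma leftUnitor_lin (x : (tensor (unitObj k H) V).carrier) :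
    (leftUnitor V).hom.lin x = epsL V (inc _ _ x) := leftHom_lin V x

lemma rightUnitor_lin (x : (tensor V (unitObj k H)).carrier) :
    (rightUnitor V).hom.lin x = epsR V (inc _ _ x) := rfl

/-- the inverse of the right unit isomorphism is `v ↦ 1₍₁₎·v ⊗ 1₍₂₎` -/
lemma rightUnitor_inv_lin (v : V.carrier) :
    (rightUnitor V).inv.lin v = proj _ _ (v ⊗ₜ uproj (k := k) (1 : H)) := by
  apply (rightHom_bijective V).1
  change (rightUnitor V).hom.lin ((rightUnitor V).inv.lin v) = _
  rw [← comp_lin, Iso.inv_hom_id, rightHom_lin, inc_proj, epsR_act, uinc_one_eq, ctrR_one,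
    one_smul, id_lin]

end Unit

section Monoidal

variable {k H : Type u} [Field k] [Ring H] [Algebra k H] [QuantumGroupoid k H]
variable {U V W X Y Z : QGRep k H}

lemma map_map_apply {k A B A' B' A'' B'' : Type u} [Field k] [AddCommGroup A] [Module k A]
    [AddCommGroup B] [Module k B] [AddCommGroup A'] [Module k A'] [AddCommGroup B'] [Module k B']
    [AddCommGroup A''] [Module k A''] [AddCommGroup B''] [Module k B'']
    (f : A →ₗ[k] A') (g : B →ₗ[k] B') (f' : A' →ₗ[k] A'') (g' : B' →ₗ[k] B'') (x : A ⊗[k] B) :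
    TensorProduct.map f' g' (TensorProduct.map f g x) =
      TensorProduct.map (f' ∘ₗ f) (g' ∘ₗ g) x := by
  rw [TensorProduct.map_comp]; rfl

lemma klin_id {k H : Type u} [Field k] [Ring H] [Algebra k H] {V : QGRep k H} : klin (𝟙 V) = LinearMap.id := rfl
lemma klin_comp {k H : Type u} [Field k] [Ring H] [Algebra k H] {U V W : QGRep k H} (f : U ⟶ V) (g : V ⟶ W) : klin (f ≫ g) = klin g ∘ₗ klin f := rfl

lemma klin_tensorMap (f : V ⟶ X) (g : W ⟶ Y) : inc X Y ∘ₗ klin (tensorMap f g) =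
    TensorProduct.map (klin f) (klin g) ∘ₗ inc V W :=
  LinearMap.ext fun x => inc_tensorMap f g x

lemma klin_associator : incR U V W ∘ₗ klin (associator U V W).hom =
    (TensorProduct.assoc k _ _ _).toLinearMap ∘ₗ incL U V W :=
  LinearMap.ext fun x => incR_associator x

lemma klin_leftUnitor : klin (leftUnitor V).hom = epsL V ∘ₗ inc _ _ :=
  LinearMap.ext fun x => leftUnitor_lin V x

lemma klin_rightUnitor : klin (rightUnitor V).hom = epsR V ∘ₗ inc _ _ := rfl

noncomputable instance : MonoidalCategoryStruct (QGRep k H) where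
  tensorObj := tensor
  whiskerLeft V _ _ f := tensorMap (𝟙 V) f
  whiskerRight f W := tensorMap f (𝟙 W)
  tensorHom := tensorMap
  tensorUnit := unitObj k H
  associator := associator
  leftUnitor := leftUnitor
  rightUnitor := rightUnitor

lemma tensorMap_comp (f : U ⟶ V) (g : V ⟶ W) (f' : X ⟶ Y) (g' : Y ⟶ Z) :
    tensorMap (f ≫ g) (f' ≫ g') = tensorMap f f' ≫ tensorMap g g' :=
  hom_ext fun x => inc_injective _ _ (by
    simp only [inc_tensorMap, comp_lin, klin_comp, TensorProduct.map_comp, LinearMap.comp_apply])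

lemma tensorMap_id : tensorMap (𝟙 V) (𝟙 W) = 𝟙 (tensor V W) :=
  hom_ext fun x => inc_injective _ _ (by
    simp only [inc_tensorMap, klin_id, TensorProduct.map_id, LinearMap.id_apply, id_lin])

lemma incL_tensorMap (f : U ⟶ X) (g : V ⟶ Y) (h : W ⟶ Z) (x : (tensor (tensor U V) W).carrier) :
    incL X Y Z ((tensorMap (tensorMap f g) h).lin x) =
      TensorProduct.map (TensorProduct.map (klin f) (klin g)) (klin h) (incL U V W x) := by
  simp only [incL, LinearMap.comp_apply, inc_tensorMap]
  rw [LinearMap.rTensor_def, LinearMap.rTensor_def, map_map_apply, map_map_apply, klin_tensorMap]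
  rfl

lemma incR_tensorMap (f : U ⟶ X) (g : V ⟶ Y) (h : W ⟶ Z) (x : (tensor U (tensor V W)).carrier) :
    incR X Y Z ((tensorMap f (tensorMap g h)).lin x) =
      TensorProduct.map (klin f) (TensorProduct.map (klin g) (klin h)) (incR U V W x) := by
  simp only [incR, LinearMap.comp_apply, inc_tensorMap]
  rw [LinearMap.lTensor_def, LinearMap.lTensor_def, map_map_apply, map_map_apply, klin_tensorMap]
  rfl

lemma map_map_assoc {A B C A' B' C' : Type u} [AddCommGroup A] [Module k A] [AddCommGroup B]
    [Module k B] [AddCommGroup C] [Module k C] [AddCommGroup A'] [Module k A'] [AddCommGroup B']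
    [Module k B'] [AddCommGroup C'] [Module k C'] (f : A →ₗ[k] A') (g : B →ₗ[k] B')
    (h : C →ₗ[k] C') (x : (A ⊗[k] B) ⊗[k] C) :
    TensorProduct.map f (TensorProduct.map g h) (TensorProduct.assoc k _ _ _ x) =
      TensorProduct.assoc k _ _ _ (TensorProduct.map (TensorProduct.map f g) h x) := by
  have : TensorProduct.map f (TensorProduct.map g h) ∘ₗ (TensorProduct.assoc k A B C).toLinearMap =
      (TensorProduct.assoc k A' B' C').toLinearMap ∘ₗ
        TensorProduct.map (TensorProduct.map f g) h := by
    ext; simp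
  exact LinearMap.congr_fun this x

lemma pentagon_aux (x : (tensor (tensor (tensor U V) W) X).carrier) :
    (tensorMap (𝟙 U) (associator V W X).hom).lin ((associator U (tensor V W) X).hom.lin
      ((tensorMap (associator U V W).hom (𝟙 X)).lin x)) =
    (associator U V (tensor W X)).hom.lin ((associator (tensor U V) W X).hom.lin x) := by
  -- both sides are compared inside `U ⊗ₖ (V ⊗ₖ (W ⊗ₖ X))`
  apply inc_injective
  apply Module.Flat.lTensor_preserves_injective_linearMap _ (incR_injective V W X)
  rw [inc_tensorMap]
  -- elements of the big tensor products
  set I4 : (tensor (tensor (tensor U V) W) X).carrier →ₗ[k]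
    ((U.carrier ⊗[k] V.carrier) ⊗[k] W.carrier) ⊗[k] X.carrier :=
      (incL U V W).rTensor _ ∘ₗ inc _ _ with hI4
  -- left-hand side
  have L1 (y : U.carrier ⊗[k] (tensor (tensor V W) X).carrier) :
      (incR V W X).lTensor U.carrier
        (TensorProduct.map (klin (𝟙 U)) (klin (associator V W X).hom) y) =
      (TensorProduct.assoc k _ _ _).toLinearMap.lTensor U.carrier
        ((incL V W X).lTensor U.carrier y) := by
    rw [klin_id]
    change (incR V W X).lTensor U.carrier ((klin (associator V W X).hom).lTensor U.carrier y) = _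
    rw [← LinearMap.comp_apply, ← LinearMap.comp_apply, ← LinearMap.lTensor_comp,
      ← LinearMap.lTensor_comp, klin_associator]
  have L2 (y : (tensor U (tensor (tensor V W) X)).carrier) :
      (incL V W X).lTensor U.carrier (inc _ _ y) =
      ((inc V W).rTensor X.carrier).lTensor U.carrier (incR U (tensor V W) X y) := by
    simp only [incL, incR, LinearMap.lTensor_comp, LinearMap.comp_apply]
  have L3 (y : (tensor (tensor U (tensor V W)) X).carrier) :
      ((inc V W).rTensor X.carrier).lTensor U.carrier
        (TensorProduct.assoc k _ _ _ (incL U (tensor V W) X y)) =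
      TensorProduct.assoc k _ _ _ ((incR U V W).rTensor X.carrier (inc _ _ y)) := by
    simp only [incR, incL, LinearMap.rTensor_comp, LinearMap.comp_apply]
    exact map_map_assoc _ _ _ _
  have L4 : (incR U V W).rTensor X.carrier
      (TensorProduct.map (klin (associator U V W).hom) (klin (𝟙 X)) (inc _ _ x)) =
      (TensorProduct.assoc k _ _ _).toLinearMap.rTensor X.carrier (I4 x) := by
    rw [klin_id]
    change (incR U V W).rTensor X.carrier
      ((klin (associator U V W).hom).rTensor X.carrier (inc _ _ x)) = _
    rw [← LinearMap.comp_apply, ← LinearMap.rTensor_comp, klin_associator, hI4,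
      LinearMap.rTensor_comp]
    rfl
  rw [L1, L2, incR_associator, L3, inc_tensorMap, L4]
  -- right-hand side
  have R1 (y : (tensor U (tensor V (tensor W X))).carrier) :
      (incR V W X).lTensor U.carrier (inc _ _ y) =
      ((inc W X).lTensor V.carrier).lTensor U.carrier (incR U V (tensor W X) y) := by
    simp only [incR, LinearMap.lTensor_comp, LinearMap.comp_apply]
  have R2 (y : (tensor (tensor U V) (tensor W X)).carrier) :
      ((inc W X).lTensor V.carrier).lTensor U.carrier
        (TensorProduct.assoc k _ _ _ (incL U V (tensor W X) y)) =
      TensorProduct.assoc k _ _ _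
        ((inc U V).rTensor _ (incR (tensor U V) W X y)) := by
    simp only [incR, incL, LinearMap.comp_apply]
    refine (map_map_assoc _ _ _ _).trans ?_
    congr 1
    rw [TensorProduct.map_id, LinearMap.lTensor_def, LinearMap.rTensor_def, LinearMap.rTensor_def,
      map_map_apply, map_map_apply]
    rfl
  have R3 : (inc U V).rTensor _ (TensorProduct.assoc k _ _ _ (incL (tensor U V) W X x)) =
      TensorProduct.assoc k _ _ _ (I4 x) := by
    simp only [hI4, incL, LinearMap.comp_apply, LinearMap.rTensor_comp]
    rw [LinearMap.rTensor_def, ← TensorProduct.map_id]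
    exact map_map_assoc _ _ _ _
  rw [R1, incR_associator, R2, incR_associator, R3]
  generalize I4 x = y
  have : ((TensorProduct.assoc k V.carrier W.carrier X.carrier).toLinearMap.lTensor U.carrier) ∘ₗ
      (TensorProduct.assoc k U.carrier (V.carrier ⊗[k] W.carrier) X.carrier).toLinearMap ∘ₗ
      ((TensorProduct.assoc k U.carrier V.carrier W.carrier).toLinearMap.rTensor X.carrier) =
      (TensorProduct.assoc k U.carrier V.carrier (W.carrier ⊗[k] X.carrier)).toLinearMap ∘ₗ
      (TensorProduct.assoc k (U.carrier ⊗[k] V.carrier) W.carrier X.carrier).toLinearMap := by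
    ext; simp
  exact LinearMap.congr_fun this y

lemma triangle_aux (x : (tensor (tensor U (unitObj k H)) V).carrier) :
    (tensorMap (𝟙 U) (leftUnitor V).hom).lin ((associator U (unitObj k H) V).hom.lin x) =
      (tensorMap (rightUnitor U).hom (𝟙 V)).lin x := by
  apply inc_injective
  rw [inc_tensorMap, inc_tensorMap, klin_leftUnitor, klin_rightUnitor, klin_id, klin_id]
  change ((epsL V ∘ₗ inc _ _).lTensor U.carrier) _ = ((epsR U ∘ₗ inc _ _).rTensor V.carrier) _
  rw [LinearMap.lTensor_comp, LinearMap.rTensor_comp, LinearMap.comp_apply, LinearMap.comp_apply]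
  change (epsL V).lTensor U.carrier (incR _ _ _ _) = (epsR U).rTensor V.carrier (incL _ _ _ x)
  rw [incR_associator]
  generalize incL U (unitObj k H) V x = y
  have : (epsL V).lTensor U.carrier ∘ₗ (TensorProduct.assoc k _ _ _).toLinearMap =
      (epsR U).rTensor V.carrier := by
    ext u z v
    simp [TensorProduct.smul_tmul]
  exact LinearMap.congr_fun this y

noncomputable instance : MonoidalCategory (QGRep k H) where
  tensorHom_def f g := by
    change tensorMap _ _ = tensorMap _ _ ≫ tensorMap _ _
    rw [← tensorMap_comp, Category.comp_id, Category.id_comp]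
  id_tensorHom_id _ _ := tensorMap_id
  tensorHom_comp_tensorHom _ _ _ _ := (tensorMap_comp _ _ _ _).symm
  whiskerLeft_id _ _ := tensorMap_id
  id_whiskerRight _ _ := tensorMap_id
  associator_naturality f g h := hom_ext fun x => incR_injective _ _ _ (by
    change incR _ _ _ ((associator _ _ _).hom.lin ((tensorMap (tensorMap f g) h).lin x)) =
      incR _ _ _ ((tensorMap f (tensorMap g h)).lin ((associator _ _ _).hom.lin x))
    rw [incR_associator, incL_tensorMap, incR_tensorMap, incR_associator, map_map_assoc])
  leftUnitor_naturality {V W} f := hom_ext fun x => by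
    change (leftUnitor W).hom.lin ((tensorMap (𝟙 _) f).lin x) = f.lin ((leftUnitor V).hom.lin x)
    rw [leftUnitor_lin, leftUnitor_lin, inc_tensorMap]
    generalize inc _ _ x = y
    induction y using TensorProduct.induction_on with
    | zero => simp
    | add x y hx hy => simp only [map_add, hx, hy]
    | tmul z v =>
      change epsL W (z ⊗ₜ f.lin v) = f.lin (epsL V (z ⊗ₜ v))
      rw [epsL_tmul, epsL_tmul]
      exact ((klin f).map_smul _ _).symm
  rightUnitor_naturality {V W} f := hom_ext fun x => by
    change (rightUnitor W).hom.lin ((tensorMap f (𝟙 _)).lin x) = f.lin ((rightUnitor V).hom.lin x)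
    rw [rightUnitor_lin, rightUnitor_lin, inc_tensorMap]
    generalize inc _ _ x = y
    induction y using TensorProduct.induction_on with
    | zero => simp
    | add x y hx hy => simp only [map_add, hx, hy]
    | tmul v z =>
      change epsR W (f.lin v ⊗ₜ z) = f.lin (epsR V (v ⊗ₜ z))
      rw [epsR_tmul, epsR_tmul]
      exact ((klin f).map_smul _ _).symm
  pentagon U V W X := hom_ext fun x => pentagon_aux x
  triangle U V := hom_ext fun x => triangle_aux x

instance : MonoidalPreadditive (QGRep k H) where
  whiskerLeft_zero := hom_ext fun x => inc_injective _ _ (by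
    refine (inc_tensorMap _ _ x).trans ?_
    rw [show klin (0 : _ ⟶ _) = 0 from rfl, TensorProduct.map_zero_right]; rfl)
  zero_whiskerRight := hom_ext fun x => inc_injective _ _ (by
    refine (inc_tensorMap _ _ x).trans ?_
    rw [show klin (0 : _ ⟶ _) = 0 from rfl, TensorProduct.map_zero_left]; rfl)
  whiskerLeft_add f g := hom_ext fun x => inc_injective _ _ (by
    refine (inc_tensorMap _ _ x).trans ?_
    rw [show klin (f + g) = klin f + klin g from rfl, TensorProduct.map_add_right]
    exact congrArg₂ (· + ·) (inc_tensorMap _ _ x).symm (inc_tensorMap _ _ x).symm)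
  add_whiskerRight f g := hom_ext fun x => inc_injective _ _ (by
    refine (inc_tensorMap _ _ x).trans ?_
    rw [show klin (f + g) = klin f + klin g from rfl, TensorProduct.map_add_left]
    exact congrArg₂ (· + ·) (inc_tensorMap _ _ x).symm (inc_tensorMap _ _ x).symm)

instance : MonoidalLinear k (QGRep k H) where
  whiskerLeft_smul V _ _ r f := hom_ext fun x => inc_injective _ _ (by
    refine (inc_tensorMap _ _ x).trans ?_
    rw [show klin (r • f) = r • klin f from rfl, TensorProduct.map_smul_right]
    exact congrArg (r • ·) (inc_tensorMap _ _ x).symm)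
  smul_whiskerRight r _ _ f V := hom_ext fun x => inc_injective _ _ (by
    refine (inc_tensorMap _ _ x).trans ?_
    rw [show klin (r • f) = r • klin f from rfl, TensorProduct.map_smul_left]
    exact congrArg (r • ·) (inc_tensorMap _ _ x).symm)

end Monoidal
end QGRep

/-- A twist on a braided category with (right) duals which is compatible with duality. -/
class RibbonCategory (C : Type*) [Category C] [MonoidalCategory C] [BraidedCategory C]
    [RightRigidCategory C] where
  twist (X : C) : X ≅ X
  twist_naturality {X Y : C} (f : X ⟶ Y) : f ≫ (twist Y).hom = (twist X).hom ≫ f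
  twist_tensor (X Y : C) : (twist (X ⊗ Y)).hom =
    ((twist X).hom ⊗ₘ (twist Y).hom) ≫ (β_ X Y).hom ≫ (β_ Y X).hom
  twist_dual (X : C) : η_ X Xᘁ ≫ (twist X).hom ▷ Xᘁ = η_ X Xᘁ ≫ X ◁ (twist Xᘁ).hom

namespace QGRep
open QuantumGroupoid

section Comm

variable {k H : Type u} [Field k] [Ring H] [Algebra k H] {V W : QGRep k H}

lemma comm_mul (s t : H ⊗[k] H) : TensorProduct.comm k H H (s * t) =
    TensorProduct.comm k H H s * TensorProduct.comm k H H t :=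
  map_mul (Algebra.TensorProduct.comm k H H) s t

lemma actT_comm (s : H ⊗[k] H) (x : V.carrier ⊗[k] W.carrier) :
    actT W V (TensorProduct.comm k H H s) (TensorProduct.comm k _ _ x) =
      TensorProduct.comm k _ _ (actT V W s x) := by
  induction s using TensorProduct.induction_on with
  | zero => simp
  | add a b ha hb => simp only [map_add, LinearMap.add_apply, ha, hb]
  | tmul a b =>
    induction x using TensorProduct.induction_on with
    | zero => simp
    | add x y hx hy => simp only [map_add, hx, hy]
    | tmul x y => simp

end Comm

section Braiding

variable {k H : Type u} [Field k] [Ring H] [Algebra k H] [QuasitriangularQuantumGroupoid k H]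
variable {U V W X Y Z : QGRep k H}

variable (k H) in
/-- the `R`-matrix -/
noncomputable abbrev Rm : H ⊗[k] H := QuasitriangularQuantumGroupoid.R

variable (k H) in
/-- the element `R₂₁` -/
noncomputable def R21 : H ⊗[k] H := TensorProduct.comm k H H (Rm k H)

lemma R21_mul (h : H) : Δ k h * R21 k H = R21 k H * TensorProduct.comm k H H (Δ k h) := by
  have := congrArg (TensorProduct.comm k H H) (QuasitriangularQuantumGroupoid.Δop_mul_R (k := k) h)
  rw [comm_mul, comm_mul] at this
  rwa [Δop, LinearMap.comp_apply, LinearEquiv.coe_coe, TensorProduct.comm_comm] at this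

/-- `x ↦ R₍₂₎·x₍₂₎ ⊗ R₍₁₎·x₍₁₎` on `V ⊗ₖ W` -/
noncomputable def brFun (V W : QGRep k H) :
    V.carrier ⊗[k] W.carrier →ₗ[k] W.carrier ⊗[k] V.carrier :=
  actT W V (R21 k H) ∘ₗ (TensorProduct.comm k _ _).toLinearMap

lemma brFun_apply (x : V.carrier ⊗[k] W.carrier) :
    brFun V W x = actT W V (R21 k H) (TensorProduct.comm k _ _ x) := rfl

/-- The action of `R₂₁`, as a morphism. -/
noncomputable def brHom (V W : QGRep k H) : tensor V W ⟶ tensor W V :=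
  lift (brFun V W ∘ₗ inc V W) fun h x => by
    simp only [LinearMap.comp_apply, brFun_apply, inc_smul]
    rw [← actT_comm, ← Module.End.mul_apply, ← Module.End.mul_apply, ← map_mul, ← map_mul, R21_mul]

lemma inc_brHom (x : (tensor V W).carrier) :
    inc W V ((brHom V W).lin x) = brFun V W (inc V W x) := inc_lift _ _ x

lemma brHom_bijective (V W : QGRep k H) : Function.Bijective (brHom V W).lin := by
  obtain ⟨r, h1, h2⟩ := QuasitriangularQuantumGroupoid.exists_R_inv (k := k) (H := H)
  set r' := Δ k 1 * r * Δop k 1 with hr'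
  have h3 : Δ k 1 * r' = r' := by
    rw [hr', ← mul_assoc, ← mul_assoc, Δ_one_mul_Δ]
  have h4 : R21 k H * TensorProduct.comm k H H r' = Δ k 1 := by
    rw [R21, ← comm_mul, h1]; simp [Δop]
  constructor
  · have key (x : (tensor V W).carrier) : actT V W r' (TensorProduct.comm k _ _
        (inc W V ((brHom V W).lin x))) = inc V W x := by
      rw [inc_brHom, brFun_apply, R21, actT_comm, TensorProduct.comm_comm, ← Module.End.mul_apply,
        ← map_mul, h2, actT_one_inc]
    intro x y hxy
    apply inc_injective
    rw [← key x, ← key y, hxy]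
  · intro y
    refine ⟨proj V W (actT V W r' (TensorProduct.comm k _ _ (inc W V y))), inc_injective _ _ ?_⟩
    rw [inc_brHom, inc_proj, ← Module.End.mul_apply, ← map_mul, h3, brFun_apply, ← actT_comm,
      TensorProduct.comm_comm, ← Module.End.mul_apply, ← map_mul, h4, actT_one_inc]

/-- The braiding of `Rep(H)`. -/
noncomputable def braid (V W : QGRep k H) : tensor V W ≅ tensor W V :=
  isoMk (LinearEquiv.ofBijective (brHom V W).lin (brHom_bijective V W))

lemma inc_braid (x : (tensor V W).carrier) :
    inc W V ((braid V W).hom.lin x) = brFun V W (inc V W x) := inc_brHom x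

lemma klin_braid : inc W V ∘ₗ klin (braid V W).hom = brFun V W ∘ₗ inc V W :=
  LinearMap.ext fun x => inc_braid x

lemma braid_naturality (f : V ⟶ X) (g : W ⟶ Y) (x : (tensor V W).carrier) :
    (braid X Y).hom.lin ((tensorMap f g).lin x) = (tensorMap g f).lin ((braid V W).hom.lin x) := by
  apply inc_injective
  rw [inc_braid, inc_tensorMap, inc_tensorMap, inc_braid, brFun_apply, brFun_apply, ← actT_map]
  congr 1
  generalize inc V W x = y
  induction y using TensorProduct.induction_on with
  | zero => simp
  | add x y hx hy => simp only [map_add, hx, hy]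
  | tmul x y => simp

lemma incL_associator_inv (x : (tensor U (tensor V W)).carrier) :
    incL U V W ((associator U V W).inv.lin x) =
      (TensorProduct.assoc k _ _ _).symm (incR U V W x) := by
  rw [LinearEquiv.eq_symm_apply, ← incR_associator, ← comp_lin, Iso.inv_hom_id, id_lin]

lemma incL_braid (x : (tensor U (tensor V W)).carrier) :
    incL V W U ((braid U (tensor V W)).hom.lin x) =
      act3 V W U ((Δ k).rTensor H (R21 k H)) (TensorProduct.comm k _ _ (incR U V W x)) := by
  rw [incL, LinearMap.comp_apply, inc_braid, brFun_apply, rTensor_inc_actT, incR,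
    LinearMap.comp_apply]
  congr 1
  generalize inc _ _ x = y
  induction y using TensorProduct.induction_on with
  | zero => simp
  | add x y hx hy => simp only [map_add, hx, hy]
  | tmul x y => simp

lemma incR_braid (x : (tensor (tensor U V) W).carrier) :
    incR W U V ((braid (tensor U V) W).hom.lin x) =
      act₂ (act W) (actT U V) ((Δ k).lTensor H (R21 k H))
        (TensorProduct.comm k _ _ (incL U V W x)) := by
  rw [incR, LinearMap.comp_apply, inc_braid, brFun_apply, lTensor_inc_actT, incL,
    LinearMap.comp_apply]
  congr 1
  generalize inc _ _ x = y
  induction y using TensorProduct.induction_on with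
  | zero => simp
  | add x y hx hy => simp only [map_add, hx, hy]
  | tmul x y => simp

lemma incL_braid_whisker (x : (tensor (tensor U V) W).carrier) :
    incL V U W ((tensorMap (braid U V).hom (𝟙 W)).lin x) =
      (brFun U V).rTensor W.carrier (incL U V W x) := by
  rw [incL, LinearMap.comp_apply, inc_tensorMap, incL, LinearMap.comp_apply, klin_id,
    LinearMap.rTensor_def, LinearMap.rTensor_def, LinearMap.rTensor_def, map_map_apply,
    map_map_apply, klin_braid]

lemma incR_braid_whisker (x : (tensor U (tensor V W)).carrier) :
    incR U W V ((tensorMap (𝟙 U) (braid V W).hom).lin x) =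
      (brFun V W).lTensor U.carrier (incR U V W x) := by
  rw [incR, LinearMap.comp_apply, inc_tensorMap, incR, LinearMap.comp_apply, klin_id,
    LinearMap.lTensor_def, LinearMap.lTensor_def, LinearMap.lTensor_def, map_map_apply,
    map_map_apply, klin_braid]

/-- `R₁₃(s) R₁₂(t)` -/
noncomputable def r13 (s : H ⊗[k] H) : (H ⊗[k] H) ⊗[k] H :=
  TensorProduct.rightComm k H H H (s ⊗ₜ[k] (1 : H))

lemma hexagon_aux (y : (X.carrier ⊗[k] Y.carrier) ⊗[k] Z.carrier) :
    TensorProduct.assoc k _ _ _ (act3 Y Z X ((Δ k).rTensor H (R21 k H))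
      (TensorProduct.comm k _ _ (TensorProduct.assoc k _ _ _ y))) =
    (brFun X Z).lTensor Y.carrier (TensorProduct.assoc k _ _ _
      ((brFun X Y).rTensor Z.carrier y)) := by
  induction y using TensorProduct.induction_on with
  | zero => simp
  | add x y hx hy => simp only [map_add, hx, hy]
  | tmul y z =>
  induction y using TensorProduct.induction_on with
  | zero => simp
  | add x y hx hy => simp only [TensorProduct.add_tmul, map_add, hx, hy]
  | tmul x y =>
  let M' : (H ⊗[k] H) ⊗[k] H →ₗ[k] Y.carrier ⊗[k] (Z.carrier ⊗[k] X.carrier) :=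
    TensorProduct.map ((act Y).toLinearMap.flip y)
      (TensorProduct.map ((act Z).toLinearMap.flip z) ((act X).toLinearMap.flip x)) ∘ₗ
      (TensorProduct.comm k H H).toLinearMap.lTensor H ∘ₗ
      (TensorProduct.leftComm k H H H).toLinearMap ∘ₗ
      (TensorProduct.assoc k H H H).toLinearMap
  have hM (a b c : H) : M' ((a ⊗ₜ b) ⊗ₜ c) = (b • y) ⊗ₜ ((c • z) ⊗ₜ (a • x)) := by simp [M']
  have e1 (s : H ⊗[k] H) : TensorProduct.assoc k _ _ _ (act3 Y Z X ((Δ k).rTensor H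
      (TensorProduct.comm k H H s)) ((y ⊗ₜ z) ⊗ₜ x)) =
      M' ((TensorProduct.assoc k H H H).symm ((Δ k).lTensor H s)) := by
    induction s using TensorProduct.induction_on with
    | zero => simp
    | add a b ha hb => simp only [map_add, LinearMap.add_apply, ha, hb]
    | tmul a b =>
      simp only [TensorProduct.comm_tmul, LinearMap.rTensor_tmul, LinearMap.lTensor_tmul]
      induction Δ k b using TensorProduct.induction_on with
      | zero => simp
      | add u v hu hv =>
        simp only [TensorProduct.add_tmul, TensorProduct.tmul_add, map_add, LinearMap.add_apply,
          hu, hv]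
      | tmul u v => simp [hM]
  have e2 (s t : H ⊗[k] H) : M' (r13 s * (t ⊗ₜ[k] (1 : H))) =
      (actT Z X (TensorProduct.comm k H H s) ∘ₗ (TensorProduct.comm k _ _).toLinearMap).lTensor
        Y.carrier (TensorProduct.assoc k _ _ _
          ((actT Y X (TensorProduct.comm k H H t) (y ⊗ₜ x)) ⊗ₜ z)) := by
    induction t using TensorProduct.induction_on with
    | zero => simp
    | add a b ha hb =>
      simp only [map_add, LinearMap.add_apply, TensorProduct.add_tmul, mul_add, ha, hb]
    | tmul c d =>
      induction s using TensorProduct.induction_on with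
      | zero => simp [r13]
      | add a b ha hb =>
        have : r13 (a + b) = r13 a + r13 b := by simp [r13, TensorProduct.add_tmul]
        rw [this, add_mul, map_add, ha, hb, map_add, map_add, LinearMap.add_comp,
          LinearMap.lTensor_add, LinearMap.add_apply]
      | tmul a b => simp [r13, hM, mul_smul]
  have e3 := QuasitriangularQuantumGroupoid.lTensor_R (k := k) (H := H)
  simp only [TensorProduct.assoc_tmul, TensorProduct.comm_tmul]
  rw [R21, e1, e3, ← r13, e2]
  rfl

lemma hexagon_aux' (y : X.carrier ⊗[k] (Y.carrier ⊗[k] Z.carrier)) :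
    (TensorProduct.assoc k _ _ _).symm (act₂ (act Z) (actT X Y) ((Δ k).lTensor H (R21 k H))
      (TensorProduct.comm k _ _ ((TensorProduct.assoc k _ _ _).symm y))) =
    (brFun X Z).rTensor Y.carrier ((TensorProduct.assoc k _ _ _).symm
      ((brFun Y Z).lTensor X.carrier y)) := by
  induction y using TensorProduct.induction_on with
  | zero => simp
  | add x y hx hy => simp only [map_add, hx, hy]
  | tmul x y =>
  induction y using TensorProduct.induction_on with
  | zero => simp
  | add x y hx hy => simp only [TensorProduct.tmul_add, map_add, hx, hy]
  | tmul y z =>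
  let M : (H ⊗[k] H) ⊗[k] H →ₗ[k] (Z.carrier ⊗[k] X.carrier) ⊗[k] Y.carrier :=
    TensorProduct.map
      (TensorProduct.map ((act Z).toLinearMap.flip z) ((act X).toLinearMap.flip x))
      ((act Y).toLinearMap.flip y) ∘ₗ
      (TensorProduct.comm k H H).toLinearMap.rTensor H ∘ₗ
      (TensorProduct.rightComm k H H H).toLinearMap
  have hM (a b c : H) : M ((a ⊗ₜ b) ⊗ₜ c) = ((c • z) ⊗ₜ (a • x)) ⊗ₜ (b • y) := by simp [M]
  have e1 (s : H ⊗[k] H) : (TensorProduct.assoc k _ _ _).symm (act₂ (act Z) (actT X Y)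
      ((Δ k).lTensor H (TensorProduct.comm k H H s)) (z ⊗ₜ (x ⊗ₜ y))) =
      M ((Δ k).rTensor H s) := by
    induction s using TensorProduct.induction_on with
    | zero => simp
    | add a b ha hb => simp only [map_add, LinearMap.add_apply, ha, hb]
    | tmul a b =>
      simp only [TensorProduct.comm_tmul, LinearMap.rTensor_tmul, LinearMap.lTensor_tmul]
      induction Δ k a using TensorProduct.induction_on with
      | zero => simp
      | add u v hu hv =>
        simp only [TensorProduct.add_tmul, TensorProduct.tmul_add, map_add, LinearMap.add_apply,
          hu, hv]
      | tmul u v => simp [hM]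
  have e2 (s t : H ⊗[k] H) :
      M (r13 s * (TensorProduct.assoc k H H H).symm ((1 : H) ⊗ₜ[k] t)) =
      (actT Z X (TensorProduct.comm k H H s) ∘ₗ (TensorProduct.comm k _ _).toLinearMap).rTensor
        Y.carrier ((TensorProduct.assoc k _ _ _).symm
          (x ⊗ₜ (actT Z Y (TensorProduct.comm k H H t) (z ⊗ₜ y)))) := by
    induction t using TensorProduct.induction_on with
    | zero => simp
    | add a b ha hb =>
      simp only [map_add, LinearMap.add_apply, TensorProduct.tmul_add, mul_add, ha, hb]
    | tmul c d =>
      induction s using TensorProduct.induction_on with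
      | zero => simp [r13]
      | add a b ha hb =>
        have : r13 (a + b) = r13 a + r13 b := by simp [r13, TensorProduct.add_tmul]
        rw [this, add_mul, map_add, ha, hb, map_add, map_add, LinearMap.add_comp,
          LinearMap.rTensor_add, LinearMap.add_apply]
      | tmul a b => simp [r13, hM, mul_smul]
  have e3 := QuasitriangularQuantumGroupoid.rTensor_R (k := k) (H := H)
  simp only [TensorProduct.assoc_symm_tmul, TensorProduct.comm_tmul]
  rw [R21, e1, e3, ← r13, e2]
  rfl

noncomputable instance : BraidedCategory (QGRep k H) where
  braiding := braid
  braiding_naturality_right X _ _ f := hom_ext fun x => braid_naturality (𝟙 X) f x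
  braiding_naturality_left f Z := hom_ext fun x => braid_naturality f (𝟙 Z) x
  hexagon_forward X Y Z := hom_ext fun x => incR_injective _ _ _ (by
    change incR Y Z X ((associator Y Z X).hom.lin ((braid X (tensor Y Z)).hom.lin
      ((associator X Y Z).hom.lin x))) =
      incR Y Z X ((tensorMap (𝟙 Y) (braid X Z).hom).lin ((associator Y X Z).hom.lin
        ((tensorMap (braid X Y).hom (𝟙 Z)).lin x)))
    rw [incR_associator, incL_braid, incR_associator, incR_braid_whisker, incR_associator,
      incL_braid_whisker, hexagon_aux])
  hexagon_reverse X Y Z := hom_ext fun x => incL_injective _ _ _ (by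
    change incL Z X Y ((associator Z X Y).inv.lin ((braid (tensor X Y) Z).hom.lin
      ((associator X Y Z).inv.lin x))) =
      incL Z X Y ((tensorMap (braid X Z).hom (𝟙 Y)).lin ((associator X Z Y).inv.lin
        ((tensorMap (𝟙 X) (braid Y Z).hom).lin x)))
    rw [incL_associator_inv, incR_braid, incL_associator_inv, incL_braid_whisker,
      incL_associator_inv, incR_braid_whisker, hexagon_aux'])

end Braiding

section Duality

variable {k H : Type u} [Field k] [Ring H] [Algebra k H] [QuantumGroupoid k H]

/-- `(h·φ)(v) = φ(S(h)·v)` on `V* = Hom_k(V, k)` -/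
@[reducible] noncomputable def dualModule (V : QGRep k H) : Module H (Module.Dual k V.carrier) where
  smul h φ := φ ∘ₗ act V (S k h)
  one_smul φ := by
    change φ ∘ₗ act V (S k 1) = φ
    rw [show S k (1 : H) = 1 from antipode_one, map_one]; rfl
  mul_smul a b φ := by
    change φ ∘ₗ act V (S k (a * b)) = (φ ∘ₗ act V (S k b)) ∘ₗ act V (S k a)
    rw [show S k (a * b) = S k b * S k a from antipode_mul a b, map_mul]; rfl
  smul_zero a := LinearMap.zero_comp _
  smul_add a φ ψ := LinearMap.add_comp _ _ _
  add_smul a b φ := by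
    change φ ∘ₗ act V (S k (a + b)) = φ ∘ₗ act V (S k a) + φ ∘ₗ act V (S k b)
    rw [map_add, map_add, LinearMap.comp_add]
  zero_smul φ := by
    change φ ∘ₗ act V (S k 0) = 0
    rw [map_zero, map_zero, LinearMap.comp_zero]

/-- The dual object `V*`. -/
noncomputable def dual (V : QGRep k H) : QGRep k H :=
  letI := dualModule V
  { carrier := Module.Dual k V.carrier
    tower := ⟨fun c h φ => by
      change φ ∘ₗ act V (S k (c • h)) = c • (φ ∘ₗ act V (S k h))
      rw [map_smul, map_smul, LinearMap.comp_smul]⟩ }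

variable (V : QGRep k H)

/-- elements of `V*` as functionals -/
noncomputable def dualEquiv : (dual V).carrier ≃ₗ[k] Module.Dual k V.carrier :=
  LinearEquiv.refl k (Module.Dual k V.carrier)

@[simp] lemma dualEquiv_smul (h : H) (φ : (dual V).carrier) (v : V.carrier) :
    dualEquiv V (h • φ) v = dualEquiv V φ (S k h • v) := rfl

/-- the identification `V ⊗ V* ≅ End_k(V)` -/
noncomputable def opEquiv : V.carrier ⊗[k] (dual V).carrier ≃ₗ[k] Module.End k V.carrier :=
  TensorProduct.comm k _ _ ≪≫ₗ
    (dualTensorHomEquiv k V.carrier V.carrier :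
      Module.Dual k V.carrier ⊗[k] V.carrier ≃ₗ[k] (V.carrier →ₗ[k] V.carrier))

@[simp] lemma opEquiv_tmul (v w : V.carrier) (φ : (dual V).carrier) :
    opEquiv V (v ⊗ₜ φ) w = dualEquiv V φ w • v := rfl

/-- `x₁ ⊗ x₂ ↦ x₁ T S(x₂)` -/
noncomputable def sw (T : Module.End k V.carrier) : H ⊗[k] H →ₗ[k] Module.End k V.carrier :=
  LinearMap.mul' k _ ∘ₗ TensorProduct.map (LinearMap.mulRight k T ∘ₗ (act V).toLinearMap)
    ((act V).toLinearMap ∘ₗ S k)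

lemma opEquiv_act (s : H ⊗[k] H) (x : V.carrier ⊗[k] (dual V).carrier) :
    opEquiv V (actT V (dual V) s x) = sw V (opEquiv V x) s := by
  induction s using TensorProduct.induction_on with
  | zero => simp
  | add a b ha hb => simp only [map_add, LinearMap.add_apply, ha, hb]
  | tmul a b =>
    induction x using TensorProduct.induction_on with
    | zero => simp [sw]
    | add x y hx hy =>
      rw [map_add, map_add, hx, hy, map_add]
      simp [sw, mul_add, add_mul]
    | tmul v φ =>
      ext w
      simp [sw, Module.End.mul_apply]

/-- the canonical element `∑ fᵢ ⊗ ξⁱ` of `V ⊗ₖ V*`, for dual bases `(fᵢ)`, `(ξⁱ)` -/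
noncomputable def canon : V.carrier ⊗[k] (dual V).carrier := coevaluation k V.carrier 1

lemma opEquiv_canon : opEquiv V (canon V) = 1 := by
  ext w
  rw [canon, coevaluation_apply_one]
  change opEquiv V (∑ i, Module.Basis.ofVectorSpace k V.carrier i ⊗ₜ
    ((dualEquiv V).symm ((Module.Basis.ofVectorSpace k V.carrier).coord i))) w = w
  rw [map_sum, LinearMap.sum_apply]
  simp only [opEquiv_tmul, LinearEquiv.apply_symm_apply]
  exact (Module.Basis.ofVectorSpace k V.carrier).sum_repr w

/-- `z ↦ z · ∑ fᵢ ⊗ ξⁱ` -/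
noncomputable def coevFun : (unitObj k H).carrier →ₗ[k] V.carrier ⊗[k] (dual V).carrier :=
  (LinearMap.applyₗ (canon V)) ∘ₗ (actT V (dual V)).toLinearMap ∘ₗ Δ k ∘ₗ uinc

lemma coevFun_apply (z : (unitObj k H).carrier) :
    coevFun V z = actT V (dual V) (Δ k (uinc z)) (canon V) := rfl

lemma opEquiv_Δ (h : H) : opEquiv V (actT V (dual V) (Δ k h) (canon V)) = act V (εt k h) := by
  rw [opEquiv_act, opEquiv_canon]
  change _ = act V (LinearMap.mul' k H ((S k).lTensor H (Δ k h)))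
  induction Δ k h using TensorProduct.induction_on with
  | zero => simp
  | add a b ha hb => simp only [map_add, ha, hb]
  | tmul a b => simp [sw]

/-- The coevaluation `b_V : H_t → V ⊗ V*`, `z ↦ z · ∑ fᵢ ⊗ ξⁱ`. -/
noncomputable def coevHom : unitObj k H ⟶ tensor V (dual V) :=
  lift (coevFun V) fun h z => (opEquiv V).injective (by
    rw [coevFun_apply, coevFun_apply, ← Module.End.mul_apply, ← map_mul, ← Δ_mul, opEquiv_Δ,
      opEquiv_Δ, uinc_smul, εt_εt])

lemma inc_coevHom (z : (unitObj k H).carrier) :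
    inc V (dual V) ((coevHom V).lin z) = coevFun V z := inc_lift _ _ z

lemma opEquiv_coevFun (z : (unitObj k H).carrier) : opEquiv V (coevFun V z) = act V (uinc z) := by
  rw [coevFun_apply, opEquiv_Δ, εt_uinc]

/-- `φ ⊗ v ↦ (h ↦ φ(h·v))` -/
noncomputable def matrixCoeff : (dual V).carrier ⊗[k] V.carrier →ₗ[k] Module.Dual k H :=
  TensorProduct.lift (LinearMap.mk₂ k
    (fun φ v => dualEquiv V φ ∘ₗ ((act V).toLinearMap.flip v))
    (by intros; rw [map_add, LinearMap.add_comp])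
    (by intros; rw [map_smul, LinearMap.smul_comp])
    (by intros; rw [map_add, LinearMap.comp_add])
    (by intros; rw [map_smul, LinearMap.comp_smul]))

@[simp] lemma matrixCoeff_tmul (φ : (dual V).carrier) (v : V.carrier) (h : H) :
    matrixCoeff V (φ ⊗ₜ v) h = dualEquiv V φ (h • v) := rfl

/-- `φ ⊗ v ↦ φ(1₍₁₎·v) 1₍₂₎` -/
noncomputable def evFun : (dual V).carrier ⊗[k] V.carrier →ₗ[k] (unitObj k H).carrier :=
  uproj ∘ₗ (TensorProduct.lid k H).toLinearMap ∘ₗ LinearMap.applyₗ (Δ k (1 : H)) ∘ₗ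
    LinearMap.rTensorHom H ∘ₗ matrixCoeff V

lemma uinc_evFun (x : (dual V).carrier ⊗[k] V.carrier) : uinc (evFun V x) =
    TensorProduct.lid k H ((matrixCoeff V x).rTensor H (Δ k (1 : H))) := by
  have h (s : H ⊗[k] H) : εt k (TensorProduct.lid k H ((matrixCoeff V x).rTensor H s)) =
      TensorProduct.lid k H ((matrixCoeff V x).rTensor H ((εt k).lTensor H s)) := by
    induction s using TensorProduct.induction_on with
    | zero => simp
    | add a b ha hb => simp only [map_add, ha, hb]
    | tmul a b => simp
  change εt k (TensorProduct.lid k H ((matrixCoeff V x).rTensor H (Δ k (1 : H)))) = _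
  rw [h, lTensor_εt_one]

lemma ε_evFun (x : (dual V).carrier ⊗[k] V.carrier) : ε k (uinc (evFun V x)) =
    matrixCoeff V x 1 := by
  have h (s : H ⊗[k] H) : ε k (TensorProduct.lid k H ((matrixCoeff V x).rTensor H s)) =
      matrixCoeff V x (TensorProduct.rid k H ((ε k).lTensor H s)) := by
    induction s using TensorProduct.induction_on with
    | zero => simp
    | add a b ha hb => simp only [map_add, ha, hb]
    | tmul a b => simp [mul_comm]
  rw [uinc_evFun, h, counit_rid]

lemma evFun_Δ (h : H) (x : (dual V).carrier ⊗[k] V.carrier) :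
    evFun V (actT (dual V) V (Δ k h) x) = h • evFun V x := by
  apply uinc_injective
  rw [uinc_smul, uinc_evFun, uinc_evFun]
  have e1 (s t : H ⊗[k] H) : TensorProduct.lid k H
      ((matrixCoeff V (actT (dual V) V s x)).rTensor H t) =
      TensorProduct.lid k H ((matrixCoeff V x).rTensor H (sandwich t s)) := by
    induction s using TensorProduct.induction_on with
    | zero => simp
    | add a b ha hb =>
      simp only [map_add, LinearMap.add_apply, LinearMap.rTensor_add, ha, hb]
    | tmul a b =>
      rw [sandwich_tmul]
      induction t using TensorProduct.induction_on with
      | zero => simp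
      | add u v hu hv => simp only [map_add, mul_add, add_mul, hu, hv]
      | tmul c d =>
        simp only [Algebra.TensorProduct.tmul_mul_tmul, one_mul, mul_one, LinearMap.rTensor_tmul,
          TensorProduct.lid_tmul]
        congr 1
        induction x using TensorProduct.induction_on with
        | zero => simp
        | add u v hu hv => simp only [map_add, LinearMap.add_apply, hu, hv]
        | tmul φ v => simp [mul_smul]
  have e2 (t : H ⊗[k] H) : εt k (h * TensorProduct.lid k H ((matrixCoeff V x).rTensor H t)) =
      TensorProduct.lid k H ((matrixCoeff V x).rTensor H
        ((εt k).lTensor H (((1 : H) ⊗ₜ[k] h) * t))) := by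
    induction t using TensorProduct.induction_on with
    | zero => simp
    | add u v hu hv => simp only [map_add, mul_add, hu, hv]
    | tmul c d => simp
  rw [e1, ← lTensor_εt_mul_one, e2]

/-- The evaluation `d_V : V* ⊗ V → H_t`, `φ ⊗ v ↦ φ(1₍₁₎·v) 1₍₂₎`. -/
noncomputable def evHom : tensor (dual V) V ⟶ unitObj k H where
  lin :=
    { toFun := fun x => evFun V (inc _ _ x)
      map_add' := fun x y => by rw [map_add, map_add]
      map_smul' := fun h x => by rw [inc_smul, evFun_Δ]; rfl }

lemma klin_evHom : klin (evHom V) = evFun V ∘ₗ inc _ _ := rfl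

lemma klin_coevHom : inc _ _ ∘ₗ klin (coevHom V) = coevFun V :=
  LinearMap.ext fun z => inc_coevHom V z

lemma zigzag₁ (x : (tensor (unitObj k H) V).carrier) :
    (rightUnitor V).hom.lin ((tensorMap (𝟙 V) (evHom V)).lin ((associator V (dual V) V).hom.lin
      ((tensorMap (coevHom V) (𝟙 V)).lin x))) = (leftUnitor V).hom.lin x := by
  rw [rightUnitor_lin, inc_tensorMap, klin_evHom, klin_id]
  have h1 (y : (tensor V (tensor (dual V) V)).carrier) :
      TensorProduct.map LinearMap.id (evFun V ∘ₗ inc _ _) (inc V (tensor (dual V) V) y) =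
        (evFun V).lTensor _ (incR V (dual V) V y) := by
    rw [incR, LinearMap.comp_apply, LinearMap.lTensor_def, LinearMap.lTensor_def, map_map_apply]
    rfl
  have h2 : incL V (dual V) V ((tensorMap (coevHom V) (𝟙 V)).lin x) =
      (coevFun V).rTensor _ (inc _ _ x) := by
    rw [incL, LinearMap.comp_apply, inc_tensorMap, klin_id, LinearMap.rTensor_def,
      LinearMap.rTensor_def, map_map_apply, klin_coevHom]
    rfl
  rw [h1, incR_associator, h2]
  rw [leftUnitor_lin, epsL_inc, leftFun, LinearMap.comp_apply]
  generalize inc _ _ x = y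
  induction y using TensorProduct.induction_on with
  | zero => simp
  | add x y hx hy => simp only [map_add, hx, hy]
  | tmul z v =>
    simp only [LinearMap.rTensor_tmul, TensorProduct.lift.tmul, LinearMap.comp_apply,
      AlgHom.toLinearMap_apply]
    rw [← opEquiv_coevFun]
    generalize coevFun V z = t
    induction t using TensorProduct.induction_on with
    | zero => simp
    | add x y hx hy => simp only [map_add, TensorProduct.add_tmul, LinearMap.add_apply, hx, hy]
    | tmul w φ => simp [ε_evFun]

lemma zigzag₂ (φ : (dual V).carrier) :
    (leftUnitor (dual V)).hom.lin ((tensorMap (evHom V) (𝟙 (dual V))).lin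
      ((associator (dual V) V (dual V)).inv.lin ((tensorMap (𝟙 (dual V)) (coevHom V)).lin
        ((rightUnitor (dual V)).inv.lin φ)))) = φ := by
  rw [leftUnitor_lin, inc_tensorMap, klin_evHom, klin_id]
  have h1 (y : (tensor (tensor (dual V) V) (dual V)).carrier) :
      TensorProduct.map (evFun V ∘ₗ inc _ _) LinearMap.id (inc (tensor (dual V) V) (dual V) y) =
        (evFun V).rTensor _ (incL (dual V) V (dual V) y) := by
    rw [incL, LinearMap.comp_apply, LinearMap.rTensor_def, LinearMap.rTensor_def, map_map_apply]
    rfl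
  have h2 (x) : incR (dual V) V (dual V) ((tensorMap (𝟙 (dual V)) (coevHom V)).lin x) =
      (coevFun V).lTensor _ (inc _ _ x) := by
    rw [incR, LinearMap.comp_apply, inc_tensorMap, klin_id, LinearMap.lTensor_def,
      LinearMap.lTensor_def, map_map_apply, klin_coevHom]
    rfl
  have h3 (y : (tensor (dual V) (tensor V (dual V))).carrier) :
      incL (dual V) V (dual V) ((associator (dual V) V (dual V)).inv.lin y) =
      (TensorProduct.assoc k _ _ _).symm (incR (dual V) V (dual V) y) := by
    rw [LinearEquiv.eq_symm_apply, ← incR_associator, ← comp_lin, Iso.inv_hom_id, id_lin]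
  rw [h1, h3, h2, rightUnitor_inv_lin, inc_proj]
  -- contract
  let K : (dual V).carrier ⊗[k] (unitObj k H).carrier →ₗ[k] (dual V).carrier :=
    epsL (dual V) ∘ₗ (evFun V).rTensor _ ∘ₗ (TensorProduct.assoc k _ _ _).symm.toLinearMap ∘ₗ
      (coevFun V).lTensor _
  have hK (ψ : (dual V).carrier) (z : (unitObj k H).carrier) (v : V.carrier) :
      dualEquiv V (K (ψ ⊗ₜ z)) v = dualEquiv V ψ (uinc z • v) := by
    rw [show uinc z • v = act V (uinc z) v from rfl, ← opEquiv_coevFun]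
    simp only [K, LinearMap.comp_apply, LinearMap.lTensor_tmul]
    generalize coevFun V z = t
    induction t using TensorProduct.induction_on with
    | zero => simp
    | add x y hx hy => 
      simp only [map_add, TensorProduct.tmul_add, LinearMap.add_apply, hx, hy]
    | tmul w φ => simp [ε_evFun, mul_comm]
  change K _ = φ
  apply (dualEquiv V).injective
  ext v
  have h4 (s : H ⊗[k] H) : dualEquiv V (K (actT (dual V) (unitObj k H) s
      (φ ⊗ₜ uproj (k := k) (1 : H)))) v =
      dualEquiv V φ (LinearMap.mul' k H ((S k).rTensor H ((εt k).lTensor H s)) • v) := by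
    induction s using TensorProduct.induction_on with
    | zero => simp
    | add a b ha hb => simp only [map_add, LinearMap.add_apply, add_smul, ha, hb]
    | tmul a b =>
      rw [act₂_tmul, hK]
      simp [mul_smul, εt_one]
  rw [h4, lTensor_εt_one]
  change dualEquiv V φ (εs (k := k) (1 : H) • v) = _
  rw [εs_one, one_smul]

noncomputable instance : RightRigidCategory (QGRep k H) where
  rightDual V :=
    { rightDual := dual V
      exact :=
        { coevaluation' := coevHom V
          evaluation' := evHom V
          coevaluation_evaluation' := by
            rw [← Category.assoc, Iso.eq_comp_inv, ← Iso.inv_comp_eq_id]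
            exact hom_ext fun φ => zigzag₂ V φ
          evaluation_coevaluation' := by
            rw [← Category.assoc, Iso.eq_comp_inv]
            exact hom_ext fun x => zigzag₁ V x } }

end Duality

section Ribbon

variable {k H : Type u} [Field k] [Ring H] [Algebra k H] [RibbonQuantumGroupoid k H]

variable (k H) in
/-- the ribbon element -/
noncomputable abbrev rib : H := RibbonQuantumGroupoid.ν k

/-- multiplication by the ribbon element -/
noncomputable def twistHom (V : QGRep k H) : V ⟶ V where
  lin :=
    { toFun := fun v => rib k H • v
      map_add' := fun x y => smul_add _ _ _
      map_smul' := fun h x => by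
        rw [RingHom.id_apply, ← mul_smul, ← mul_smul, RibbonQuantumGroupoid.ν_central] }

lemma twistHom_bijective (V : QGRep k H) : Function.Bijective (twistHom V).lin := by
  obtain ⟨w, hw⟩ := RibbonQuantumGroupoid.isUnit_ν (k := k) (H := H)
  change Function.Bijective fun v : V.carrier => rib k H • v
  rw [show rib k H = (w : H) from hw.symm]
  exact MulAction.bijective w

/-- The twist of `Rep(H)`. -/
noncomputable def twistIso (V : QGRep k H) : V ≅ V :=
  isoMk (LinearEquiv.ofBijective (twistHom V).lin (twistHom_bijective V))

lemma twistIso_lin (V : QGRep k H) (v : V.carrier) : (twistIso V).hom.lin v = rib k H • v := rfl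

noncomputable instance : RibbonCategory (QGRep k H) where
  twist := twistIso
  twist_naturality f := hom_ext fun x => by
    rw [comp_lin, comp_lin, twistIso_lin, twistIso_lin, map_smul]
  twist_tensor V W := hom_ext fun x => inc_injective _ _ (by
    change inc V W (rib k H • x) = inc V W ((braid W V).hom.lin ((braid V W).hom.lin
      ((tensorMap (twistIso V).hom (twistIso W).hom).lin x)))
    rw [inc_braid, inc_braid, inc_tensorMap, inc_smul, brFun_apply, brFun_apply]
    have h0 (y : V.carrier ⊗[k] W.carrier) : actT V W (R21 k H) (TensorProduct.comm k _ _
        (actT W V (R21 k H) (TensorProduct.comm k _ _ y))) =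
        actT V W (R21 k H) (actT V W (Rm k H) y) := by
      conv_lhs => rw [R21, actT_comm (V := V) (W := W) (Rm k H) y, TensorProduct.comm_comm]
      rfl
    rw [h0]
    have h1 : TensorProduct.map (klin (twistIso V).hom) (klin (twistIso W).hom) (inc V W x) =
        actT V W (rib k H ⊗ₜ[k] rib k H) (inc V W x) := by
      rw [act₂_tmul']; rfl
    rw [h1, ← Module.End.mul_apply, ← Module.End.mul_apply, ← map_mul, ← map_mul]
    rw [show Δ k (rib k H) = _ from RibbonQuantumGroupoid.Δ_ν, R21])
  twist_dual V := hom_ext fun z => inc_injective _ _ ((opEquiv V).injective (by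
    change opEquiv V (inc _ _ ((tensorMap (twistIso V).hom (𝟙 (dual V))).lin
      ((coevHom V).lin z))) =
      opEquiv V (inc _ _ ((tensorMap (𝟙 V) (twistIso (dual V)).hom).lin ((coevHom V).lin z)))
    rw [inc_tensorMap, inc_tensorMap, inc_coevHom, klin_id, klin_id]
    have h1 (y : V.carrier ⊗[k] (dual V).carrier) :
        TensorProduct.map (klin (twistIso V).hom) LinearMap.id y =
        actT V (dual V) (rib k H ⊗ₜ[k] 1) y := by
      rw [act₂_tmul', map_one]; rfl
    have h2 (y : V.carrier ⊗[k] (dual V).carrier) :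
        TensorProduct.map LinearMap.id (klin (twistIso (dual V)).hom) y =
        actT V (dual V) (1 ⊗ₜ[k] rib k H) y := by
      rw [act₂_tmul', map_one]; rfl
    rw [h1, h2, opEquiv_act, opEquiv_act, opEquiv_coevFun]
    have hS : S k (rib k H) = rib k H := RibbonQuantumGroupoid.S_ν
    have hS1 : S k (1 : H) = 1 := antipode_one
    simp only [sw, LinearMap.comp_apply, TensorProduct.map_tmul, LinearMap.mul'_apply,
      AlgHom.toLinearMap_apply, LinearMap.mulRight_apply, hS, hS1, map_one, mul_one, one_mul]
    rw [← map_mul, ← map_mul, show rib k H * uinc z = uinc z * rib k H from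
      RibbonQuantumGroupoid.ν_central _]))

end Ribbon
end QGRep

section Trace

variable {C : Type*} [Category C] [MonoidalCategory C] [BraidedCategory C]
  [RightRigidCategory C] [RibbonCategory C]

/-- The quantum trace `d_X ∘ c_{X,X*} ∘ ((θ_X ∘ f) ⊗ id) ∘ b_X` of an endomorphism. -/
noncomputable def qtr {X : C} (f : X ⟶ X) : 𝟙_ C ⟶ 𝟙_ C :=
  η_ X Xᘁ ≫ (f ≫ (RibbonCategory.twist X).hom) ▷ Xᘁ ≫ (β_ X Xᘁ).hom ≫ ε_ X Xᘁ

variable [Preadditive C]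

/-- A morphism `f : X ⟶ Y` is negligible if `tr(f ∘ g) = 0` for all `g : Y ⟶ X`. -/
def IsNegligible {X Y : C} (f : X ⟶ Y) : Prop := ∀ g : Y ⟶ X, qtr (g ≫ f) = 0

/-- An object is negligible if all its endomorphisms have trace zero. -/
def IsNegligibleObj (X : C) : Prop := ∀ f : X ⟶ X, qtr f = 0

/-- `∑ r, f_r ∘ g_r` differs from the identity of `X` by a negligible morphism, for some morphisms
`f_r : V_{s(r)} ⟶ X` and `g_r : X ⟶ V_{s(r)}`. -/
def Quasidominates {I : Type*} (V : I → C) (X : C) : Prop :=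
  ∃ (n : ℕ) (s : Fin n → I) (f : ∀ r, V (s r) ⟶ X) (g : ∀ r, X ⟶ V (s r)),
    IsNegligible (𝟙 X - ∑ r, g r ≫ f r)

/-- The identity of `X` equals `∑ r, f_r ∘ g_r` for some morphisms
`f_r : V_{s(r)} ⟶ X` and `g_r : X ⟶ V_{s(r)}`. -/
def Dominates {I : Type*} (V : I → C) (X : C) : Prop :=
  ∃ (n : ℕ) (s : Fin n → I) (f : ∀ r, V (s r) ⟶ X) (g : ∀ r, X ⟶ V (s r)),
    𝟙 X = ∑ r, g r ≫ f r

variable (k : Type*) [Field k] [Linear k C]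

/-- Every endomorphism of `X` is multiplication by a unique element of `k`. -/
def IsSimpleObj (X : C) : Prop := Function.Bijective fun c : k => c • 𝟙 X

variable {I : Type*} [Fintype I] [DecidableEq I]

/-- A finite family of simple objects of a ribbon category which contains the unit object, is
closed under duality up to isomorphism, and for which the square matrix
`S_{ij} = tr(c_{V_i,V_j} ∘ c_{V_j,V_i})`, with `End(𝟙) = k`, is invertible over `k`. -/
structure IsModularFamily (V : I → C) : Prop where
  simple : ∀ i, IsSimpleObj k (V i)
  unit : ∃ i, V i = 𝟙_ C
  dual : ∀ i, ∃ j, Nonempty (V j ≅ (V i)ᘁ)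
  smatrix : ∃ S : Matrix I I k, (∀ i j, S i j • 𝟙 (𝟙_ C) =
    qtr ((β_ (V j) (V i)).hom ≫ (β_ (V i) (V j)).hom)) ∧ IsUnit S

variable [MonoidalPreadditive C] [MonoidalLinear k C]

/-- `(C, V)` is a quasimodular category. -/
structure IsQuasimodular (V : I → C) : Prop extends IsModularFamily k V where
  quasidominates : ∀ X : C, Quasidominates V X

/-- `(C, V)` is a modular category. -/
structure IsModular (V : I → C) : Prop extends IsModularFamily k V where
  dominates : ∀ X : C, Dominates V X

end Trace

section Purification

open RibbonCategory

section Ideal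

lemma exists_coev {C : Type*} [Category C] [MonoidalCategory C] [RightRigidCategory C] {Y D : C}
     (u : 𝟙_ C ⟶ Y ⊗ Dᘁ) : ∃ t : D ⟶ Y, u = η_ D Dᘁ ≫ t ▷ Dᘁ := by
  refine ⟨(λ_ _).inv ≫ (tensorRightHomEquiv (𝟙_ C) D Dᘁ Y).symm u, ?_⟩
  conv_lhs => rw [← (tensorRightHomEquiv (𝟙_ C) D Dᘁ Y).apply_symm_apply u]
  generalize (tensorRightHomEquiv (𝟙_ C) D Dᘁ Y).symm u = v
  simp [tensorRightHomEquiv, unitors_equal]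

variable {C : Type*} [Category C] [MonoidalCategory C] [BraidedCategory C]
  [RightRigidCategory C] [RibbonCategory C]

/-- the pairing `Z ⊗ Z* ⟶ 𝟙` occurring in the quantum trace -/
noncomputable def tev (Z : C) : Z ⊗ Zᘁ ⟶ 𝟙_ C :=
  (twist Z).hom ▷ Zᘁ ≫ (β_ Z Zᘁ).hom ≫ ε_ Z Zᘁ

lemma qtr_eq {Z : C} (f : Z ⟶ Z) : qtr f = η_ Z Zᘁ ≫ f ▷ Zᘁ ≫ tev Z := by
  simp [qtr, tev]

lemma exists_tev {Z D : C} (φ : Z ⊗ D ⟶ 𝟙_ C) : ∃ t : D ⟶ Zᘁ, φ = Z ◁ t ≫ tev Z := by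
  let ψ : D ⊗ Z ⟶ 𝟙_ C := (β_ Z D).inv ≫ (twist Z).inv ▷ D ≫ φ
  refine ⟨tensorRightHomEquiv D Z Zᘁ (𝟙_ C) ψ ≫ (λ_ _).hom, ?_⟩
  have h1 : (tensorRightHomEquiv D Z Zᘁ (𝟙_ C) ψ ≫ (λ_ _).hom) ▷ Z ≫ ε_ Z Zᘁ = ψ := by
    conv_rhs => rw [← (tensorRightHomEquiv D Z Zᘁ (𝟙_ C)).symm_apply_apply ψ]
    generalize tensorRightHomEquiv D Z Zᘁ (𝟙_ C) ψ = u
    simp [tensorRightHomEquiv, ← unitors_equal]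
  rw [tev, whisker_exchange_assoc, BraidedCategory.braiding_naturality_right_assoc, h1]
  simp [ψ]

variable [Preadditive C]

lemma isNegligible_iff {Y Z : C} (f : Y ⟶ Z) : IsNegligible f ↔
    ∀ (D : C) (u : 𝟙_ C ⟶ Y ⊗ D) (φ : Z ⊗ D ⟶ 𝟙_ C), u ≫ f ▷ D ≫ φ = 0 := by
  constructor
  · intro h D u φ
    obtain ⟨t, rfl⟩ := exists_tev φ
    obtain ⟨g, hg⟩ := exists_coev (u ≫ Y ◁ t)
    rw [← whisker_exchange_assoc, ← Category.assoc, hg, ← h g, qtr_eq, comp_whiskerRight,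
      Category.assoc, Category.assoc]
  · intro h g
    rw [qtr_eq, comp_whiskerRight, Category.assoc]
    simpa using h _ (η_ Z Zᘁ ≫ g ▷ Zᘁ) (tev Z)

lemma IsNegligible.comp {X Y Z : C} {f : X ⟶ Y} (h : IsNegligible f) (g : Y ⟶ Z) :
    IsNegligible (f ≫ g) := by
  rw [isNegligible_iff] at h ⊢
  intro D u φ
  rw [comp_whiskerRight, Category.assoc, h]

lemma IsNegligible.precomp {X Y Z : C} {f : Y ⟶ Z} (h : IsNegligible f) (g : X ⟶ Y) :
    IsNegligible (g ≫ f) := by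
  rw [isNegligible_iff] at h ⊢
  intro D u φ
  rw [comp_whiskerRight, Category.assoc, ← Category.assoc, h]

lemma IsNegligible.whiskerRight {Y Z : C} {f : Y ⟶ Z} (h : IsNegligible f) (W : C) :
    IsNegligible (f ▷ W) := by
  rw [isNegligible_iff] at h ⊢
  intro D u φ
  have := h (W ⊗ D) (u ≫ (α_ _ _ _).hom) ((α_ _ _ _).inv ≫ φ)
  simpa using this

lemma IsNegligible.whiskerLeft {Y Z : C} {f : Y ⟶ Z} (h : IsNegligible f) (W : C) :
    IsNegligible (W ◁ f) := by
  have : W ◁ f = (β_ W Y).hom ≫ f ▷ W ≫ (β_ W Z).inv := by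
    rw [← BraidedCategory.braiding_naturality_right_assoc, Iso.hom_inv_id, Category.comp_id]
  rw [this]
  exact ((h.whiskerRight W).comp _).precomp _

variable (k : Type*) [Field k] [Linear k C] [MonoidalPreadditive C] [MonoidalLinear k C]

/-- The space of negligible morphisms. -/
def negl (X Y : C) : Submodule k (X ⟶ Y) where
  carrier := {f | IsNegligible f}
  zero_mem' g := by simp [qtr_eq, MonoidalPreadditive.zero_whiskerRight]
  add_mem' {a b} ha hb := by
    change IsNegligible a at ha
    change IsNegligible b at hb
    change IsNegligible _
    rw [isNegligible_iff] at *
    intro D u φ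
    rw [MonoidalPreadditive.add_whiskerRight, Preadditive.add_comp, Preadditive.comp_add, ha, hb,
      add_zero]
  smul_mem' c a ha := by
    change IsNegligible a at ha
    change IsNegligible _
    rw [isNegligible_iff] at *
    intro D u φ
    rw [MonoidalLinear.smul_whiskerRight, Linear.smul_comp, Linear.comp_smul, ha, smul_zero]

lemma mem_negl {X Y : C} {f : X ⟶ Y} : f ∈ negl k X Y ↔ IsNegligible f := Iff.rfl

end Ideal

/-- The purification of a ribbon category: the same objects, and morphisms modulo negligible
morphisms. -/
structure Purification (k C : Type*) where
  obj : C

namespace Purification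

variable {k : Type*} [Field k] {C : Type*} [Category C] [MonoidalCategory C] [BraidedCategory C]
  [RightRigidCategory C] [RibbonCategory C] [Preadditive C] [Linear k C] [MonoidalPreadditive C]
  [MonoidalLinear k C]

noncomputable instance : Category (Purification k C) where
  Hom X Y := (X.obj ⟶ Y.obj) ⧸ negl k X.obj Y.obj
  id X := Submodule.Quotient.mk (𝟙 X.obj)
  comp {X Y Z} f g := Quotient.map₂ (fun a b => a ≫ b) (fun a a' ha b b' hb => by
    rw [← Quotient.eq_iff_equiv] at *
    have ha' := (Submodule.Quotient.eq (negl k X.obj Y.obj)).1 ha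
    have hb' := (Submodule.Quotient.eq (negl k Y.obj Z.obj)).1 hb
    refine (Submodule.Quotient.eq (negl k X.obj Z.obj)).2 ?_
    have e : a ≫ b - a' ≫ b' = (a - a') ≫ b + a' ≫ (b - b') := by simp
    rw [e]
    exact add_mem (IsNegligible.comp ha' b) (IsNegligible.precomp hb' a')) f g
  id_comp := by rintro X Y ⟨f⟩; exact congrArg Submodule.Quotient.mk (Category.id_comp f)
  comp_id := by rintro X Y ⟨f⟩; exact congrArg Submodule.Quotient.mk (Category.comp_id f)
  assoc := by
    rintro W X Y Z ⟨f⟩ ⟨g⟩ ⟨h⟩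
    exact congrArg Submodule.Quotient.mk (Category.assoc f g h)

noncomputable instance (X Y : Purification k C) : AddCommGroup (X ⟶ Y) :=
  inferInstanceAs (AddCommGroup ((X.obj ⟶ Y.obj) ⧸ negl k X.obj Y.obj))
noncomputable instance (X Y : Purification k C) : Module k (X ⟶ Y) :=
  inferInstanceAs (Module k ((X.obj ⟶ Y.obj) ⧸ negl k X.obj Y.obj))

variable (k) in
/-- the class of a morphism -/
def cls {X Y : C} (f : X ⟶ Y) : (⟨X⟩ : Purification k C) ⟶ ⟨Y⟩ := Submodule.Quotient.mk f

lemma cls_surj {X Y : Purification k C} (f : X ⟶ Y) : ∃ g : X.obj ⟶ Y.obj, f = cls k g := by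
  obtain ⟨g⟩ := f
  exact ⟨g, rfl⟩

lemma cls_eq_iff {X Y : C} {f g : X ⟶ Y} : cls k f = cls k g ↔ IsNegligible (f - g) :=
  Submodule.Quotient.eq _

lemma cls_id (X : C) : cls k (𝟙 X) = 𝟙 _ := rfl
lemma cls_comp {X Y Z : C} (f : X ⟶ Y) (g : Y ⟶ Z) : cls k (f ≫ g) = cls k f ≫ cls k g := rfl
lemma cls_add {X Y : C} (f g : X ⟶ Y) : cls k (f + g) = cls k f + cls k g := rfl
lemma cls_zero {X Y : C} : cls k (0 : X ⟶ Y) = 0 := rfl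
lemma cls_smul {X Y : C} (c : k) (f : X ⟶ Y) : cls k (c • f) = c • cls k f := rfl

noncomputable instance : Preadditive (Purification k C) where
  add_comp := by
    rintro X Y Z ⟨f⟩ ⟨g⟩ ⟨h⟩
    exact congrArg (cls k) (Preadditive.add_comp _ _ _ f g h)
  comp_add := by
    rintro X Y Z ⟨f⟩ ⟨g⟩ ⟨h⟩
    exact congrArg (cls k) (Preadditive.comp_add _ _ _ f g h)

noncomputable instance : Linear k (Purification k C) where
  smul_comp := by
    rintro X Y Z c ⟨f⟩ ⟨g⟩
    exact congrArg (cls k) (Linear.smul_comp _ _ _ c f g)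
  comp_smul := by
    rintro X Y Z ⟨f⟩ c ⟨g⟩
    exact congrArg (cls k) (Linear.comp_smul _ _ _ f c g)

variable (k) in
/-- the class of an isomorphism -/
def clsIso {X Y : C} (e : X ≅ Y) : (⟨X⟩ : Purification k C) ≅ ⟨Y⟩ where
  hom := cls k e.hom
  inv := cls k e.inv
  hom_inv_id := congrArg (cls k) e.hom_inv_id
  inv_hom_id := congrArg (cls k) e.inv_hom_id

/-- `Z ◁ f` on classes -/
noncomputable def whiskerL (Z : Purification k C) {X Y : Purification k C} (f : X ⟶ Y) :
    (⟨Z.obj ⊗ X.obj⟩ : Purification k C) ⟶ ⟨Z.obj ⊗ Y.obj⟩ :=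
  Quotient.map (fun a => Z.obj ◁ a) (fun a b h => by
    rw [← Quotient.eq_iff_equiv] at *
    have h' := (Submodule.Quotient.eq (negl k X.obj Y.obj)).1 h
    refine (Submodule.Quotient.eq (negl k (Z.obj ⊗ X.obj) (Z.obj ⊗ Y.obj))).2 ?_
    have e : Z.obj ◁ a - Z.obj ◁ b = Z.obj ◁ (a - b) := by
      rw [sub_eq_add_neg, sub_eq_add_neg, MonoidalPreadditive.whiskerLeft_add]
      congr 1
      exact (((tensoringLeft C).obj Z.obj).map_neg).symm
    rw [e]
    exact IsNegligible.whiskerLeft h' _) f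

/-- `f ▷ Z` on classes -/
noncomputable def whiskerR {X Y : Purification k C} (f : X ⟶ Y) (Z : Purification k C) :
    (⟨X.obj ⊗ Z.obj⟩ : Purification k C) ⟶ ⟨Y.obj ⊗ Z.obj⟩ :=
  Quotient.map (fun a => a ▷ Z.obj) (fun a b h => by
    rw [← Quotient.eq_iff_equiv] at *
    have h' := (Submodule.Quotient.eq (negl k X.obj Y.obj)).1 h
    refine (Submodule.Quotient.eq (negl k (X.obj ⊗ Z.obj) (Y.obj ⊗ Z.obj))).2 ?_
    have e : a ▷ Z.obj - b ▷ Z.obj = (a - b) ▷ Z.obj := by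
      rw [sub_eq_add_neg, sub_eq_add_neg, MonoidalPreadditive.add_whiskerRight]
      congr 1
      exact (((tensoringRight C).obj Z.obj).map_neg).symm
    rw [e]
    exact IsNegligible.whiskerRight h' _) f

noncomputable instance : MonoidalCategoryStruct (Purification k C) where
  tensorObj X Y := ⟨X.obj ⊗ Y.obj⟩
  whiskerLeft Z _ _ f := whiskerL Z f
  whiskerRight f Z := whiskerR f Z
  tensorHom {_ Y X _} f g := whiskerR f X ≫ whiskerL Y g
  tensorUnit := ⟨𝟙_ C⟩
  associator X Y Z := clsIso k (α_ X.obj Y.obj Z.obj)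
  leftUnitor X := clsIso k (λ_ X.obj)
  rightUnitor X := clsIso k (ρ_ X.obj)

lemma cls_whiskerLeft (Z : C) {X Y : C} (f : X ⟶ Y) :
    cls k (Z ◁ f) = (⟨Z⟩ : Purification k C) ◁ cls k f := rfl
lemma cls_whiskerRight {X Y : C} (f : X ⟶ Y) (Z : C) :
    cls k (f ▷ Z) = cls k f ▷ (⟨Z⟩ : Purification k C) := rfl
lemma cls_tensorHom {X Y X' Y' : C} (f : X ⟶ Y) (g : X' ⟶ Y') :
    cls k (f ⊗ₘ g) = cls k f ⊗ₘ cls k g := by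
  rw [MonoidalCategory.tensorHom_def]; rfl

noncomputable instance : MonoidalCategory (Purification k C) where
  tensorHom_def _ _ := rfl
  id_tensorHom_id X Y := by
    change cls k (𝟙 X.obj) ⊗ₘ cls k (𝟙 Y.obj) = cls k (𝟙 (X.obj ⊗ Y.obj))
    rw [← cls_tensorHom, MonoidalCategory.id_tensorHom_id]
  tensorHom_comp_tensorHom := by
    intro X₁ Y₁ Z₁ X₂ Y₂ Z₂ f₁ f₂ g₁ g₂
    obtain ⟨f₁, rfl⟩ := cls_surj f₁
    obtain ⟨f₂, rfl⟩ := cls_surj f₂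
    obtain ⟨g₁, rfl⟩ := cls_surj g₁
    obtain ⟨g₂, rfl⟩ := cls_surj g₂
    rw [← cls_comp, ← cls_comp, ← cls_tensorHom, ← cls_tensorHom, ← cls_tensorHom,
      ← MonoidalCategory.tensorHom_comp_tensorHom]
    rfl
  whiskerLeft_id X Y := congrArg (cls k) (MonoidalCategory.whiskerLeft_id X.obj Y.obj)
  id_whiskerRight X Y := congrArg (cls k) (MonoidalCategory.id_whiskerRight X.obj Y.obj)
  associator_naturality := by
    intro X₁ X₂ X₃ Y₁ Y₂ Y₃ f₁ f₂ f₃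
    obtain ⟨f₁, rfl⟩ := cls_surj f₁
    obtain ⟨f₂, rfl⟩ := cls_surj f₂
    obtain ⟨f₃, rfl⟩ := cls_surj f₃
    have e := congrArg (cls k) (MonoidalCategory.associator_naturality f₁ f₂ f₃)
    rw [cls_comp, cls_comp, cls_tensorHom, cls_tensorHom, cls_tensorHom, cls_tensorHom] at e
    exact e
  leftUnitor_naturality := by
    rintro X Y ⟨f⟩
    exact congrArg (cls k) (MonoidalCategory.leftUnitor_naturality f)
  rightUnitor_naturality := by
    rintro X Y ⟨f⟩
    exact congrArg (cls k) (MonoidalCategory.rightUnitor_naturality f)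
  pentagon W X Y Z := congrArg (cls k) (MonoidalCategory.pentagon W.obj X.obj Y.obj Z.obj)
  triangle X Y := congrArg (cls k) (MonoidalCategory.triangle X.obj Y.obj)

instance : MonoidalPreadditive (Purification k C) where
  whiskerLeft_zero := congrArg (cls k) MonoidalPreadditive.whiskerLeft_zero
  zero_whiskerRight := congrArg (cls k) MonoidalPreadditive.zero_whiskerRight
  whiskerLeft_add := by
    rintro X Y Z ⟨f⟩ ⟨g⟩
    exact congrArg (cls k) (MonoidalPreadditive.whiskerLeft_add f g)
  add_whiskerRight := by
    rintro X Y Z ⟨f⟩ ⟨g⟩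
    exact congrArg (cls k) (MonoidalPreadditive.add_whiskerRight f g)

instance : MonoidalLinear k (Purification k C) where
  whiskerLeft_smul := by
    rintro X Y Z c ⟨f⟩
    exact congrArg (cls k) (MonoidalLinear.whiskerLeft_smul X.obj c f)
  smul_whiskerRight := by
    rintro c Y Z ⟨f⟩ X
    exact congrArg (cls k) (MonoidalLinear.smul_whiskerRight c f X.obj)

noncomputable instance : BraidedCategory (Purification k C) where
  braiding X Y := clsIso k (β_ X.obj Y.obj)
  braiding_naturality_right := by
    rintro X Y Z ⟨f⟩
    exact congrArg (cls k) (BraidedCategory.braiding_naturality_right X.obj f)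
  braiding_naturality_left := by
    rintro X Y ⟨f⟩ Z
    exact congrArg (cls k) (BraidedCategory.braiding_naturality_left f Z.obj)
  hexagon_forward X Y Z :=
    congrArg (cls k) (BraidedCategory.hexagon_forward X.obj Y.obj Z.obj)
  hexagon_reverse X Y Z :=
    congrArg (cls k) (BraidedCategory.hexagon_reverse X.obj Y.obj Z.obj)

noncomputable instance : RightRigidCategory (Purification k C) where
  rightDual X :=
    { rightDual := ⟨X.objᘁ⟩
      exact :=
        { coevaluation' := cls k (η_ X.obj X.objᘁ)
          evaluation' := cls k (ε_ X.obj X.objᘁ)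
          coevaluation_evaluation' :=
            congrArg (cls k) (ExactPairing.coevaluation_evaluation X.obj X.objᘁ)
          evaluation_coevaluation' :=
            congrArg (cls k) (ExactPairing.evaluation_coevaluation X.obj X.objᘁ) } }

noncomputable instance : RibbonCategory (Purification k C) where
  twist X := clsIso k (twist X.obj)
  twist_naturality := by
    rintro X Y ⟨f⟩
    exact congrArg (cls k) (twist_naturality f)
  twist_tensor X Y := by
    refine (congrArg (cls k) (twist_tensor X.obj Y.obj)).trans ?_
    rw [cls_comp, cls_tensorHom]; rfl
  twist_dual X := congrArg (cls k) (twist_dual X.obj)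

end Purification
end Purification

section FullSubcategory

open RibbonCategory

variable {C : Type*} [Category C] [MonoidalCategory C] [RightRigidCategory C]

/-- A class of objects closed under duals. -/
class ClosedUnderDual (P : ObjectProperty C) : Prop where
  prop_dual (X : C) : P X → P Xᘁ

variable (P : ObjectProperty C) [P.IsMonoidal] [ClosedUnderDual P]

/-- A full monoidal subcategory closed under duals inherits the duality. -/
noncomputable instance : RightRigidCategory P.FullSubcategory where
  rightDual X :=
    { rightDual := ⟨X.objᘁ, ClosedUnderDual.prop_dual _ X.property⟩
      exact :=
        { coevaluation' := ObjectProperty.homMk (η_ X.obj X.objᘁ)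
          evaluation' := ObjectProperty.homMk (ε_ X.obj X.objᘁ)
          coevaluation_evaluation' := ObjectProperty.hom_ext _
            (ExactPairing.coevaluation_evaluation X.obj X.objᘁ)
          evaluation_coevaluation' := ObjectProperty.hom_ext _
            (ExactPairing.evaluation_coevaluation X.obj X.objᘁ) } }

variable [BraidedCategory C] [RibbonCategory C]

/-- A full monoidal subcategory closed under duals inherits the twist. -/
noncomputable instance : RibbonCategory P.FullSubcategory where
  twist X := P.isoMk (twist X.obj)
  twist_naturality f := ObjectProperty.hom_ext _ (twist_naturality f.hom)
  twist_tensor X Y := ObjectProperty.hom_ext _ (twist_tensor X.obj Y.obj)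
  twist_dual X := ObjectProperty.hom_ext _ (twist_dual X.obj)

end FullSubcategory

section Modular

variable (k : Type u) {H : Type u} [Field k] [Ring H] [Algebra k H] [RibbonQuantumGroupoid k H]
  {I : Type*} [Fintype I] [DecidableEq I]

/-- `(H, R, ν, V)` is a modular quantum groupoid. -/
structure IsModularQuantumGroupoid (V : I → QGRep k H) : Prop extends IsModularFamily k V where
  /-- `V_a ⊗ V_b` is a finite direct sum of members of the family and a negligible module. -/
  tensor : ∀ a b, ∃ (n : ℕ) (s : Fin n → I) (N : QGRep k H), IsNegligibleObj N ∧
    Nonempty ((V a ⊗ V b).carrier ≃ₗ[H] ((r : Fin n) → (V (s r)).carrier) × N.carrier)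

variable {k}

/-- The modules quasidominated by the family `V`. -/
def quasidominated {I : Type*} (V : I → QGRep k H) : ObjectProperty (QGRep k H) :=
  fun X => Quasidominates V X

lemma quasidominated_self {I : Type*} (V : I → QGRep k H) (i : I) : quasidominated V (V i) :=
  ⟨1, fun _ => i, fun _ => 𝟙 _, fun _ => 𝟙 _, fun g => by
    simp [qtr_eq, MonoidalPreadditive.zero_whiskerRight]⟩

/-- The family `V` inside the full subcategory of the modules which it quasidominates. -/
def quasidominatedFamily {I : Type*} (V : I → QGRep k H) (i : I) :
    (quasidominated V).FullSubcategory := ⟨V i, quasidominated_self V i⟩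

end Modular

/-! The whole statement rests on one reformulation. In a ribbon category the negligible morphisms
form an ideal stable under composition and tensoring. Adding to them all morphisms that factor
through some `V i` generates a larger two-sided ideal, `quasiIdeal`, and an object `X` is
quasidominated exactly when `𝟙 X` lies in it (`quasidominates_iff`). Closure of the quasidominated
objects under an operation thus becomes stability of the ideal under that operation, which can be
tested on generators.

From modular quantum groupoid to quasimodular category. A decomposition of `V a ⊗ V b` into members
of the family and a negligible module writes its identity as a sum of morphisms through the `V i`
plus a negligible morphism, so `V a ⊗ V b` is quasidominated (`quasidominates_of_decomposition`).
Bifunctoriality of `⊗` then spreads this from generators to all quasidominated objects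
(`Quasidominates.tensor`), and condition 2 does the same for duals (`Quasidominates.dual`).
Simplicity, duality and the matrix `S` are the same in a full subcategory as in the ambient
category.

From quasimodular category to modular quantum groupoid. Since `V a ⊗ V b` belongs to the
subcategory, it is quasidominated, and it remains to decompose a quasidominated module `X`
(`exists_decomposition`). If `X` is not negligible, cyclicity of the trace (`qtr_comp_comm`) yields
morphisms `V i ⟶ X ⟶ V i` whose composite has nonzero trace (`Quasidominates.exists_qtr_ne_zero`).
By simplicity this composite is a nonzero scalar, so `V i` splits off `X`. The complement is a
retract of `X`, hence again quasidominated, and has smaller dimension; the induction ends at a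
negligible remainder. No semisimplicity of `H` enters.

Purification. Modulo negligible morphisms quasidomination becomes domination, and the rest descends
to classes. The one point to check is that a simple object stays simple, that is, that `𝟙 (V i)`
does not become zero: otherwise row `i` of `S` would vanish, against its invertibility
(`IsModularFamily.not_isNegligible_id`). -/

/-! ### Cyclicity of the quantum trace. -/

section TraceIdeal

open RibbonCategory

variable {C : Type*} [Category C] [MonoidalCategory C] [BraidedCategory C]
  [RightRigidCategory C] [RibbonCategory C]

/-- The pairing `tev` is dinatural because ordinary evaluation is: the mate slides through the
braiding, evaluation exchanges it for `g`, and `g` slides back through the braiding and past the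
twist by naturality. -/
lemma whiskerLeft_rightAdjointMate_tev {X Y : C} (g : Y ⟶ X) :
    Y ◁ gᘁ ≫ tev Y = g ▷ Xᘁ ≫ tev X := by
  rw [tev, tev, whisker_exchange_assoc, BraidedCategory.braiding_naturality_right_assoc,
    rightAdjointMate_comp_evaluation, ← BraidedCategory.braiding_naturality_left_assoc,
    ← comp_whiskerRight_assoc, ← comp_whiskerRight_assoc, twist_naturality]

/-- The quantum trace is cyclic. -/
lemma qtr_comp_comm {X Y : C} (f : X ⟶ Y) (g : Y ⟶ X) : qtr (g ≫ f) = qtr (f ≫ g) := by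
  -- `g` travels once around the loop: the coevaluation turns it into its mate on the dual strand,
  -- the mate commutes past `f`, and the pairing turns it back into `g`, now after `f`.
  rw [qtr_eq, qtr_eq, comp_whiskerRight_assoc, ← coevaluation_comp_rightAdjointMate_assoc,
    whisker_exchange_assoc, whiskerLeft_rightAdjointMate_tev, comp_whiskerRight_assoc]

/-! ### The ideal generated by the family and the negligible morphisms. -/

variable [Preadditive C] {I : Type*} (V : I → C)

/-- This lets the ideal properties of negligible morphisms be applied to negligible objects. -/
lemma isNegligible_id_iff {X : C} : IsNegligible (𝟙 X) ↔ IsNegligibleObj X :=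
  forall_congr' fun f => by rw [Category.comp_id]

/-- The ideal of morphisms generated by the identities of the family `V` and the negligible
morphisms. -/
def quasiIdeal (X Y : C) : AddSubgroup (X ⟶ Y) :=
  AddSubgroup.closure {f | IsNegligible f ∨ ∃ (i : I) (a : X ⟶ V i) (b : V i ⟶ Y), f = a ≫ b}

variable {V}

lemma IsNegligible.mem_quasiIdeal {X Y : C} {f : X ⟶ Y} (h : IsNegligible f) :
    f ∈ quasiIdeal V X Y :=
  AddSubgroup.subset_closure (Or.inl h)

lemma comp_mem_quasiIdeal {X Y : C} (i : I) (a : X ⟶ V i) (b : V i ⟶ Y) :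
    a ≫ b ∈ quasiIdeal V X Y :=
  AddSubgroup.subset_closure (Or.inr ⟨i, a, b, rfl⟩)

/-- A generator composed with any morphism is again a generator of the same kind. The additive
closure therefore absorbs composition, here on the right and in the next lemma on the left, without
being enlarged. -/
lemma quasiIdeal_comp {X Y Z : C} {f : X ⟶ Y} (hf : f ∈ quasiIdeal V X Y) (g : Y ⟶ Z) :
    f ≫ g ∈ quasiIdeal V X Z := by
  induction hf using AddSubgroup.closure_induction with
  | mem f hf =>
    obtain hf | ⟨i, a, b, rfl⟩ := hf
    · exact (hf.comp g).mem_quasiIdeal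
    · rw [Category.assoc]; exact comp_mem_quasiIdeal i a _
  | zero => rw [Limits.zero_comp]; exact zero_mem _
  | add f f' _ _ hf hf' => rw [Preadditive.add_comp]; exact add_mem hf hf'
  | neg f _ hf => rw [Preadditive.neg_comp]; exact neg_mem hf

lemma quasiIdeal_precomp {X Y Z : C} {f : Y ⟶ Z} (hf : f ∈ quasiIdeal V Y Z) (g : X ⟶ Y) :
    g ≫ f ∈ quasiIdeal V X Z := by
  induction hf using AddSubgroup.closure_induction with
  | mem f hf =>
    obtain hf | ⟨i, a, b, rfl⟩ := hf
    · exact (hf.precomp g).mem_quasiIdeal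
    · rw [← Category.assoc]; exact comp_mem_quasiIdeal i _ b
  | zero => rw [Limits.comp_zero]; exact zero_mem _
  | add f f' _ _ hf hf' => rw [Preadditive.comp_add]; exact add_mem hf hf'
  | neg f _ hf => rw [Preadditive.comp_neg]; exact neg_mem hf

/-- The main use of the ideal property: once the identity of `Z` is in the ideal, `Z` serves as well
as a member of the family for factoring morphisms. It is applied with `Z` equal to `V i ⊗ V j`, to
`(V i)ᘁ`, and to an object having `X` as a retract. -/
lemma quasiIdeal_of_factors {X Y Z : C} (h : 𝟙 Z ∈ quasiIdeal V Z Z) (a : X ⟶ Z) (b : Z ⟶ Y) :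
    a ≫ b ∈ quasiIdeal V X Y := by
  have := quasiIdeal_precomp (quasiIdeal_comp h b) a
  rwa [Category.id_comp] at this

lemma Quasidominates.id_mem {X : C} (h : Quasidominates V X) : 𝟙 X ∈ quasiIdeal V X X := by
  obtain ⟨n, s, f, g, h⟩ := h
  have := add_mem h.mem_quasiIdeal
    (sum_mem fun r (_ : r ∈ Finset.univ) => comp_mem_quasiIdeal (s r) (g r) (f r))
  rwa [sub_add_cancel] at this

-- The mate involves the morphism only once, inside whiskerings and compositions, all of which are
-- additive.
omit [BraidedCategory C] [RibbonCategory C] in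
lemma rightAdjointMate_add [MonoidalPreadditive C] {X Y : C} (f g : X ⟶ Y) : (f + g)ᘁ = fᘁ + gᘁ := by
  simp [rightAdjointMate, MonoidalPreadditive.whiskerLeft_add, MonoidalPreadditive.add_whiskerRight]

lemma qtr_of_isNegligible {X : C} {f : X ⟶ X} (h : IsNegligible f) : qtr f = 0 := by
  simpa using h (𝟙 X)

/-! ### Quasidomination as membership of the identity, and its closure properties. -/

section Linear

variable (k : Type*) [Field k] [Linear k C] [MonoidalPreadditive C] [MonoidalLinear k C]

include k

/-- Elements of the ideal have a normal form, because finite sums through the family modulo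
negligible morphisms are already closed under addition and negation. An arbitrary finite index type
is used so that two sums are added over a disjoint union, with no index arithmetic. -/
lemma exists_sum_of_mem_quasiIdeal {X Y : C} {f : X ⟶ Y} (hf : f ∈ quasiIdeal V X Y) :
    ∃ (ι : Type) (_ : Fintype ι) (s : ι → I) (a : ∀ r, X ⟶ V (s r)) (b : ∀ r, V (s r) ⟶ Y),
      IsNegligible (f - ∑ r, a r ≫ b r) := by
  induction hf using AddSubgroup.closure_induction with
  | mem f hf =>
    obtain hf | ⟨i, a, b, rfl⟩ := hf
    -- A negligible morphism is its own error term, with an empty sum.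
    · exact ⟨Empty, inferInstance, Empty.elim, fun r => r.elim, fun r => r.elim, by simpa⟩
    · refine ⟨Unit, inferInstance, fun _ => i, fun _ => a, fun _ => b, ?_⟩
      rw [Fintype.sum_unique, sub_self]
      exact (negl k X Y).zero_mem
  | zero =>
    refine ⟨Empty, inferInstance, Empty.elim, fun r => r.elim, fun r => r.elim, ?_⟩
    rw [Fintype.sum_empty, sub_self]
    exact (negl k X Y).zero_mem
  | add f f' _ _ hf hf' =>
    obtain ⟨ι, _, s, a, b, h⟩ := hf
    obtain ⟨ι', _, s', a', b', h'⟩ := hf'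
    refine ⟨ι ⊕ ι', inferInstance, Sum.elim s s', fun r => Sum.rec a a' r,
      fun r => Sum.rec b b' r, ?_⟩
    have := (negl k X Y).add_mem h h'
    rw [mem_negl, sub_add_sub_comm] at this
    rw [Fintype.sum_sum_type]
    exact this
  | neg f _ hf =>
    obtain ⟨ι, _, s, a, b, h⟩ := hf
    -- The sign is absorbed into the first factor of each summand.
    refine ⟨ι, inferInstance, s, fun r => - a r, b, ?_⟩
    have := (negl k X Y).neg_mem h
    rw [mem_negl, neg_sub'] at this
    simpa [Preadditive.neg_comp] using this

/-- The pivot of the closure arguments: it replaces explicit families of morphisms by an ideal that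
can be handled on generators. -/
lemma quasidominates_iff {X : C} : Quasidominates V X ↔ 𝟙 X ∈ quasiIdeal V X X := by
  refine ⟨Quasidominates.id_mem, fun h => ?_⟩
  obtain ⟨ι, _, s, a, b, h⟩ := exists_sum_of_mem_quasiIdeal k h
  -- Quasidomination is phrased with `Fin n`, so the finite index type is numbered here.
  let e := (Fintype.equivFin ι).symm
  refine ⟨Fintype.card ι, fun r => s (e r), fun r => b (e r), fun r => a (e r), ?_⟩
  rwa [e.sum_comp (fun r => a r ≫ b r)]

/-- The tensor product is biadditive, so generators suffice. A negligible factor makes the product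
negligible; if both factors pass through the family, the product passes through some `V i ⊗ V j`,
which the hypothesis makes quasidominated. -/
lemma quasiIdeal_tensor (h : ∀ i j, Quasidominates V (V i ⊗ V j)) {X Y X' Y' : C}
    {f : X ⟶ Y} {g : X' ⟶ Y'} (hf : f ∈ quasiIdeal V X Y) (hg : g ∈ quasiIdeal V X' Y') :
    f ⊗ₘ g ∈ quasiIdeal V (X ⊗ X') (Y ⊗ Y') := by
  induction hf using AddSubgroup.closure_induction with
  | mem f hf =>
    obtain hf | ⟨i, a, b, rfl⟩ := hf
    -- When `f` is negligible nothing about `g` is needed; the second induction only starts once `f`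
    -- factors through some `V i`.
    · rw [MonoidalCategory.tensorHom_def]
      exact ((hf.whiskerRight _).comp _).mem_quasiIdeal
    · induction hg using AddSubgroup.closure_induction with
      | mem g hg =>
        obtain hg | ⟨j, c, d, rfl⟩ := hg
        · rw [MonoidalCategory.tensorHom_def]
          exact ((hg.whiskerLeft _).precomp _).mem_quasiIdeal
        · rw [← MonoidalCategory.tensorHom_comp_tensorHom]
          exact quasiIdeal_of_factors (h i j).id_mem _ _
      | zero =>
        rw [MonoidalPreadditive.tensor_zero]; exact zero_mem _
      | add g g' _ _ hg hg' => rw [MonoidalPreadditive.tensor_add]; exact add_mem hg hg'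
      | neg g _ hg =>
        -- Negation is moved out of the tensor product as multiplication by the scalar `-1`.
        rw [← neg_one_smul k g, MonoidalCategory.tensorHom_def, MonoidalLinear.whiskerLeft_smul,
          Linear.comp_smul, neg_one_smul, ← MonoidalCategory.tensorHom_def]
        exact neg_mem hg
  | zero => rw [MonoidalPreadditive.zero_tensor]; exact zero_mem _
  | add f f' _ _ hf hf' => rw [MonoidalPreadditive.add_tensor]; exact add_mem hf hf'
  | neg f _ hf =>
    rw [← neg_one_smul k f, MonoidalCategory.tensorHom_def, MonoidalLinear.smul_whiskerRight,
      Linear.smul_comp, neg_one_smul, ← MonoidalCategory.tensorHom_def]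
    exact neg_mem hf

lemma Quasidominates.tensor (h : ∀ i j, Quasidominates V (V i ⊗ V j)) {X Y : C}
    (hX : Quasidominates V X) (hY : Quasidominates V Y) : Quasidominates V (X ⊗ Y) := by
  rw [quasidominates_iff k, ← MonoidalCategory.id_tensorHom_id]
  exact quasiIdeal_tensor k h hX.id_mem hY.id_mem

-- Taking mates is additive and contravariant. It keeps negligible morphisms negligible and sends a
-- morphism through `V i` to one through `(V i)ᘁ`.
omit k [Field k] [Linear k C] [MonoidalLinear k C] in
lemma quasiIdeal_dual (h : ∀ i, Quasidominates V (V i)ᘁ) {X Y : C} {f : X ⟶ Y}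
    (hf : f ∈ quasiIdeal V X Y) : fᘁ ∈ quasiIdeal V Yᘁ Xᘁ := by
  -- Packaging the mate as an additive map disposes of the zero and negation cases of the induction.
  let D : (X ⟶ Y) →+ (Yᘁ ⟶ Xᘁ) := AddMonoidHom.mk' (fun f => fᘁ) rightAdjointMate_add
  change D f ∈ _
  induction hf using AddSubgroup.closure_induction with
  | mem f hf =>
    change fᘁ ∈ _
    obtain hf | ⟨i, a, b, rfl⟩ := hf
    · rw [rightAdjointMate]
      -- By definition the mate of `f` is `f` whiskered on both sides and then composed with
      -- structure morphisms, each of which preserves negligibility.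
      exact (((((hf.whiskerRight _).whiskerLeft _).comp _).precomp _).precomp _).mem_quasiIdeal
    · rw [comp_rightAdjointMate]
      exact quasiIdeal_of_factors (h i).id_mem _ _
  | zero => rw [map_zero]; exact zero_mem _
  | add f f' _ _ hf hf' => rw [map_add]; exact add_mem hf hf'
  | neg f _ hf => rw [map_neg]; exact neg_mem hf

lemma Quasidominates.dual (h : ∀ i, Quasidominates V (V i)ᘁ) {X : C}
    (hX : Quasidominates V X) : Quasidominates V Xᘁ := by
  rw [quasidominates_iff k, ← rightAdjointMate_id]
  exact quasiIdeal_dual h hX.id_mem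

/-- An object through which the identity of `X` factors passes quasidomination on to `X`. -/
lemma Quasidominates.of_retract {X Y : C} (hY : Quasidominates V Y) (a : X ⟶ Y) (b : Y ⟶ X)
    (h : a ≫ b = 𝟙 X) : Quasidominates V X := by
  rw [quasidominates_iff k, ← h]
  exact quasiIdeal_of_factors hY.id_mem a b

/-- If `X` is quasidominated and not negligible, some member of the family admits morphisms to and
from `X` whose composite has nonzero trace. -/
lemma Quasidominates.exists_qtr_ne_zero {X : C} (hX : Quasidominates V X)
    (h : ¬ IsNegligibleObj X) :
    ∃ (i : I) (a : V i ⟶ X) (b : X ⟶ V i), qtr (a ≫ b) ≠ 0 := by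
  -- If all these traces vanished, every summand through the family would be negligible; then so
  -- would `𝟙 X`, which is their sum plus a negligible morphism.
  by_contra! H
  refine h (isNegligible_id_iff.1 ?_)
  obtain ⟨n, s, f, g, hn⟩ := hX
  have hs : ∑ r, g r ≫ f r ∈ negl k X X := sum_mem fun r _ => by
    rw [mem_negl]
    intro c
    -- Cyclicity turns the trace of an endomorphism of `X` passing through `V (s r)` into the trace
    -- of an endomorphism of `V (s r)` passing through `X`, to which `H` applies.
    rw [← Category.assoc, qtr_comp_comm]
    exact H _ _ _
  have := add_mem ((mem_negl k).2 hn) hs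
  rwa [sub_add_cancel] at this

variable [Fintype I] [DecidableEq I]

-- Row `i` of the matrix `S` consists of traces of endomorphisms of `V j ⊗ V i`. If `V i` were
-- negligible these would all vanish, and an invertible matrix has no zero row.
omit [MonoidalPreadditive C] [MonoidalLinear k C] in
lemma IsModularFamily.not_isNegligible_id (h : IsModularFamily k V) (i : I) :
    ¬ IsNegligible (𝟙 (V i)) := by
  intro hi
  obtain ⟨S, hS, hu⟩ := h.smatrix
  obtain ⟨o, ho⟩ := h.unit
  have hz (j : I) : S i j = 0 := by
    have h0 : S i j • 𝟙 (𝟙_ C) = 0 := by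
      rw [hS]
      refine qtr_of_isNegligible ?_
      -- The double braiding is viewed as itself preceded by `V j ◁ 𝟙 (V i)`, which is negligible by
      -- assumption.
      have := (hi.whiskerLeft (V j)).comp ((β_ (V j) (V i)).hom ≫ (β_ (V i) (V j)).hom)
      rwa [MonoidalCategory.whiskerLeft_id, Category.id_comp] at this
    -- The unit object is a member of the family, hence simple, so a scalar is determined by its
    -- multiple of `𝟙 (𝟙_ C)`.
    have hs := h.simple o
    rw [ho] at hs
    exact hs.1 (by simpa using h0)
  obtain ⟨T, hT⟩ := hu.exists_right_inv
  have := congrFun (congrFun hT i) i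
  simp [Matrix.mul_apply, hz] at this

end Linear

end TraceIdeal

/-! ### From quasimodular to modular: passing to the purification. -/

section PurificationModular

variable {k : Type*} [Field k] {C : Type*} [Category C] [MonoidalCategory C] [BraidedCategory C]
  [RightRigidCategory C] [RibbonCategory C] [Preadditive C] [Linear k C] [MonoidalPreadditive C]
  [MonoidalLinear k C] {I : Type*} [Fintype I] [DecidableEq I] {V : I → C}

/-- The purification of a quasimodular category is modular. -/
theorem IsQuasimodular.isModular_purification (h : IsQuasimodular k V) :
    IsModular k (fun i => (⟨V i⟩ : Purification k C)) where
  simple i := by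
    refine ⟨fun c d hcd => ?_, fun f => ?_⟩
    · change Purification.cls k (c • 𝟙 (V i)) = Purification.cls k (d • 𝟙 (V i)) at hcd
      rw [Purification.cls_eq_iff, ← sub_smul] at hcd
      by_contra hne
      -- If `c ≠ d`, dividing the negligible morphism `(c - d) • 𝟙 (V i)` by `c - d` would make `𝟙
      -- (V i)` negligible. Surjectivity below needs only a lift of the class.
      refine h.not_isNegligible_id k i ?_
      have := (negl k (V i) (V i)).smul_mem (c - d)⁻¹ hcd
      rwa [smul_smul, inv_mul_cancel₀ (sub_ne_zero.2 hne), one_smul] at this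
    · obtain ⟨g, rfl⟩ := Purification.cls_surj f
      obtain ⟨c, rfl⟩ := (h.simple i).2 g
      exact ⟨c, rfl⟩
  unit := by
    obtain ⟨i, hi⟩ := h.unit
    exact ⟨i, congrArg (Purification.mk (k := k)) hi⟩
  dual i := by
    obtain ⟨j, ⟨e⟩⟩ := h.dual i
    exact ⟨j, ⟨Purification.clsIso k e⟩⟩
  smatrix := by
    obtain ⟨S, hS, hu⟩ := h.smatrix
    -- Braiding, twist and duality of the purification are classes of the original ones, so the
    -- class of a trace is the trace of the class and the same matrix works.
    exact ⟨S, fun i j => congrArg (Purification.cls k) (hS i j), hu⟩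
  dominates X := by
    obtain ⟨n, s, f, g, hn⟩ := h.quasidominates X.obj
    refine ⟨n, s, fun r => Purification.cls k (f r), fun r => Purification.cls k (g r), ?_⟩
    -- A negligible difference is exactly an equality of classes: quasidomination becomes
    -- domination.
    have h1 := Purification.cls_eq_iff (k := k) |>.2 hn
    refine h1.trans ?_
    exact map_sum (negl k X.obj X.obj).mkQ _ _

end PurificationModular

/-! ### Comparison of a full ribbon subcategory with the ambient category. -/

section FullSubcategoryTransfer

variable {k : Type*} [Field k] {C : Type*} [Category C] [MonoidalCategory C] [BraidedCategory C]
  [RightRigidCategory C] [RibbonCategory C] [Preadditive C] [Linear k C] [MonoidalPreadditive C]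
  [MonoidalLinear k C] {I : Type*} [Fintype I] [DecidableEq I]
  {P : ObjectProperty C} [P.IsMonoidal] [ClosedUnderDual P]

-- Negligibility of `f : X ⟶ Y` is tested only against morphisms `Y ⟶ X`. Fullness gives the same
-- test morphisms in both categories, and the inherited structure gives the same traces.
omit [MonoidalPreadditive C] in
lemma isNegligible_fullSubcategory_iff {X Y : P.FullSubcategory} (f : X ⟶ Y) :
    IsNegligible f ↔ IsNegligible f.hom := by
  constructor
  · intro h g
    exact congrArg (fun f => f.hom) (h (ObjectProperty.homMk g))
  · intro h g
    exact ObjectProperty.hom_ext _ (h g.hom)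

omit [Fintype I] [DecidableEq I] [MonoidalPreadditive C] in
lemma quasidominates_fullSubcategory_iff {V : I → P.FullSubcategory} {X : P.FullSubcategory} :
    Quasidominates V X ↔ Quasidominates (fun i => (V i).obj) X.obj := by
  -- The inclusion functor is additive, so it commutes with forming the error term of
  -- quasidomination.
  have key {n : ℕ} {s : Fin n → I} (f : ∀ r, V (s r) ⟶ X) (g : ∀ r, X ⟶ V (s r)) :
      (𝟙 X - ∑ r, g r ≫ f r).hom = 𝟙 X.obj - ∑ r, (g r).hom ≫ (f r).hom := by
    rw [← ObjectProperty.ι_map, Functor.map_sub, Functor.map_sum]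
    rfl
  constructor
  · rintro ⟨n, s, f, g, h⟩
    refine ⟨n, s, fun r => (f r).hom, fun r => (g r).hom, ?_⟩
    rw [← key]
    exact (isNegligible_fullSubcategory_iff _).1 h
  · rintro ⟨n, s, f, g, h⟩
    refine ⟨n, s, fun r => ObjectProperty.homMk (f r), fun r => ObjectProperty.homMk (g r), ?_⟩
    rw [isNegligible_fullSubcategory_iff, key]
    exact h

-- All conditions on the family concern only its members, the unit object, duals and the morphisms
-- between these, which the full subcategory shares with the ambient category.
omit [MonoidalPreadditive C] [MonoidalLinear k C] in
lemma isModularFamily_fullSubcategory_iff {V : I → P.FullSubcategory} :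
    IsModularFamily k V ↔ IsModularFamily k (fun i => (V i).obj) := by
  -- The two scalar maps differ by the bijection on endomorphisms given by full faithfulness.
  have hs (i) : IsSimpleObj k (V i) ↔ IsSimpleObj k (V i).obj :=
    (Equiv.bijective (P.fullyFaithfulι.homEquiv (X := V i) (Y := V i)) |>.of_comp_iff' _).symm
  constructor
  · intro h
    refine ⟨fun i => (hs i).1 (h.simple i), ?_, fun i => ?_, ?_⟩
    · obtain ⟨i, hi⟩ := h.unit
      exact ⟨i, congrArg (fun X => X.obj) hi⟩
    · obtain ⟨j, ⟨e⟩⟩ := h.dual i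
      exact ⟨j, ⟨P.ι.mapIso e⟩⟩
    · obtain ⟨S, hS, hu⟩ := h.smatrix
      exact ⟨S, fun i j => congrArg (fun f => f.hom) (hS i j), hu⟩
  · intro h
    refine ⟨fun i => (hs i).2 (h.simple i), ?_, fun i => ?_, ?_⟩
    · obtain ⟨i, hi⟩ := h.unit
      exact ⟨i, ObjectProperty.FullSubcategory.ext hi⟩
    · obtain ⟨j, ⟨e⟩⟩ := h.dual i
      exact ⟨j, ⟨P.isoMk e⟩⟩
    · obtain ⟨S, hS, hu⟩ := h.smatrix
      exact ⟨S, fun i j => ObjectProperty.hom_ext _ (hS i j), hu⟩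

end FullSubcategoryTransfer

/-! ### Splitting a module along a section. -/

namespace QGRep

variable {k H : Type u} [Field k] [Ring H] [Algebra k H]

lemma sum_lin {X Y : QGRep k H} {ι : Type*} (s : Finset ι) (f : ι → (X ⟶ Y)) (x : X.carrier) :
    (∑ i ∈ s, f i).lin x = ∑ i ∈ s, (f i).lin x :=
  map_sum (AddMonoidHom.mk' (fun f : X ⟶ Y => f.lin x) fun _ _ => rfl) f s

/-- A submodule as an object of `Rep(H)`. -/
def ofSubmodule (X : QGRep k H) (p : Submodule H X.carrier) : QGRep k H where
  carrier := p
  finite := Module.Finite.of_injective (p.subtype.restrictScalars k) Subtype.val_injective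

/-- The inclusion of a submodule. -/
def ofSubmoduleι (X : QGRep k H) (p : Submodule H X.carrier) : ofSubmodule X p ⟶ X := ⟨p.subtype⟩

/-- If `X ⟶ V` has a section `a`, then `X` is the direct sum of `V` and the kernel. -/
noncomputable def splitEquiv {X V : QGRep k H} (a : V ⟶ X) (b : X ⟶ V) (h : a ≫ b = 𝟙 V) :
    X.carrier ≃ₗ[H] V.carrier × (ofSubmodule X (LinearMap.ker b.lin)).carrier where
  toFun x := (b.lin x, ⟨x - a.lin (b.lin x), by
    have := congrArg (fun f => f.lin (b.lin x)) h
    simp only [comp_lin, id_lin] at this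
    rw [LinearMap.mem_ker, map_sub, this, sub_self]⟩)
  map_add' x y := Prod.ext (map_add _ _ _) (Subtype.ext (by
    change x + y - _ = x - _ + (y - _)
    rw [map_add, map_add, add_sub_add_comm]))
  map_smul' c x := Prod.ext (map_smul _ _ _) (Subtype.ext (by
    change c • x - _ = c • (x - _)
    rw [map_smul, map_smul, smul_sub]))
  invFun p := a.lin p.1 + p.2.1
  left_inv x := add_sub_cancel _ _
  right_inv p := by
    have h1 := congrArg (fun f => f.lin p.1) h
    simp only [comp_lin, id_lin] at h1
    have h2 : b.lin (a.lin p.1 + p.2.1) = p.1 := by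
      rw [map_add, h1, LinearMap.mem_ker.1 p.2.2, add_zero]
    exact Prod.ext h2 (Subtype.ext (by
      change a.lin p.1 + p.2.1 - a.lin (b.lin (a.lin p.1 + p.2.1)) = _
      rw [h2, add_sub_cancel_left]))

end QGRep

/-! ### Quasidominated modules are sums of members of the family and a negligible module. -/

namespace QGRep

variable {k H : Type u} [Field k] [Ring H] [Algebra k H] [RibbonQuantumGroupoid k H]
  {I : Type*} {V : I → QGRep k H}

-- On the zero module the scalars `0` and `1` act alike. Nontriviality is what makes the dimension
-- drop strictly when a simple summand is removed.
omit [RibbonQuantumGroupoid k H] in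
lemma nontrivial_of_isSimpleObj {X : QGRep k H} (h : IsSimpleObj k X) : Nontrivial X.carrier := by
  by_contra hn
  rw [not_nontrivial_iff_subsingleton] at hn
  exact one_ne_zero (h.1 (hom_ext fun x => Subsingleton.elim _ _) : (1 : k) = 0)

/-- A module quasidominated by a family of simple modules is a direct sum of members of the family
and a negligible module. -/
theorem exists_decomposition (hV : ∀ i, IsSimpleObj k (V i)) (X : QGRep k H)
    (hX : Quasidominates V X) :
    ∃ (n : ℕ) (s : Fin n → I) (N : QGRep k H), IsNegligibleObj N ∧
      Nonempty (X.carrier ≃ₗ[H] ((r : Fin n) → (V (s r)).carrier) × N.carrier) := by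
  -- Each round splits off one simple summand, so the induction runs over the dimension of what
  -- remains.
  induction hd : Module.finrank k X.carrier using Nat.strong_induction_on generalizing X with
  | _ d ih =>
  by_cases hN : IsNegligibleObj X
  -- The process stops with `X` itself as the remainder; the product over `Fin 0` is a one-point
  -- module.
  · exact ⟨0, Fin.elim0, X, hN, ⟨(LinearEquiv.uniqueProd (R := H)).symm⟩⟩
  obtain ⟨i, a, b, hab⟩ := hX.exists_qtr_ne_zero k hN
  obtain ⟨c, hc⟩ := (hV i).2 (a ≫ b)
  -- Simplicity makes `a ≫ b` a scalar, and a nonzero trace forces that scalar to be nonzero.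
  -- Rescaling `b` by its inverse then turns `a` into a split monomorphism.
  have hc0 : c ≠ 0 := by
    rintro rfl
    rw [← hc] at hab
    exact hab (by simp [qtr_eq, MonoidalPreadditive.zero_whiskerRight])
  have hsplit : a ≫ (c⁻¹ • b) = 𝟙 (V i) := by
    rw [Linear.comp_smul, ← hc, smul_smul, inv_mul_cancel₀ hc0, one_smul]
  let e := splitEquiv a (c⁻¹ • b) hsplit
  let X' := ofSubmodule X (LinearMap.ker (c⁻¹ • b).lin)
  -- The complement is a retract of `X`, by the inclusion of the kernel and the second projection of
  -- the splitting, so the induction hypothesis applies to it.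
  have hX' : Quasidominates V X' :=
    hX.of_retract k (ofSubmoduleι X _) ⟨LinearMap.snd H _ _ ∘ₗ e.toLinearMap⟩
      (hom_ext fun y => Subtype.ext (by
        change y.1 - a.lin ((c⁻¹ • b).lin y.1) = y.1
        rw [LinearMap.mem_ker.1 y.2, map_zero, sub_zero]))
  have hdim : Module.finrank k X'.carrier < d := by
    have h1 := (e.restrictScalars k).finrank_eq
    rw [Module.finrank_prod, hd] at h1
    have := nontrivial_of_isSimpleObj (hV i)
    have h2 : 0 < Module.finrank k (V i).carrier := Module.finrank_pos
    change d = _ + Module.finrank k X'.carrier at h1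
    omega
  obtain ⟨n, s, N, hN', ⟨e'⟩⟩ := ih _ hdim X' hX' rfl
  refine ⟨n + 1, Fin.cons i s, N, hN', ⟨?_⟩⟩
  -- The new summand `V i` is placed at index `0`, in front of those supplied by the induction
  -- hypothesis.
  exact e ≪≫ₗ (LinearEquiv.refl H _).prodCongr e' ≪≫ₗ (LinearEquiv.prodAssoc H _ _ _).symm ≪≫ₗ
    (Fin.consLinearEquiv H
      (fun r => (V ((Fin.cons i s : Fin (n + 1) → I) r)).carrier)).prodCongr (LinearEquiv.refl H _)

/-- The inclusions and projections of the simple summands are the required morphisms. What they miss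
is the projector onto `N`, which is negligible because it factors through `N`. -/
lemma quasidominates_of_decomposition {X N : QGRep k H} (hN : IsNegligibleObj N) {n : ℕ}
    {s : Fin n → I}
    (e : X.carrier ≃ₗ[H] ((r : Fin n) → (V (s r)).carrier) × N.carrier) :
    Quasidominates V X := by
  let p : X ⟶ N := ⟨LinearMap.snd H _ _ ∘ₗ e.toLinearMap⟩
  let q : N ⟶ X := ⟨e.symm.toLinearMap ∘ₗ LinearMap.inr H _ _⟩
  refine ⟨n, s,
    fun r => ⟨e.symm.toLinearMap ∘ₗ LinearMap.inl H _ _ ∘ₗ 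
      LinearMap.single H (fun r => (V (s r)).carrier) r⟩,
    fun r => ⟨LinearMap.proj r ∘ₗ LinearMap.fst H _ _ ∘ₗ e.toLinearMap⟩, ?_⟩
  -- The identity of `N` is kept in the middle so that its negligibility carries over to the whole
  -- composite.
  rw [sub_eq_of_eq_add' (c := p ≫ 𝟙 N ≫ q)]
  · exact ((isNegligible_id_iff.2 hN).comp q).precomp p
  refine hom_ext fun x => e.injective ?_
  -- What remains is that the coordinate projectors add up to the identity, checked after applying
  -- `e`, separately in the two factors.
  rw [add_lin, sum_lin, map_add, map_sum]
  simp only [comp_lin, id_lin, p, q, LinearMap.comp_apply, LinearEquiv.coe_coe,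
    LinearEquiv.apply_symm_apply]
  refine Prod.ext ?_ ?_
  · simp only [Prod.fst_add, Prod.fst_sum, LinearMap.inl_apply, LinearMap.inr_apply, add_zero,
      LinearMap.coe_single, LinearMap.proj_apply, LinearMap.fst_apply]
    exact (Finset.univ_sum_single _).symm
  · simp [Prod.snd_sum]

end QGRep

/-! ### The main theorem. -/

/-- The closure properties supply the ribbon structure on the full subcategory, so quasimodularity
can be stated only once they are given; this is why they are quantified first. The two directions of
the equivalence are (a) and (b), and the second conjunct is (c). -/
theorem mainTheorem12 {k H : Type u} [Field k] [Ring H] [Algebra k H] [RibbonQuantumGroupoid k H]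
    {I : Type*} [Fintype I] [DecidableEq I] (V : I → QGRep k H) :
    (IsModularQuantumGroupoid k V ↔
      ∃ (_ : (quasidominated V).IsMonoidal) (_ : ClosedUnderDual (quasidominated V)),
        IsQuasimodular k (quasidominatedFamily V)) ∧
    (∀ (_ : (quasidominated V).IsMonoidal) (_ : ClosedUnderDual (quasidominated V)),
      IsQuasimodular k (quasidominatedFamily V) →
        IsModular k (fun i => (⟨quasidominatedFamily V i⟩ :
          Purification k (quasidominated V).FullSubcategory))) := by
  refine ⟨⟨fun h => ?_, ?_⟩, fun _ _ h => h.isModular_purification⟩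
  · have hunit : quasidominated V (𝟙_ (QGRep k H)) := by
      obtain ⟨i, hi⟩ := h.unit
      rw [← hi]
      exact quasidominated_self V i
    have htensor (i j : I) : Quasidominates V (V i ⊗ V j) := by
      obtain ⟨n, s, N, hN, ⟨e⟩⟩ := h.tensor i j
      exact QGRep.quasidominates_of_decomposition hN e
    have hdual (i : I) : Quasidominates V (V i)ᘁ := by
      obtain ⟨j, ⟨e⟩⟩ := h.dual i
      -- The dual of a member is isomorphic to another member, and an isomorphism is in particular a
      -- retraction.
      exact Quasidominates.of_retract k (quasidominated_self V j) e.inv e.hom e.inv_hom_id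
    have hm : (quasidominated V).IsMonoidal :=
      { prop_unit := hunit
        prop_tensor := fun _ _ hX hY => Quasidominates.tensor k htensor hX hY }
    have hd : ClosedUnderDual (quasidominated V) := ⟨fun _ hX => Quasidominates.dual k hdual hX⟩
    exact ⟨hm, hd,
      { toIsModularFamily := isModularFamily_fullSubcategory_iff.2 h.toIsModularFamily
        quasidominates := fun X => quasidominates_fullSubcategory_iff.2 X.property }⟩
  · rintro ⟨_, _, h⟩
    have hV : IsModularFamily k V := isModularFamily_fullSubcategory_iff.1 h.toIsModularFamily
    exact
      { toIsModularFamily := hV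
        -- Closure under `⊗` is used exactly here: it puts `V a ⊗ V b` among the quasidominated
        -- modules, which can be decomposed.
        tensor := fun a b => QGRep.exists_decomposition hV.simple _
          (ObjectProperty.prop_tensor (Q := quasidominated V) (quasidominated_self V a)
            (quasidominated_self V b)) }
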